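/- Let $(a_\omega(n))_{n\in\mathbb Z}$ and $(V_\omega(n))_{n\in\mathbb Z}$ be real random sequences on a probability space (they may be correlated), and assume that there is $M>0$ such that, almost surely, $\frac1M\le |a_\omega(n)|\le M$ and $|V_\omega(n)|\le M$ for all $n\in\mathbb Z$. Consider the random Jacobi operator $$(H_\omega u)(n)=a_\omega(n+1)u(n+1)+a_\omega(n)u(n-1)+V_\omega(n)u(n)$$ and, for a finite interval $\Lambda\subset\mathbb Z$, let $H_\omega(\Lambda)$ be its restriction to $\ell^2(\Lambda)$ with Dirichlet boundary conditions. For $L\in\mathbb N$ put $\Lambda_L=[1,L]\cap\mathbb Z$. Let $\mathcal I\subset\mathbb R$ be open and bounded, and let $s\in(0,1]$ and $\rho\ge1$. Assume: - **(IAD)** there is $S\in\mathbb N$ such that for any $n$ and any nonempty finite intervals $\Lambda_1,\dots,\Lambda_n$ of $\mathbb Z$ with $\operatorname{dist}(\Lambda_k,\Lambda_{k'})\ge S$ for all $k\ne k'$, the random operators $H_\omega(\Lambda_1),\dots,H_\omega(\Lambda_n)$ are independent; - **(W)** there is $C_W>0$ such that for every compact interval $K\subset\mathcal I$ and every nonempty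 finite interval $\Lambda$ of integers in $\mathbb N=\{0,1,2,\dots\}$, $\ \mathbb P\big[\operatorname{tr}\mathbf 1_K(H_\omega(\Lambda))\ge1\big]\le C_W|K|^s|\Lambda|^\rho$; - **(Loc)** for every $\xi\in(0,1)$, $$\sup_{L}\ \sup_{x\in\Lambda_L}\ \sup_{f}\ \mathbb E\Big(\sum_{y\in\Lambda_L}e^{|y-x|^\xi}\,\big|\langle\delta_x,f(H_\omega(\Lambda_L))\delta_y\rangle\big|\Big)<\infty,$$ where $f$ runs over the Borel functions $\mathbb R\to\mathbb R$ with $|f|\le1$ and (closed) support contained in $\mathcal I$. Let $J\subset\mathcal I$ be compact. 1. For all $p>0$, $\eta>1$, $\beta>\max(1+4s,\rho)$ and $\rho'>\rho$ there exist $C>0$ and $L_0>0$ such that for all $E\in J$, all integers $L\ge L_0$ and all $\epsilon\in(0,1)$, with $l:=(\log L)^\eta$, $$\sum_{k\ge2}\mathbb P\big(\operatorname{tr}\mathbf 1_{[E-\epsilon,E+\epsilon]}(H_\omega(\Lambda_L))\ge k\big)\le C\Big[\big(\epsilon^sL\,l^\beta+e^{-l/8}\big)^2e^{C\epsilon^sL\,l^{\rho'}}+L^{-p}\Big].$$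 2. For all $\alpha\in(0,1)$, $\nu\in(0,\alpha)$, $\beta>1+4s+\rho$ and $\rho'>\rho$ there exist $C>0$ and $L_0>0$ such that for all $E\in J$, all integers $L\ge L_0$ and all $\epsilon\in(0,1)$, with $l:=L^\alpha$, $$\sum_{k\ge2}\mathbb P\big(\operatorname{tr}\mathbf 1_{[E-\epsilon,E+\epsilon]}(H_\omega(\Lambda_L))\ge k\big)\le C\Big[\big(\epsilon^sL\,l^\beta+e^{-l/8}\big)^2e^{C\epsilon^sL\,l^{\rho'}}+e^{-L^\nu}\Big].$$ -/

import Mathlib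

open MeasureTheory ProbabilityTheory
open scoped ENNReal NNReal

/-- The Jacobi operator `(H u)(n) = a(n+1) u(n+1) + a(n) u(n-1) + V(n) u(n)` on sequences. -/
def jacobiOp (a V : ℤ → ℝ) (u : ℤ → ℝ) (n : ℤ) : ℝ :=
  a (n + 1) * u (n + 1) + a n * u (n - 1) + V n * u n

/-- `H(Λ)`: the restriction of the Jacobi operator to `ℓ²(Λ)` with Dirichlet boundary conditions,
as the matrix `⟨δ_i, H δ_j⟩`, `i, j ∈ Λ`. -/
def boxOp (a V : ℤ → ℝ) (Λ : Finset ℤ) : Matrix Λ Λ ℝ :=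
  Matrix.of fun i j => jacobiOp a V (Pi.single (j : ℤ) 1) (i : ℤ)

theorem jacobiOp_single_symm (a V : ℤ → ℝ) (p q : ℤ) :
    jacobiOp a V (Pi.single p 1) q = jacobiOp a V (Pi.single q 1) p := by
  rcases eq_or_ne p q with h | h
  · rw [h]
  rcases eq_or_ne q (p + 1) with h1 | h1
  · subst h1
    have e1 : p + 1 + 1 ≠ p := by omega
    have e2 : p - 1 ≠ p + 1 := by omega
    simp [jacobiOp, e1, e2]
  rcases eq_or_ne p (q + 1) with h2 | h2
  · subst h2
    have e1 : q + 1 + 1 ≠ q := by omega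
    have e2 : q - 1 ≠ q + 1 := by omega
    simp [jacobiOp, e1, e2]
  · have e1 : q - 1 ≠ p := by omega
    have e2 : p - 1 ≠ q := by omega
    simp [jacobiOp, h, h.symm, h1.symm, h2.symm, e1, e2]

theorem boxOp_isHermitian (a V : ℤ → ℝ) (Λ : Finset ℤ) : (boxOp a V Λ).IsHermitian := by
  ext i j
  simpa [boxOp, Matrix.conjTranspose_apply] using jacobiOp_single_symm a V i j

/-- `f(H(Λ))`, by the functional calculus of real symmetric matrices. -/
noncomputable def boxCalc (a V : ℤ → ℝ) (Λ : Finset ℤ) (f : ℝ → ℝ) : Matrix Λ Λ ℝ :=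
  (boxOp_isHermitian a V Λ).cfc f

/-- `tr 1_J(H(Λ))`: the number of eigenvalues of `H(Λ)` in `J`, with multiplicity. -/
noncomputable def specTrace (a V : ℤ → ℝ) (Λ : Finset ℤ) (J : Set ℝ) : ℝ :=
  (boxCalc a V Λ (J.indicator fun _ => 1)).trace

/-- The box `Λ_L = [1, L] ∩ ℤ`. -/
noncomputable def boxL (L : ℕ) : Finset ℤ := Finset.Icc 1 (L : ℤ)

section Assumptions

variable {Ω : Type*} [MeasurableSpace Ω] (μ : Measure Ω) (a V : Ω → ℤ → ℝ)

/-- Independence at a distance: for some `S`, the restrictions of the random operator to finitely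
many nonempty finite intervals of `ℤ` at pairwise distance at least `S` are independent, as random
matrices. -/
def IndepAtDistance : Prop :=
  ∃ S : ℕ, ∀ (n : ℕ) (c d : Fin n → ℤ), (∀ k, c k ≤ d k) →
    (∀ k k' : Fin n, k ≠ k' → ∀ x ∈ Finset.Icc (c k) (d k), ∀ y ∈ Finset.Icc (c k') (d k'),
      (S : ℤ) ≤ |x - y|) →
    iIndepFun (β := fun k : Fin n =>
        Finset.Icc (c k) (d k) → Finset.Icc (c k) (d k) → ℝ)
      (fun k ω i j => boxOp (a ω) (V ω) (Finset.Icc (c k) (d k)) i j) μ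

/-- Wegner estimate on `I` with exponents `s` (length of the energy interval `[c, d]`) and `ρ`
(volume of the box `{m, …, n} ⊆ ℕ`). -/
def WegnerEstimate (I : Set ℝ) (s ρ : ℝ) : Prop :=
  ∃ C : ℝ, 0 < C ∧ ∀ c d : ℝ, c ≤ d → Set.Icc c d ⊆ I → ∀ m n : ℕ, m ≤ n →
    μ {ω | 1 ≤ specTrace (a ω) (V ω) (Finset.Icc (m : ℤ) (n : ℤ)) (Set.Icc c d)} ≤
      ENNReal.ofReal (C * (d - c) ^ s * ((Finset.Icc (m : ℤ) (n : ℤ)).card : ℝ) ^ ρ)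

/-- Localization in `I`: for every `ξ ∈ (0, 1)`, the quantity
`E (∑_y e^{|y - x|^ξ} |⟨δ_x, f(H_ω(Λ_L)) δ_y⟩|)` is bounded uniformly in `L`, in the base point
`x ∈ Λ_L` and in the Borel functions `f` with `|f| ≤ 1` and `supp f ⊆ I`. The Hilbert-Schmidt norm
of `1_{x} f(H) 1_{y}` is the absolute value of the matrix element, and the terms with `y ∉ Λ_L`
vanish. -/
def LocalizedOn (I : Set ℝ) : Prop :=
  ∀ ξ : ℝ, 0 < ξ → ξ < 1 → ∃ K : ℝ≥0, ∀ (L : ℕ) (x : boxL L) (f : ℝ → ℝ),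
    Measurable f → tsupport f ⊆ I → (∀ t, |f t| ≤ 1) →
    ∫⁻ ω, ∑ y : boxL L, ENNReal.ofReal
      (Real.exp (|((y : ℤ) : ℝ) - ((x : ℤ) : ℝ)| ^ ξ) *
        |boxCalc (a ω) (V ω) (boxL L) f x y|) ∂μ ≤ K

/-- `∑_{k ≥ 2} P(tr 1_{[E-ε, E+ε]}(H_ω(Λ_L)) ≥ k)`. -/
noncomputable def minamiSum (L : ℕ) (E ε : ℝ) : ℝ≥0∞ :=
  ∑' k : ℕ, μ {ω | ((k + 2 : ℕ) : ℝ) ≤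
    specTrace (a ω) (V ω) (boxL L) (Set.Icc (E - ε) (E + ε))}

end Assumptions

/-! Write P for the spectral projection of `H(Λ_L)` on `[E - ε, E + ε]`. By (Loc) and Markov's
inequality its kernel is tiny at distance at least r from the diagonal, outside an event of small
probability (`measure_projKernel_ge_le`). On the good event let X be the set of sites x where P(x,
x) is not negligible. The trace of P is the number N of eigenvalues and each diagonal entry is at
most 1, so N is at most the cardinality of X (`card_eigenvalues_le`).

Suppose N is at least 2. If X is spread out, each site of X is far from one of the two extreme sites
of X, and the row P(x, ·), cut off to a box of radius r, is an approximate eigenvector there. Hence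
N is at most the number of far pairs of sites whose boxes both have an eigenvalue near E, and
independence with two Wegner estimates bounds each pair. If X is clustered, cutting off two
eigenfunctions shows that one interval of `2 R + 1` sites, with R comparable to r, has two
eigenvalues near E.

The second case needs a substitute for Minami's estimate, and here dimension one enters:
`inverse_tunneling`, a deterministic statement, splits the interval into two separated pieces that
each have an eigenvalue within a constant multiple of ε of E. To see why, take orthogonal
eigenfunctions u, v and a block of fixed length, and suppose that no side of the block has an
eigenvalue near E. On the left side u and v solve resolvent equations with a common source, so after
normalization their scalar product there is nonnegative. The ratio of boundary values is a Herglotz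
function of the energy without poles or zeros nearby, hence almost constant
(`herglotz_nearly_constant`). So u and v enter the block almost equal, remain so across it, and have
a positive product on it (`block_nearly_equal`). Orthogonality makes the right-hand product
negative, which the same sign rule on the right allows only if u and v have opposite signs at the
end of the block; they are almost equal there. Thus every block has an eigenvalue on one side, and
sliding the block from one end to the other produces eigenvalues on both sides.

Summing probabilities gives `exists_minamiSum_le`, with an error `L ^ 5 / ε ^ 3 * exp (-r ^ ξ)`.
Taking r close to l and raising very small ε to `exp (-l ^ ξ')`, which monotonicity permits, makes
this error negligible (`bound_at_scale`, `exists_bound_of_scale`). The resulting bound `C * ((ε ^ s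
* L * l ^ β) ^ 2 + err)` is stronger than the one claimed. -/

/-! ### Eigenbasis coordinates of real symmetric matrices -/

section SpectralCoordinates

variable {n : Type*} [Fintype n] [DecidableEq n] {A : Matrix n n ℝ}

/-- The `i`-th entry of the `j`-th normalized eigenvector of a real symmetric matrix. -/
noncomputable def specVec (hA : A.IsHermitian) (j i : n) : ℝ :=
  (hA.eigenvectorUnitary : Matrix n n ℝ) i j

/-- The coordinates of a vector in the eigenbasis of a real symmetric matrix. -/
noncomputable def specCoef (hA : A.IsHermitian) (w : n → ℝ) (j : n) : ℝ :=
  ∑ i, specVec hA j i * w i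

theorem specVec_orth (hA : A.IsHermitian) (j k : n) :
    ∑ i, specVec hA j i * specVec hA k i = if j = k then 1 else 0 := by
  have h := Unitary.coe_star_mul_self hA.eigenvectorUnitary
  have h2 := congrFun (congrFun h j) k
  rw [Matrix.mul_apply, Matrix.one_apply] at h2
  simpa [specVec, Matrix.star_apply] using h2

theorem specVec_complete (hA : A.IsHermitian) (i i' : n) :
    ∑ j, specVec hA j i * specVec hA j i' = if i = i' then 1 else 0 := by
  have h := Unitary.coe_mul_star_self hA.eigenvectorUnitary
  have h2 := congrFun (congrFun h i) i'
  rw [Matrix.mul_apply, Matrix.one_apply] at h2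
  simpa [specVec, Matrix.star_apply] using h2

theorem mulVec_specVec (hA : A.IsHermitian) (j i : n) :
    (A.mulVec (specVec hA j)) i = hA.eigenvalues j * specVec hA j i := by
  have h := congrFun (hA.mulVec_eigenvectorBasis j) i
  exact h

theorem sum_specCoef_mul_specVec (hA : A.IsHermitian) (w : n → ℝ) (i : n) :
    ∑ j, specCoef hA w j * specVec hA j i = w i := by
  simp only [specCoef, Finset.sum_mul]
  rw [Finset.sum_comm]
  have : ∀ y, ∑ x, specVec hA x y * w y * specVec hA x i =
      w y * if y = i then 1 else 0 := by
    intro y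
    rw [← specVec_complete hA y i, Finset.mul_sum]
    exact Finset.sum_congr rfl fun x _ => by ring
  simp [this]

theorem sum_mul_eq_sum_specCoef (hA : A.IsHermitian) (w z : n → ℝ) :
    ∑ i, w i * z i = ∑ j, specCoef hA w j * specCoef hA z j := by
  calc ∑ i, w i * z i = ∑ i, ∑ j, specCoef hA w j * specVec hA j i * z i := by
        refine Finset.sum_congr rfl fun i _ => ?_
        rw [← Finset.sum_mul, sum_specCoef_mul_specVec]
    _ = ∑ j, specCoef hA w j * specCoef hA z j := by
        rw [Finset.sum_comm]
        refine Finset.sum_congr rfl fun j _ => ?_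
        rw [specCoef, specCoef, Finset.mul_sum]
        exact Finset.sum_congr rfl fun i _ => by ring

/-- Symmetry moves `A` onto the eigenvector, so `A - E` is diagonal in these coordinates. Resolvent
equations and approximate eigenvectors are all handled one coordinate at a time through this
identity. -/
theorem specCoef_mulVec_sub (hA : A.IsHermitian) (w : n → ℝ) (E : ℝ) (j : n) :
    specCoef hA (fun i => (A.mulVec w) i - E * w i) j =
      (hA.eigenvalues j - E) * specCoef hA w j := by
  have h1 : ∑ i, specVec hA j i * (A.mulVec w) i =
      hA.eigenvalues j * ∑ i, specVec hA j i * w i := by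
    simp only [Matrix.mulVec, dotProduct, Finset.mul_sum]
    rw [Finset.sum_comm]
    refine Finset.sum_congr rfl fun k _ => ?_
    have := mulVec_specVec hA j k
    rw [← mul_assoc, ← this, Matrix.mulVec, dotProduct, Finset.sum_mul]
    exact Finset.sum_congr rfl fun i _ => by rw [show A k i = A i k by simpa using hA.apply i k]; ring
  simp only [specCoef, mul_sub, Finset.sum_sub_distrib, h1, sub_mul]
  congr 1
  rw [Finset.mul_sum]
  exact Finset.sum_congr rfl fun i _ => by ring

theorem cfc_apply_eq_sum (hA : A.IsHermitian) (f : ℝ → ℝ) (i i' : n) :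
    hA.cfc f i i' = ∑ j, f (hA.eigenvalues j) * specVec hA j i * specVec hA j i' := by
  rw [Matrix.IsHermitian.cfc, Unitary.conjStarAlgAut_apply, Matrix.mul_apply]
  refine Finset.sum_congr rfl fun j _ => ?_
  rw [Matrix.mul_diagonal]
  simp only [specVec, Matrix.star_apply, star_trivial, Function.comp_apply,
    RCLike.ofReal_real_eq_id, id]
  ring

theorem cfc_trace_eq_sum (hA : A.IsHermitian) (f : ℝ → ℝ) :
    (hA.cfc f).trace = ∑ j, f (hA.eigenvalues j) := by
  simp only [Matrix.trace, Matrix.diag, cfc_apply_eq_sum]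
  rw [Finset.sum_comm]
  refine Finset.sum_congr rfl fun j _ => ?_
  have := specVec_orth hA j j
  simp only [mul_assoc, ← Finset.mul_sum, this]
  simp

theorem exists_eigenvalue_eq (hA : A.IsHermitian) {w : n → ℝ} {E : ℝ} (hw : ∃ i, w i ≠ 0)
    (h : ∀ i, (A.mulVec w) i = E * w i) : ∃ j, hA.eigenvalues j = E := by
  by_contra! hne
  obtain ⟨i, hi⟩ := hw
  apply hi
  rw [← sum_specCoef_mul_specVec hA w i]
  refine Finset.sum_eq_zero fun j _ => ?_
  have h1 := specCoef_mulVec_sub hA w E j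
  have h2 : specCoef hA (fun i => (A.mulVec w) i - E * w i) j = 0 := by
    simp [specCoef, h]
  rw [h2] at h1
  have := (mul_eq_zero.1 h1.symm).resolve_left (sub_ne_zero.2 (hne j))
  simp [this]

/-- If two rank-one inhomogeneous equations with the same right hand side are solved at two
energies with no eigenvalue in between, the solutions form an acute angle. -/
theorem inner_resolvent_nonneg (hA : A.IsHermitian) {w z b : n → ℝ} {E₁ E₂ α β lo hi : ℝ}
    (hE₁ : E₁ ∈ Set.Icc lo hi) (hE₂ : E₂ ∈ Set.Icc lo hi)
    (hno : ∀ j, hA.eigenvalues j ∉ Set.Icc lo hi)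
    (hw : ∀ i, (A.mulVec w) i - E₁ * w i = α * b i)
    (hz : ∀ i, (A.mulVec z) i - E₂ * z i = β * b i) :
    0 ≤ α * β * ∑ i, w i * z i := by
  rw [sum_mul_eq_sum_specCoef hA, Finset.mul_sum]
  refine Finset.sum_nonneg fun j _ => ?_
  have h1 := specCoef_mulVec_sub hA w E₁ j
  have h2 := specCoef_mulVec_sub hA z E₂ j
  have e1 : specCoef hA (fun i => (A.mulVec w) i - E₁ * w i) j = α * specCoef hA b j := by
    simp only [hw, specCoef, Finset.mul_sum]
    exact Finset.sum_congr rfl fun i _ => by ring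
  have e2 : specCoef hA (fun i => (A.mulVec z) i - E₂ * z i) j = β * specCoef hA b j := by
    simp only [hz, specCoef, Finset.mul_sum]
    exact Finset.sum_congr rfl fun i _ => by ring
  rw [e1] at h1
  rw [e2] at h2
  -- Both energies lie on the same side of every eigenvalue, so each coordinate contributes a square
  -- divided by a positive number.
  have hpos : 0 < (hA.eigenvalues j - E₁) * (hA.eigenvalues j - E₂) := by
    have := hno j
    rw [Set.mem_Icc, not_and_or, not_le, not_le] at this
    rcases this with h | h
    · exact mul_pos_of_neg_of_neg (by linarith [hE₁.1]) (by linarith [hE₂.1])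
    · exact mul_pos (by linarith [hE₁.2]) (by linarith [hE₂.2])
  refine (mul_nonneg_iff_of_pos_left hpos).1 ?_
  have : (hA.eigenvalues j - E₁) * (hA.eigenvalues j - E₂) *
      (α * β * (specCoef hA w j * specCoef hA z j)) =
      α * β * (((hA.eigenvalues j - E₁) * specCoef hA w j) *
        ((hA.eigenvalues j - E₂) * specCoef hA z j)) := by ring
  rw [this, ← h1, ← h2]
  nlinarith [sq_nonneg (α * β * specCoef hA b j)]

/-- A vector whose spectral support avoids `[E - η, E + η]` is not an approximate eigenvector. -/
theorem lt_sum_sq_mulVec_sub (hA : A.IsHermitian) {w : n → ℝ} {E η : ℝ} (hη : 0 ≤ η)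
    (hw : ∃ i, w i ≠ 0)
    (h : ∀ j, specCoef hA w j ≠ 0 → hA.eigenvalues j ∉ Set.Icc (E - η) (E + η)) :
    η ^ 2 * ∑ i, w i ^ 2 < ∑ i, ((A.mulVec w) i - E * w i) ^ 2 := by
  have e1 := sum_mul_eq_sum_specCoef hA w w
  have e2 := sum_mul_eq_sum_specCoef hA (fun i => (A.mulVec w) i - E * w i)
    (fun i => (A.mulVec w) i - E * w i)
  simp only [specCoef_mulVec_sub] at e2
  simp only [sq (w _), sq ((A.mulVec w) _ - _), e1, e2]
  have key : ∀ j, specCoef hA w j ≠ 0 → η ^ 2 * (specCoef hA w j * specCoef hA w j) <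
      (hA.eigenvalues j - E) * specCoef hA w j * ((hA.eigenvalues j - E) * specCoef hA w j) := by
    intro j hj
    have h1 := h j hj
    have h2 : η ^ 2 < (hA.eigenvalues j - E) ^ 2 := by
      rw [Set.mem_Icc, not_and_or, not_le, not_le] at h1
      rcases h1 with h1 | h1 <;> nlinarith
    have h3 : 0 < specCoef hA w j ^ 2 := by positivity
    nlinarith
  rw [Finset.mul_sum]
  refine Finset.sum_lt_sum (fun j _ => ?_) ?_
  · by_cases hj : specCoef hA w j = 0
    · simp [hj]
    · exact (key j hj).le
  · obtain ⟨i, hi⟩ := hw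
    have : ∃ j, specCoef hA w j ≠ 0 := by
      by_contra! h0
      apply hi
      rw [← sum_specCoef_mul_specVec hA w i]
      simp [h0]
    obtain ⟨j, hj⟩ := this
    exact ⟨j, Finset.mem_univ _, key j hj⟩

/-- The resolvent equation `(A - t) z = b` away from the spectrum. -/
theorem exists_resolvent (hA : A.IsHermitian) (b : n → ℝ) {t : ℝ}
    (ht : ∀ j, hA.eigenvalues j ≠ t) :
    ∃ z : n → ℝ, (∀ i, (A.mulVec z) i - t * z i = b i) ∧
      ∑ i, b i * z i = ∑ j, specCoef hA b j ^ 2 / (hA.eigenvalues j - t) := by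
  let z : n → ℝ := fun i => ∑ j, specCoef hA b j / (hA.eigenvalues j - t) * specVec hA j i
  have hz : ∀ j, specCoef hA z j = specCoef hA b j / (hA.eigenvalues j - t) := by
    intro j
    simp only [specCoef, z, Finset.mul_sum]
    rw [Finset.sum_comm]
    have : ∀ k, ∑ i, specVec hA j i * ((∑ i, specVec hA k i * b i) / (hA.eigenvalues k - t) *
        specVec hA k i) = (∑ i, specVec hA k i * b i) / (hA.eigenvalues k - t) *
          if j = k then 1 else 0 := by
      intro k
      rw [← specVec_orth hA j k, Finset.mul_sum]
      exact Finset.sum_congr rfl fun i _ => by ring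
    simp only [this]
    simp
  refine ⟨z, fun i => ?_, ?_⟩
  · rw [← sum_specCoef_mul_specVec hA (fun i => (A.mulVec z) i - t * z i) i,
      ← sum_specCoef_mul_specVec hA b i]
    refine Finset.sum_congr rfl fun j _ => ?_
    rw [specCoef_mulVec_sub, hz, mul_div_cancel₀ _ (sub_ne_zero.2 (ht j))]
  · rw [sum_mul_eq_sum_specCoef hA]
    refine Finset.sum_congr rfl fun j _ => ?_
    rw [hz]; ring

end SpectralCoordinates

/-! ### Herglotz functions and resolvent matrix elements -/

/-- A partial fraction with positive weights that has neither poles nor zeros in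
`[E - D, E + D]` is nearly constant, multiplicatively, well inside this interval. -/
theorem herglotz_nearly_constant {ι : Type*} [Fintype ι] (lam om : ι → ℝ) (hom : ∀ j, 0 ≤ om j)
    {E D ε E₁ E₂ : ℝ} (hε : 0 ≤ ε) (hD : 0 < D) (hεD : 8 * ε ≤ D)
    (hlam : ∀ j, lam j ∉ Set.Icc (E - D) (E + D))
    (hg : ∀ t ∈ Set.Icc (E - D) (E + D), ∑ j, om j / (lam j - t) ≠ 0)
    (h₁ : E₁ ∈ Set.Icc (E - ε) (E + ε)) (h₂ : E₂ ∈ Set.Icc (E - ε) (E + ε)) :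
    |∑ j, om j / (lam j - E₁) - ∑ j, om j / (lam j - E₂)| ≤
      16 * (ε / D) * |∑ j, om j / (lam j - E₁)| := by
  obtain ⟨h1a, h1b⟩ := h₁
  obtain ⟨h2a, h2b⟩ := h₂
  set g : ℝ → ℝ := fun t => ∑ j, om j / (lam j - t) with hgdef
  set P := ∑ j, om j / (lam j - E₁) ^ 2 with hP
  have hne : ∀ t ∈ Set.Icc (E - D) (E + D), ∀ j, lam j - t ≠ 0 := by
    intro t ht j h0
    apply hlam j
    rwa [sub_eq_zero.1 h0]
  have hcont : ContinuousOn g (Set.Icc (E - D) (E + D)) := by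
    refine continuousOn_finsetSum _ fun j _ => ?_
    exact continuousOn_const.div (by fun_prop) fun t ht => hne t ht j
  -- Continuous without zeros, `g` keeps one sign on the interval.
  have hsign : ∀ t ∈ Set.Icc (E - D) (E + D), 0 < g E₁ * g t := by
    intro t ht
    have hE1 : E₁ ∈ Set.Icc (E - D) (E + D) := ⟨by linarith, by linarith⟩
    by_contra! hle
    have hsub : Set.uIcc E₁ t ⊆ Set.Icc (E - D) (E + D) := Set.ordConnected_Icc.uIcc_subset hE1 ht
    have h0 : (0 : ℝ) ∈ Set.uIcc (g E₁) (g t) := by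
      rw [Set.mem_uIcc]
      rcases le_total (g E₁) 0 with h | h
      · left; refine ⟨h, ?_⟩
        by_contra! h'
        have := mul_pos_of_neg_of_neg (lt_of_le_of_ne h (hg _ hE1)) h'
        linarith
      · right; refine ⟨?_, h⟩
        by_contra! h'
        have := mul_pos (lt_of_le_of_ne h (hg _ hE1).symm) h'
        linarith
    obtain ⟨c, hc, hc0⟩ := intermediate_value_uIcc (hcont.mono hsub) h0
    exact hg c (hsub hc) hc0
  have hdiff : ∀ t ∈ Set.Icc (E - D) (E + D),
      g E₁ - g t = ∑ j, (E₁ - t) * (om j / ((lam j - E₁) * (lam j - t))) := by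
    intro t ht
    simp only [hgdef, ← Finset.sum_sub_distrib]
    refine Finset.sum_congr rfl fun j _ => ?_
    have a1 := hne E₁ ⟨by linarith, by linarith⟩ j
    have a2 := hne t ht j
    field_simp
    ring
  have hcase : ∀ j, lam j - E < -D ∨ D < lam j - E := by
    intro j
    have := hlam j
    rw [Set.mem_Icc, not_and_or, not_le, not_le] at this
    rcases this with h | h
    · left; linarith
    · right; linarith
  have hPnn : 0 ≤ P := Finset.sum_nonneg fun j _ => div_nonneg (hom j) (sq_nonneg _)
  -- comparison of the weights
  have hcmp : ∀ t, |t - E₁| ≤ D / 2 → ∀ j,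
      om j / (lam j - E₁) ^ 2 / 2 ≤ om j / ((lam j - E₁) * (lam j - t)) := by
    intro t ht j
    obtain ⟨t1, t2⟩ := abs_le.1 ht
    have hp : 0 < (lam j - E₁) * (lam j - t) := by
      rcases hcase j with h | h
      · exact mul_pos_of_neg_of_neg (by linarith) (by linarith)
      · exact mul_pos (by linarith) (by linarith)
    have hq : (lam j - E₁) * (lam j - t) ≤ 2 * (lam j - E₁) ^ 2 := by
      rcases hcase j with h | h
      · nlinarith
      · nlinarith
    rw [div_div, mul_comm _ (2 : ℝ)]
    exact div_le_div_of_nonneg_left (hom j) hp hq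
  have hup : ∀ j, |om j / ((lam j - E₁) * (lam j - E₂))| ≤ 2 * (om j / (lam j - E₁) ^ 2) := by
    intro j
    have hp : 0 < (lam j - E₁) * (lam j - E₂) := by
      rcases hcase j with h | h
      · exact mul_pos_of_neg_of_neg (by linarith) (by linarith)
      · exact mul_pos (by linarith) (by linarith)
    have hq : (lam j - E₁) ^ 2 / 2 ≤ (lam j - E₁) * (lam j - E₂) := by
      rcases hcase j with h | h
      · nlinarith
      · nlinarith
    have hs : 0 < (lam j - E₁) ^ 2 := by
      have := hne E₁ ⟨by linarith, by linarith⟩ j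
      positivity
    rw [abs_of_nonneg (div_nonneg (hom j) hp.le)]
    calc om j / ((lam j - E₁) * (lam j - E₂)) ≤ om j / ((lam j - E₁) ^ 2 / 2) :=
          div_le_div_of_nonneg_left (hom j) (by positivity) hq
      _ = 2 * (om j / (lam j - E₁) ^ 2) := by field_simp
  -- `g` is increasing on the interval and `P` is its derivative at `E₁`. Moving by `D / 2` in the
  -- direction in which `|g|` decreases changes `g` by at least `D / 2 * (P / 2)` without reaching
  -- zero, so `|g E₁|` exceeds that amount.
  have hlow : D / 4 * P ≤ |g E₁| := by
    have hE1 : g E₁ ≠ 0 := hg _ ⟨by linarith, by linarith⟩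
    rcases lt_or_gt_of_ne hE1 with h | h
    · have ht : E₁ + D / 2 ∈ Set.Icc (E - D) (E + D) := ⟨by linarith, by linarith⟩
      have h2 := hsign _ ht
      have h3 : g (E₁ + D / 2) < 0 := by
        by_contra! h'
        nlinarith
      have h4 := hdiff _ ht
      have h5 : D / 2 * (P / 2) ≤ g (E₁ + D / 2) - g E₁ := by
        have : g (E₁ + D / 2) - g E₁ =
            D / 2 * ∑ j, om j / ((lam j - E₁) * (lam j - (E₁ + D / 2))) := by
          rw [Finset.mul_sum, ← neg_sub, h4, ← Finset.sum_neg_distrib]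
          exact Finset.sum_congr rfl fun j _ => by ring
        rw [this]
        refine mul_le_mul_of_nonneg_left ?_ (by linarith)
        rw [hP, Finset.sum_div]
        exact Finset.sum_le_sum fun j _ =>
          hcmp _ (by rw [abs_of_nonneg] <;> linarith) j
      rw [abs_of_neg h]
      linarith
    · have ht : E₁ - D / 2 ∈ Set.Icc (E - D) (E + D) := ⟨by linarith, by linarith⟩
      have h2 := hsign _ ht
      have h3 : 0 < g (E₁ - D / 2) := by
        by_contra! h'
        nlinarith
      have h4 := hdiff _ ht
      have h5 : D / 2 * (P / 2) ≤ g E₁ - g (E₁ - D / 2) := by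
        rw [h4, ← Finset.mul_sum, show E₁ - (E₁ - D / 2) = D / 2 by ring]
        refine mul_le_mul_of_nonneg_left ?_ (by linarith)
        rw [hP, Finset.sum_div]
        exact Finset.sum_le_sum fun j _ =>
          hcmp _ (by rw [abs_of_nonpos] <;> linarith) j
      rw [abs_of_pos h]
      linarith
  change |g E₁ - g E₂| ≤ 16 * (ε / D) * |g E₁|
  rw [hdiff E₂ ⟨by linarith, by linarith⟩, ← Finset.mul_sum, abs_mul]
  have h6 : |∑ j, om j / ((lam j - E₁) * (lam j - E₂))| ≤ 2 * P := by
    rw [hP, Finset.mul_sum]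
    exact (Finset.abs_sum_le_sum_abs _ _).trans (Finset.sum_le_sum fun j _ => hup j)
  have h7 : |E₁ - E₂| ≤ 2 * ε := by rw [abs_le]; constructor <;> linarith
  calc |E₁ - E₂| * |∑ j, om j / ((lam j - E₁) * (lam j - E₂))| ≤ 2 * ε * (2 * P) := by gcongr
    _ = 16 * (ε / D) * (D / 4 * P) := by field_simp; ring
    _ ≤ 16 * (ε / D) * |g E₁| := by gcongr

/-- Away from the spectrum `w` is forced to be α times the resolvent applied to `b`. With `b` a
delta at an endpoint, this reads a boundary value off the Herglotz function. -/
theorem inner_of_resolvent_eq {n : Type*} [Fintype n] [DecidableEq n] {A : Matrix n n ℝ}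
    (hA : A.IsHermitian) {w b : n → ℝ} {t α : ℝ} (ht : ∀ j, hA.eigenvalues j ≠ t)
    (hw : ∀ i, (A.mulVec w) i - t * w i = α * b i) :
    ∑ i, b i * w i = α * ∑ j, specCoef hA b j ^ 2 / (hA.eigenvalues j - t) := by
  rw [sum_mul_eq_sum_specCoef hA, Finset.mul_sum]
  refine Finset.sum_congr rfl fun j _ => ?_
  have h1 := specCoef_mulVec_sub hA w t j
  have e1 : specCoef hA (fun i => (A.mulVec w) i - t * w i) j = α * specCoef hA b j := by
    simp only [hw, specCoef, Finset.mul_sum]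
    exact Finset.sum_congr rfl fun i _ => by ring
  rw [e1] at h1
  have h0 := sub_ne_zero.2 (ht j)
  field_simp
  linear_combination (-specCoef hA b j) * h1

/-! ### Box operators and Dirichlet eigenfunctions on ℤ -/

section Boxes

variable {a V : ℤ → ℝ}

/-- `u` is an eigenfunction of `H(Λ)` at energy `E`, extended by zero to `ℤ`. -/
def IsBoxEigenfunction (a V : ℤ → ℝ) (Λ : Finset ℤ) (E : ℝ) (u : ℤ → ℝ) : Prop :=
  (∃ n, u n ≠ 0) ∧ (∀ n ∉ Λ, u n = 0) ∧ ∀ n ∈ Λ, jacobiOp a V u n = E * u n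

/-- `H(Λ)` has an eigenvalue in `K`. -/
def HasEigenvalueIn (a V : ℤ → ℝ) (Λ : Finset ℤ) (K : Set ℝ) : Prop :=
  ∃ E ∈ K, ∃ u, IsBoxEigenfunction a V Λ E u

theorem boxOp_mulVec (Λ : Finset ℤ) (u : ℤ → ℝ) (i : Λ) :
    (boxOp a V Λ).mulVec (fun j : Λ => u j) i =
      jacobiOp a V (fun n => if n ∈ Λ then u n else 0) i := by
  have key : ∀ m : ℤ, ∑ j ∈ Λ, (Pi.single j 1 : ℤ → ℝ) m * u j = if m ∈ Λ then u m else 0 := by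
    intro m
    simp only [Pi.single_apply, ite_mul, one_mul, zero_mul]
    rw [Finset.sum_ite_eq]
  rw [Matrix.mulVec, dotProduct]
  simp only [boxOp, Matrix.of_apply]
  rw [Finset.sum_coe_sort Λ (fun j => jacobiOp a V (Pi.single j 1) i * u j)]
  simp only [jacobiOp, ← key, Finset.mul_sum, ← Finset.sum_add_distrib]
  exact Finset.sum_congr rfl fun j _ => by ring

theorem boxOp_mulVec_of_support {Λ : Finset ℤ} {u : ℤ → ℝ} (hu : ∀ n ∉ Λ, u n = 0) (i : Λ) :
    (boxOp a V Λ).mulVec (fun j : Λ => u j) i = jacobiOp a V u i := by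
  rw [boxOp_mulVec]
  congr 1
  funext n
  split_ifs with h
  · rfl
  · exact (hu n h).symm

/-- A tridiagonal operator feels a cutoff only through the two bonds leaving the interval. These
boundary terms are the sources in the resolvent equations and the errors in the truncation
estimates. -/
theorem jacobiOp_truncate {p q n : ℤ} (u : ℤ → ℝ) (hn : n ∈ Finset.Icc p q) :
    jacobiOp a V (fun m => if m ∈ Finset.Icc p q then u m else 0) n = jacobiOp a V u n -
      (if n = q then a (q + 1) * u (q + 1) else 0) - if n = p then a p * u (p - 1) else 0 := by
  rw [Finset.mem_Icc] at hn
  simp only [jacobiOp, Finset.mem_Icc]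
  have h1 : (p ≤ n ∧ n ≤ q) := hn
  have h2 : (p ≤ n + 1 ∧ n + 1 ≤ q) ↔ n ≠ q := by omega
  have h3 : (p ≤ n - 1 ∧ n - 1 ≤ q) ↔ n ≠ p := by omega
  simp only [h1, h2, h3, and_self, if_true]
  rcases eq_or_ne n q with rfl | hq <;> rcases eq_or_ne n p with rfl | hp <;>
    simp [*] <;> ring

/-- Zero extension of a vector indexed by a finite set of integers. -/
noncomputable def zeroExtend {Λ : Finset ℤ} (w : Λ → ℝ) (n : ℤ) : ℝ :=
  if h : n ∈ Λ then w ⟨n, h⟩ else 0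

theorem zeroExtend_coe {Λ : Finset ℤ} (w : Λ → ℝ) (i : Λ) : zeroExtend w i = w i := by
  simp [zeroExtend]

theorem zeroExtend_of_notMem {Λ : Finset ℤ} (w : Λ → ℝ) {n : ℤ} (h : n ∉ Λ) :
    zeroExtend w n = 0 := by
  simp [zeroExtend, h]

theorem boxOp_mulVec_zeroExtend {Λ : Finset ℤ} (w : Λ → ℝ) (i : Λ) :
    (boxOp a V Λ).mulVec w i = jacobiOp a V (zeroExtend w) i := by
  rw [← boxOp_mulVec_of_support (fun n h => zeroExtend_of_notMem w h)]
  simp only [zeroExtend_coe]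

theorem isBoxEigenfunction_specVec (Λ : Finset ℤ) (j : Λ) :
    IsBoxEigenfunction a V Λ ((boxOp_isHermitian a V Λ).eigenvalues j)
      (zeroExtend (specVec (boxOp_isHermitian a V Λ) j)) := by
  refine ⟨?_, fun n h => zeroExtend_of_notMem _ h, fun n hn => ?_⟩
  · by_contra! h
    have h1 := specVec_orth (boxOp_isHermitian a V Λ) j j
    have h2 : ∀ i : Λ, specVec (boxOp_isHermitian a V Λ) j i = 0 := fun i => by
      rw [← zeroExtend_coe (specVec (boxOp_isHermitian a V Λ) j) i, h]
    simp [h2] at h1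
  · have := mulVec_specVec (boxOp_isHermitian a V Λ) j ⟨n, hn⟩
    rw [boxOp_mulVec_zeroExtend] at this
    rw [this, zeroExtend, dif_pos hn]

theorem hasEigenvalueIn_iff (Λ : Finset ℤ) (K : Set ℝ) :
    HasEigenvalueIn a V Λ K ↔ ∃ j, (boxOp_isHermitian a V Λ).eigenvalues j ∈ K := by
  constructor
  · rintro ⟨E, hE, u, ⟨m, hm⟩, hu0, hu⟩
    obtain ⟨j, hj⟩ := exists_eigenvalue_eq (boxOp_isHermitian a V Λ) (w := fun j : Λ => u j)
      (E := E) ⟨⟨m, by by_contra h; exact hm (hu0 m h)⟩, hm⟩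
      (fun i => by rw [boxOp_mulVec_of_support hu0]; exact hu i i.2)
    exact ⟨j, hj ▸ hE⟩
  · rintro ⟨j, hj⟩
    exact ⟨_, hj, _, isBoxEigenfunction_specVec Λ j⟩

theorem specTrace_eq_card (Λ : Finset ℤ) (K : Set ℝ) [DecidablePred (· ∈ K)] :
    specTrace a V Λ K = ((Finset.univ.filter fun j : Λ =>
      (boxOp_isHermitian a V Λ).eigenvalues j ∈ K).card : ℝ) := by
  rw [specTrace, boxCalc, cfc_trace_eq_sum, Finset.card_filter]
  push_cast
  refine Finset.sum_congr rfl fun j _ => ?_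
  simp [Set.indicator_apply]

theorem one_le_specTrace_iff (Λ : Finset ℤ) (K : Set ℝ) :
    1 ≤ specTrace a V Λ K ↔ HasEigenvalueIn a V Λ K := by
  classical
  rw [specTrace_eq_card, hasEigenvalueIn_iff, Nat.one_le_cast, Nat.one_le_iff_ne_zero,
    Finset.card_ne_zero]
  simp [Finset.Nonempty]

theorem not_hasEigenvalueIn_of_lt {p q : ℤ} (h : q < p) (K : Set ℝ) :
    ¬HasEigenvalueIn a V (Finset.Icc p q) K := by
  rintro ⟨E, -, u, ⟨n, hn⟩, hu, -⟩
  exact hn (hu n (by rw [Finset.mem_Icc]; omega))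

end Boxes

/-! ### Sign and ratio of two solutions at the edge of a spectrum-free box -/

section Tunneling

variable {a V : ℤ → ℝ} {c d k : ℤ} {u v : ℤ → ℝ} {E₁ E₂ lo hi : ℝ}

/-- The Dirichlet condition removes the boundary term at `c`, so the cutoff at `k` leaves a single
point source. Its location does not depend on the solution or on the energy, which allows two
solutions to be compared. -/
theorem left_boundary_eq (hu0 : ∀ n < c, u n = 0)
    (hu : ∀ n ∈ Finset.Icc c k, jacobiOp a V u n = E₁ * u n) (i : Finset.Icc c k) :
    (boxOp a V (Finset.Icc c k)).mulVec (fun j : Finset.Icc c k => u j) i - E₁ * u i =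
      -(a (k + 1) * u (k + 1)) * (if (i : ℤ) = k then 1 else 0) := by
  rw [boxOp_mulVec, jacobiOp_truncate u i.2, hu i i.2, hu0 (c - 1) (by omega)]
  split_ifs <;> ring

theorem right_boundary_eq (hu0 : ∀ n > d, u n = 0)
    (hu : ∀ n ∈ Finset.Icc k d, jacobiOp a V u n = E₁ * u n) (i : Finset.Icc k d) :
    (boxOp a V (Finset.Icc k d)).mulVec (fun j : Finset.Icc k d => u j) i - E₁ * u i =
      -(a k * u (k - 1)) * (if (i : ℤ) = k then 1 else 0) := by
  rw [boxOp_mulVec, jacobiOp_truncate u i.2, hu i i.2, hu0 (d + 1) (by omega)]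
  split_ifs <;> ring

/-- Both solutions are resolvents applied to the same delta at `k`, with amplitudes proportional to
their values at `k + 1`. Thus `inner_resolvent_nonneg` applies, and the common factor `a (k + 1) ^
2` is divided out. -/
theorem left_sign (ha : a (k + 1) ≠ 0) (hE₁ : E₁ ∈ Set.Icc lo hi) (hE₂ : E₂ ∈ Set.Icc lo hi)
    (hu0 : ∀ n < c, u n = 0) (hv0 : ∀ n < c, v n = 0)
    (hu : ∀ n ∈ Finset.Icc c k, jacobiOp a V u n = E₁ * u n)
    (hv : ∀ n ∈ Finset.Icc c k, jacobiOp a V v n = E₂ * v n)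
    (hno : ¬HasEigenvalueIn a V (Finset.Icc c k) (Set.Icc lo hi)) :
    0 ≤ u (k + 1) * v (k + 1) * ∑ n ∈ Finset.Icc c k, u n * v n := by
  rw [hasEigenvalueIn_iff] at hno
  push Not at hno
  have h := inner_resolvent_nonneg (boxOp_isHermitian a V (Finset.Icc c k)) hE₁ hE₂ hno
    (left_boundary_eq hu0 hu) (left_boundary_eq hv0 hv)
  rw [Finset.sum_coe_sort (Finset.Icc c k) (fun n => u n * v n)] at h
  have h2 : 0 < a (k + 1) ^ 2 := by positivity
  refine (mul_nonneg_iff_of_pos_left h2).1 ?_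
  linarith

theorem right_sign (ha : a k ≠ 0) (hE₁ : E₁ ∈ Set.Icc lo hi) (hE₂ : E₂ ∈ Set.Icc lo hi)
    (hu0 : ∀ n > d, u n = 0) (hv0 : ∀ n > d, v n = 0)
    (hu : ∀ n ∈ Finset.Icc k d, jacobiOp a V u n = E₁ * u n)
    (hv : ∀ n ∈ Finset.Icc k d, jacobiOp a V v n = E₂ * v n)
    (hno : ¬HasEigenvalueIn a V (Finset.Icc k d) (Set.Icc lo hi)) :
    0 ≤ u (k - 1) * v (k - 1) * ∑ n ∈ Finset.Icc k d, u n * v n := by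
  rw [hasEigenvalueIn_iff] at hno
  push Not at hno
  have h := inner_resolvent_nonneg (boxOp_isHermitian a V (Finset.Icc k d)) hE₁ hE₂ hno
    (right_boundary_eq hu0 hu) (right_boundary_eq hv0 hv)
  rw [Finset.sum_coe_sort (Finset.Icc k d) (fun n => u n * v n)] at h
  have h2 : 0 < a k ^ 2 := by positivity
  refine (mul_nonneg_iff_of_pos_left h2).1 ?_
  linarith

/-- Let g(t) be the diagonal entry at `k` of the resolvent of the left box. Then u(k) = -a(k+1)
u(k+1) g(E₁), and likewise for `v` with E₂, so the Wronskian-like difference is proportional to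
g(E₁) - g(E₂). Poles of g are eigenvalues of `[c, k]` and zeros are eigenvalues of `[c, k - 1]`;
excluding both makes g nearly constant. -/
theorem left_ratio {E D ε : ℝ} (hck : c ≤ k) (hε : 0 ≤ ε) (hD : 0 < D) (hεD : 8 * ε ≤ D)
    (hE₁ : E₁ ∈ Set.Icc (E - ε) (E + ε)) (hE₂ : E₂ ∈ Set.Icc (E - ε) (E + ε))
    (hu0 : ∀ n < c, u n = 0) (hv0 : ∀ n < c, v n = 0)
    (hu : ∀ n ∈ Finset.Icc c k, jacobiOp a V u n = E₁ * u n)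
    (hv : ∀ n ∈ Finset.Icc c k, jacobiOp a V v n = E₂ * v n)
    (hno : ¬HasEigenvalueIn a V (Finset.Icc c k) (Set.Icc (E - D) (E + D)))
    (hno' : ¬HasEigenvalueIn a V (Finset.Icc c (k - 1)) (Set.Icc (E - D) (E + D))) :
    |u k * v (k + 1) - u (k + 1) * v k| ≤ 16 * (ε / D) * |u k * v (k + 1)| := by
  set hA := boxOp_isHermitian a V (Finset.Icc c k)
  rw [hasEigenvalueIn_iff] at hno
  push Not at hno
  have hno2 : ∀ t ∈ Set.Icc (E - D) (E + D), ∀ j, hA.eigenvalues j ≠ t :=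
    fun t ht j h => hno j (h ▸ ht)
  set b : Finset.Icc c k → ℝ := fun i => if (i : ℤ) = k then 1 else 0 with hb
  have hbsum : ∀ w : ℤ → ℝ, ∑ i, b i * w i = w k := by
    intro w
    rw [hb, Finset.sum_coe_sort (Finset.Icc c k) (fun i => (if i = k then (1 : ℝ) else 0) * w i)]
    simp [hck]
  have hg : ∀ t ∈ Set.Icc (E - D) (E + D),
      ∑ j, specCoef hA b j ^ 2 / (hA.eigenvalues j - t) ≠ 0 := by
    -- At a zero of g the resolvent vector vanishes at `k`, hence is a Dirichlet eigenfunction of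
    -- the box shortened by one site. It is not the zero vector because of the unit source at `k`.
    intro t ht h0
    obtain ⟨z, hz, hz2⟩ := exists_resolvent hA b (hno2 t ht)
    have hzk : zeroExtend z k = 0 := by
      rw [← hbsum (zeroExtend z), ← h0, ← hz2]
      simp only [zeroExtend_coe]
    apply hno'
    refine ⟨t, ht, zeroExtend z, ?_, ?_, ?_⟩
    · by_contra! h
      have h1 := hz ⟨k, by simp [hck]⟩
      rw [boxOp_mulVec_zeroExtend, ← zeroExtend_coe z] at h1
      simp [jacobiOp, h, hb] at h1
    · intro n hn
      rcases eq_or_ne n k with rfl | hnk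
      · exact hzk
      · apply zeroExtend_of_notMem
        rw [Finset.mem_Icc] at hn ⊢
        omega
    · intro n hn
      rw [Finset.mem_Icc] at hn
      have h1 := hz ⟨n, by rw [Finset.mem_Icc]; omega⟩
      rw [boxOp_mulVec_zeroExtend, ← zeroExtend_coe z] at h1
      have h2 : n ≠ k := by omega
      simp only [hb, h2, if_false] at h1
      linarith
  have hmem : ∀ t ∈ Set.Icc (E - ε) (E + ε), t ∈ Set.Icc (E - D) (E + D) := fun t ht =>
    ⟨by linarith [ht.1], by linarith [ht.2]⟩
  have h1 := inner_of_resolvent_eq hA (hno2 _ (hmem _ hE₁)) (left_boundary_eq hu0 hu)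
  have h2 := inner_of_resolvent_eq hA (hno2 _ (hmem _ hE₂)) (left_boundary_eq hv0 hv)
  have key := herglotz_nearly_constant hA.eigenvalues (fun j => specCoef hA b j ^ 2)
    (fun j => sq_nonneg _) hε hD hεD hno hg hE₁ hE₂
  change ∑ i, b i * u i = _ * ∑ j, specCoef hA b j ^ 2 / _ at h1
  change ∑ i, b i * v i = _ * ∑ j, specCoef hA b j ^ 2 / _ at h2
  rw [hbsum] at h1 h2
  set g₁ := ∑ j, specCoef hA b j ^ 2 / (hA.eigenvalues j - E₁)
  set g₂ := ∑ j, specCoef hA b j ^ 2 / (hA.eigenvalues j - E₂)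
  have e1 : u k * v (k + 1) - u (k + 1) * v k =
      -(a (k + 1) * u (k + 1) * v (k + 1)) * (g₁ - g₂) := by rw [h1, h2]; ring
  have e2 : u k * v (k + 1) = -(a (k + 1) * u (k + 1) * v (k + 1)) * g₁ := by rw [h1]; ring
  rw [e1, e2, abs_mul, abs_mul]
  calc |-(a (k + 1) * u (k + 1) * v (k + 1))| * |g₁ - g₂|
      ≤ |-(a (k + 1) * u (k + 1) * v (k + 1))| * (16 * (ε / D) * |g₁|) := by gcongr
    _ = _ := by ring

end Tunneling

/-! ### Stability of the recursion across a block -/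

/-- Two nearly proportional solutions of a Jacobi recursion over a block of fixed length: they
have positive scalar product over the block, and cannot have opposite signs (in the weak sense) at both sites at the
end of the block. -/
theorem block_nearly_equal {a W x y : ℕ → ℝ} {q : ℕ} {M Em E₁ E₂ B θ : ℝ} (hq : 2 ≤ q)
    (hM : 0 < M) (ha : ∀ i, 1 / M ≤ |a i| ∧ |a i| ≤ M) (hW : ∀ i, |W i| ≤ M)
    (hE₁ : |E₁| ≤ Em) (hE₂ : |E₂| ≤ Em) (hB : B = M * (2 * M + Em) + M + 1)
    (hx : ∀ i < q, a (i + 2) * x (i + 2) + a (i + 1) * x i + W (i + 1) * x (i + 1) =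
      E₁ * x (i + 1))
    (hy : ∀ i < q, a (i + 2) * y (i + 2) + a (i + 1) * y i + W (i + 1) * y (i + 1) =
      E₂ * y (i + 1))
    (hθ : θ * (q * (2 * B ^ 2) ^ q * B ^ 2) < 1) (hθ0 : 0 ≤ θ) (hE : |E₁ - E₂| ≤ θ)
    (h0 : |x 0 - y 0| ≤ θ * |x 0|) (h1 : x 1 = y 1) (hx1 : x 1 ≠ 0) :
    0 < ∑ i ∈ Finset.range q, x (i + 1) * y (i + 1) ∧
      ¬(x q * y q ≤ 0 ∧ x (q + 1) * y (q + 1) ≤ 0) := by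
  have hEm : 0 ≤ Em := (abs_nonneg _).trans hE₁
  -- `M * (2 * M + Em)` bounds one step of the recursion in either direction; the added `M + 1` only
  -- serves to have both `M ≤ B` and `1 ≤ B`.
  have hB1 : 1 ≤ B := by rw [hB]; nlinarith [mul_pos hM hM, mul_nonneg hM.le hEm]
  have hBM : M ≤ B := by rw [hB]; nlinarith [mul_pos hM hM, mul_nonneg hM.le hEm]
  -- solving a three term relation for an outer value
  have solve : ∀ {α β w p r s f E R : ℝ}, 1 / M ≤ |α| → |β| ≤ M → |w| ≤ M → |E| ≤ Em →
      α * p + β * r + w * s = E * s + f → |r| ≤ R → |s| ≤ R → |p| ≤ B * R + M * |f| := by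
    intro α β w p r s f E R hα hβ hw hE h hr hs
    have hR : 0 ≤ R := (abs_nonneg _).trans hr
    have e : α * p = f - β * r - (w - E) * s := by linarith
    have h2 : |α| * |p| ≤ |f| + M * R + (M + Em) * R := by
      rw [← abs_mul, e]
      calc |f - β * r - (w - E) * s| ≤ |f| + |β| * |r| + |w - E| * |s| := by
            rw [← abs_mul, ← abs_mul]
            exact (abs_sub _ _).trans (add_le_add_left (abs_sub _ _) _)
        _ ≤ |f| + M * R + (M + Em) * R := by
            gcongr
            exact (abs_sub _ _).trans (add_le_add hw hE)
    have h3 : |p| ≤ M * (|α| * |p|) := by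
      have : 1 ≤ M * |α| := by
        calc (1 : ℝ) = M * (1 / M) := by field_simp
          _ ≤ M * |α| := by gcongr
      nlinarith [abs_nonneg p]
    calc |p| ≤ M * (|f| + M * R + (M + Em) * R) := h3.trans (by gcongr)
      _ ≤ B * R + M * |f| := by rw [hB]; nlinarith
  set X : ℕ → ℝ := fun i => max |x i| |x (i + 1)| with hX
  have hX0 : 0 < X 0 := lt_of_lt_of_le (abs_pos.2 hx1) (le_max_right _ _)
  have hXnn : ∀ i, 0 ≤ X i := fun i => (abs_nonneg _).trans (le_max_left _ _)
  have up1 : ∀ i < q, X (i + 1) ≤ B * X i := by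
    intro i hi
    have := solve (f := 0) (ha (i + 2)).1 (ha (i + 1)).2 (hW (i + 1)) hE₁
      (by rw [add_zero]; exact hx i hi) (le_max_left |x i| |x (i + 1)|) (le_max_right |x i| |x (i + 1)|)
    rw [abs_zero, mul_zero, add_zero] at this
    refine max_le ?_ this
    calc |x (i + 1)| ≤ 1 * X i := by rw [one_mul]; exact le_max_right _ _
      _ ≤ B * X i := by gcongr
  have down1 : ∀ i < q, X i ≤ B * X (i + 1) := by
    intro i hi
    have := solve (f := 0) (p := x i) (ha (i + 1)).1 (ha (i + 2)).2 (hW (i + 1)) hE₁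
      (by linarith [hx i hi]) (le_max_right |x (i + 1)| |x (i + 2)|)
      (le_max_left |x (i + 1)| |x (i + 2)|)
    rw [abs_zero, mul_zero, add_zero] at this
    refine max_le this ?_
    calc |x (i + 1)| ≤ 1 * X (i + 1) := by rw [one_mul]; exact le_max_left _ _
      _ ≤ B * X (i + 1) := by gcongr
  have up : ∀ i ≤ q, X i ≤ B ^ i * X 0 := by
    intro i
    induction i with
    | zero => intro _; simp
    | succ i ih =>
      intro hi
      calc X (i + 1) ≤ B * X i := up1 i hi
        _ ≤ B * (B ^ i * X 0) := by gcongr; exact ih (by omega)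
        _ = B ^ (i + 1) * X 0 := by ring
  have down : ∀ i ≤ q, X 0 ≤ B ^ i * X i := by
    intro i
    induction i with
    | zero => intro _; simp
    | succ i ih =>
      intro hi
      calc X 0 ≤ B ^ i * X i := ih (by omega)
        _ ≤ B ^ i * (B * X (i + 1)) := by gcongr; exact down1 i hi
        _ = B ^ (i + 1) * X (i + 1) := by ring
  -- Each step costs a factor `2 * B`: one `B` propagates the old discrepancy, the other absorbs the
  -- mismatch `(E₁ - E₂) * x`, which is at most θ times the size of `x`.
  have diff : ∀ i ≤ q, |x i - y i| ≤ (2 * B) ^ i * θ * X 0 ∧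
      |x (i + 1) - y (i + 1)| ≤ (2 * B) ^ i * θ * X 0 := by
    intro i
    induction i with
    | zero =>
      intro _
      rw [pow_zero, one_mul, zero_add, h1, sub_self, abs_zero]
      refine ⟨h0.trans ?_, by positivity⟩
      gcongr
      exact le_max_left _ _
    | succ i ih =>
      intro hi
      obtain ⟨i1, i2⟩ := ih (by omega)
      have hnn : 0 ≤ (2 * B) ^ i * θ * X 0 := by positivity
      have key := solve (f := (E₁ - E₂) * x (i + 1)) (p := x (i + 2) - y (i + 2)) (ha (i + 2)).1
        (ha (i + 1)).2 (hW (i + 1)) hE₂ (by linear_combination hx i hi - hy i hi) i1 i2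
      have hf : |(E₁ - E₂) * x (i + 1)| ≤ θ * ((2 * B) ^ i * X 0) := by
        rw [abs_mul]
        gcongr
        calc |x (i + 1)| ≤ X i := le_max_right _ _
          _ ≤ B ^ i * X 0 := up i (by omega)
          _ ≤ (2 * B) ^ i * X 0 := by gcongr; linarith
      have hfin : B * ((2 * B) ^ i * θ * X 0) + M * |(E₁ - E₂) * x (i + 1)| ≤
          (2 * B) ^ (i + 1) * θ * X 0 := by
        calc B * ((2 * B) ^ i * θ * X 0) + M * |(E₁ - E₂) * x (i + 1)|
            ≤ B * ((2 * B) ^ i * θ * X 0) + B * (θ * ((2 * B) ^ i * X 0)) := by gcongr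
          _ = (2 * B) ^ (i + 1) * θ * X 0 := by ring
      refine ⟨i2.trans ?_, key.trans hfin⟩
      calc (2 * B) ^ i * θ * X 0 = 1 * ((2 * B) ^ i * θ * X 0) := by ring
        _ ≤ (2 * B) * ((2 * B) ^ i * θ * X 0) := by gcongr; linarith
        _ = (2 * B) ^ (i + 1) * θ * X 0 := by ring
  have hq1 : (1 : ℝ) ≤ q := by exact_mod_cast (by omega : 1 ≤ q)
  have hBB : (2 * B ^ 2) ^ q = (2 * B) ^ q * B ^ q := by rw [← mul_pow]; ring_nf
  constructor
  · have hterm : ∀ i ∈ Finset.range q,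
        x (i + 1) ^ 2 - B ^ q * X 0 * ((2 * B) ^ q * θ * X 0) ≤ x (i + 1) * y (i + 1) := by
      intro i hi
      rw [Finset.mem_range] at hi
      have d1 := (diff i hi.le).2
      have d2 : |x (i + 1)| ≤ B ^ q * X 0 := by
        calc |x (i + 1)| ≤ X i := le_max_right _ _
          _ ≤ B ^ i * X 0 := up i hi.le
          _ ≤ B ^ q * X 0 := by gcongr
      have d3 : |x (i + 1) - y (i + 1)| ≤ (2 * B) ^ q * θ * X 0 := by
        refine d1.trans ?_
        gcongr
        linarith
      have d4 : |x (i + 1) * (x (i + 1) - y (i + 1))| ≤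
          B ^ q * X 0 * ((2 * B) ^ q * θ * X 0) := by
        rw [abs_mul]; gcongr
      have := (abs_le.1 d4).2
      nlinarith
    have hsum := Finset.sum_le_sum hterm
    rw [Finset.sum_sub_distrib, Finset.sum_const, Finset.card_range, nsmul_eq_mul] at hsum
    -- The larger of `|x 1|`, `|x 2|` is at least `X 0 / B`, and `2 ≤ q` puts both sites inside the
    -- block.
    have hsq : (X 0 / B) ^ 2 ≤ ∑ i ∈ Finset.range q, x (i + 1) ^ 2 := by
      have hd := down1 0 (by omega)
      have hd2 : X 0 / B ≤ X 1 := by rw [div_le_iff₀ (by linarith)]; linarith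
      have hd3 : (X 0 / B) ^ 2 ≤ X 1 ^ 2 := by gcongr
      have hcase : X 1 ^ 2 = x 1 ^ 2 ∨ X 1 ^ 2 = x 2 ^ 2 := by
        rcases max_choice |x 1| |x (1 + 1)| with h | h
        · left; simp only [hX]; rw [h, sq_abs]
        · right; simp only [hX]; rw [h, sq_abs]
      rcases hcase with h | h
      · refine hd3.trans (h.le.trans ?_)
        exact Finset.single_le_sum (f := fun i => x (i + 1) ^ 2) (fun i _ => sq_nonneg _)
          (Finset.mem_range.2 (by omega : 0 < q))
      · refine hd3.trans (h.le.trans ?_)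
        exact Finset.single_le_sum (f := fun i => x (i + 1) ^ 2) (fun i _ => sq_nonneg _)
          (Finset.mem_range.2 (by omega : 1 < q))
    refine lt_of_lt_of_le ?_ hsum
    refine lt_of_lt_of_le ?_ (sub_le_sub_right hsq _)
    have : (X 0 / B) ^ 2 - q * (B ^ q * X 0 * ((2 * B) ^ q * θ * X 0)) =
        (X 0 / B) ^ 2 * (1 - θ * (q * (2 * B ^ 2) ^ q * B ^ 2)) := by
      rw [hBB]; field_simp
    rw [this]
    have : 0 < X 0 / B := by positivity
    have h2 : 0 < 1 - θ * (q * (2 * B ^ 2) ^ q * B ^ 2) := by linarith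
    positivity
  · rintro ⟨n1, n2⟩
    obtain ⟨d1, d2⟩ := diff q le_rfl
    -- Values of opposite sign are no larger than their difference. Two such sites in a row would
    -- make `X q` as small as the drift, against the lower bound from running the recursion
    -- backwards.
    have habs : ∀ {s t : ℝ}, s * t ≤ 0 → |s| ≤ |s - t| := by
      intro s t h
      rw [← sq_le_sq]
      nlinarith [sq_nonneg t]
    have hXq : X q ≤ (2 * B) ^ q * θ * X 0 := max_le ((habs n1).trans d1) ((habs n2).trans d2)
    have h3 := down q le_rfl
    have h4 : X 0 ≤ θ * (2 * B ^ 2) ^ q * X 0 := by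
      calc X 0 ≤ B ^ q * X q := h3
        _ ≤ B ^ q * ((2 * B) ^ q * θ * X 0) := by gcongr
        _ = θ * (2 * B ^ 2) ^ q * X 0 := by rw [hBB]; ring
    have h5 : θ * (2 * B ^ 2) ^ q ≤ θ * (q * (2 * B ^ 2) ^ q * B ^ 2) := by
      gcongr
      have : 1 ≤ q * B ^ 2 := one_le_mul_of_one_le_of_one_le hq1 (one_le_pow₀ hB1)
      have h6 : 0 ≤ (2 * B ^ 2) ^ q := by positivity
      nlinarith
    nlinarith

/-! ### Inverse tunneling: two eigenvalues split between separated subintervals -/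

section InverseTunneling

variable {a V : ℤ → ℝ} {c d k : ℤ} {u v : ℤ → ℝ} {E₁ E₂ E : ℝ}

/-- A solution on `[c, d]` with Dirichlet condition at `c` that vanishes at two successive sites
vanishes identically. -/
theorem eq_zero_of_vanish_left (ha : ∀ n, a n ≠ 0) (hk : c ≤ k + 1)
    (h0 : ∀ n ≤ k + 1, u n = 0) (hd : ∀ n > d, u n = 0)
    (hu : ∀ n ∈ Finset.Icc c d, jacobiOp a V u n = E * u n) (n : ℤ) : u n = 0 := by
  have key : ∀ i : ℕ, ∀ n ≤ k + 1 + i, u n = 0 := by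
    intro i
    induction i with
    | zero => intro n hn; exact h0 n (by simpa using hn)
    | succ i ih =>
      intro n hn
      push_cast at hn
      rcases eq_or_ne n (k + 1 + i + 1) with rfl | hne
      · by_cases h : k + 1 + (i : ℤ) ≤ d
        · have h1 := hu (k + 1 + i) (by rw [Finset.mem_Icc]; omega)
          rw [jacobiOp, ih _ le_rfl, ih (k + 1 + i - 1) (by omega)] at h1
          simpa [ha] using h1
        · exact hd _ (by omega)
      · exact ih n (by omega)
  exact key (n - (k + 1)).toNat n (by omega)

/-- A zero at `k + 1` would turn the restriction of `u` to the left box into an eigenfunction of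
that box. If this restriction vanishes as well, two successive zeros propagate through the recursion
and kill `u`. -/
theorem ne_zero_of_no_left_eigenvalue (ha : ∀ n, a n ≠ 0) (hk : c ≤ k + 1) (hkd : k ≤ d)
    {K : Set ℝ} (hE : E ∈ K) (hu : IsBoxEigenfunction a V (Finset.Icc c d) E u)
    (hno : ¬HasEigenvalueIn a V (Finset.Icc c k) K) : u (k + 1) ≠ 0 := by
  obtain ⟨⟨m, hm⟩, hu0, hu⟩ := hu
  have hl : ∀ n < c, u n = 0 := fun n hn => hu0 n (by rw [Finset.mem_Icc]; omega)
  have hr : ∀ n > d, u n = 0 := fun n hn => hu0 n (by rw [Finset.mem_Icc]; omega)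
  intro h
  by_cases hz : ∀ n ≤ k, u n = 0
  · refine hm (eq_zero_of_vanish_left ha hk (fun n hn => ?_) hr hu m)
    rcases eq_or_ne n (k + 1) with rfl | hne
    · exact h
    · exact hz n (by omega)
  · push Not at hz
    obtain ⟨n, hn, hn0⟩ := hz
    refine hno ⟨E, hE, fun m => if m ∈ Finset.Icc c k then u m else 0, ⟨n, ?_⟩, ?_, ?_⟩
    · have : n ∈ Finset.Icc c k := by
        rw [Finset.mem_Icc]
        refine ⟨?_, hn⟩
        by_contra hlt
        exact hn0 (hl n (by omega))
      simpa [this] using hn0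
    · intro m hm
      simp [hm]
    · intro m hm
      have hm' := Finset.mem_Icc.1 hm
      rw [jacobiOp_truncate u hm, h, hl (c - 1) (by omega),
        hu m (by rw [Finset.mem_Icc]; omega)]
      simp only [hm, if_true]
      simp

theorem IsBoxEigenfunction.const_mul {Λ : Finset ℤ} (hu : IsBoxEigenfunction a V Λ E u) {t : ℝ}
    (ht : t ≠ 0) : IsBoxEigenfunction a V Λ E (fun n => t * u n) := by
  obtain ⟨⟨m, hm⟩, hu0, hu⟩ := hu
  refine ⟨⟨m, mul_ne_zero ht hm⟩, fun n hn => by simp [hu0 n hn], fun n hn => ?_⟩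
  have := hu n hn
  simp only [jacobiOp] at this ⊢
  linear_combination t * this

/-- If `H([c, d])` has two eigenvalues close to `E`, then for each block `[k+1, k+q]` one of the
sides has an eigenvalue close to `E`, up to the choice of the last site. -/
theorem tunneling_alternative {q : ℕ} {M Em B θ ε D : ℝ} (hq : 2 ≤ q) (hM : 0 < M)
    (ha : ∀ n, 1 / M ≤ |a n| ∧ |a n| ≤ M) (hV : ∀ n, |V n| ≤ M)
    (hE₁ : |E₁| ≤ Em) (hE₂ : |E₂| ≤ Em) (hB : B = M * (2 * M + Em) + M + 1)
    (hθ : θ * (q * (2 * B ^ 2) ^ q * B ^ 2) < 1) (hε : 0 ≤ ε) (hD : 0 < D) (hεD : 8 * ε ≤ D)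
    (hDθ : 16 * (ε / D) ≤ θ) (hεθ : 2 * ε ≤ θ)
    (h₁ : E₁ ∈ Set.Icc (E - ε) (E + ε)) (h₂ : E₂ ∈ Set.Icc (E - ε) (E + ε))
    (hu : IsBoxEigenfunction a V (Finset.Icc c d) E₁ u)
    (hv : IsBoxEigenfunction a V (Finset.Icc c d) E₂ v)
    (huv : ∑ n ∈ Finset.Icc c d, u n * v n = 0) (hck : c ≤ k + 1) (hkd : k + q ≤ d) :
    (HasEigenvalueIn a V (Finset.Icc c k) (Set.Icc (E - D) (E + D)) ∨
      HasEigenvalueIn a V (Finset.Icc c (k - 1)) (Set.Icc (E - D) (E + D))) ∨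
    (HasEigenvalueIn a V (Finset.Icc (k + q + 1) d) (Set.Icc (E - D) (E + D)) ∨
      HasEigenvalueIn a V (Finset.Icc (k + q + 2) d) (Set.Icc (E - D) (E + D))) := by
  by_contra hno
  rw [not_or, not_or, not_or] at hno
  obtain ⟨⟨hl1, hl2⟩, hr1, hr2⟩ := hno
  have ha0 : ∀ n, a n ≠ 0 := fun n h0 => by
    have := (ha n).1
    rw [h0, abs_zero] at this
    have : 0 < 1 / M := by positivity
    linarith
  have hmem : ∀ t ∈ Set.Icc (E - ε) (E + ε), t ∈ Set.Icc (E - D) (E + D) := fun t ht =>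
    ⟨by linarith [ht.1], by linarith [ht.2]⟩
  have hu1 := ne_zero_of_no_left_eigenvalue ha0 hck (by omega) (hmem _ h₁) hu hl1
  have hv1 := ne_zero_of_no_left_eigenvalue ha0 hck (by omega) (hmem _ h₂) hv hl1
  -- normalize at the first site of the block
  obtain ⟨w, hw, hw1, huw⟩ : ∃ w, IsBoxEigenfunction a V (Finset.Icc c d) E₂ w ∧
      u (k + 1) = w (k + 1) ∧ ∑ n ∈ Finset.Icc c d, u n * w n = 0 := by
    refine ⟨fun n => u (k + 1) / v (k + 1) * v n, hv.const_mul (div_ne_zero hu1 hv1), ?_, ?_⟩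
    · field_simp
    · have : ∀ n, u n * (u (k + 1) / v (k + 1) * v n) = u (k + 1) / v (k + 1) * (u n * v n) :=
        fun n => by ring
      simp only [this, ← Finset.mul_sum, huv, mul_zero]
  clear hv hv1 huv
  obtain ⟨-, hu0, hu⟩ := hu
  obtain ⟨-, hw0, hw⟩ := hw
  have hul : ∀ n < c, u n = 0 := fun n hn => hu0 n (by rw [Finset.mem_Icc]; omega)
  have hur : ∀ n > d, u n = 0 := fun n hn => hu0 n (by rw [Finset.mem_Icc]; omega)
  have hwl : ∀ n < c, w n = 0 := fun n hn => hw0 n (by rw [Finset.mem_Icc]; omega)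
  have hwr : ∀ n > d, w n = 0 := fun n hn => hw0 n (by rw [Finset.mem_Icc]; omega)
  have hsub : ∀ {p r : ℤ}, c ≤ p → r ≤ d → ∀ n ∈ Finset.Icc p r, n ∈ Finset.Icc c d := by
    intro p r hp hr n hn
    rw [Finset.mem_Icc] at hn ⊢
    omega
  have hθ0 : 0 ≤ θ := by linarith
  have hclose : |u k - w k| ≤ θ * |u k| := by
    -- For `k = c - 1` the left box is empty, and both solutions vanish at `k` by the Dirichlet
    -- condition.
    rcases lt_or_ge k c with hkc | hkc
    · rw [hul k hkc, hwl k hkc]; simp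
    · have h := left_ratio hkc hε hD hεD h₁ h₂ hul hwl
        (fun n hn => hu n (hsub le_rfl (by omega) n hn))
        (fun n hn => hw n (hsub le_rfl (by omega) n hn)) hl1 hl2
      rw [← hw1, show u k * u (k + 1) - u (k + 1) * w k = (u k - w k) * u (k + 1) by ring,
        abs_mul, abs_mul, ← mul_assoc] at h
      have h2 := le_of_mul_le_mul_right h (abs_pos.2 hu1)
      exact h2.trans (by gcongr)
  have hleft := left_sign (ha0 (k + 1)) (hmem _ h₁) (hmem _ h₂) hul hwl
    (fun n hn => hu n (hsub le_rfl (by omega) n hn))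
    (fun n hn => hw n (hsub le_rfl (by omega) n hn)) hl1
  have hright1 := right_sign (ha0 (k + q + 1)) (hmem _ h₁) (hmem _ h₂) hur hwr
    (fun n hn => hu n (hsub (by omega) le_rfl n hn))
    (fun n hn => hw n (hsub (by omega) le_rfl n hn)) hr1
  have hright2 := right_sign (ha0 (k + q + 2)) (hmem _ h₁) (hmem _ h₂) hur hwr
    (fun n hn => hu n (hsub (by omega) le_rfl n hn))
    (fun n hn => hw n (hsub (by omega) le_rfl n hn)) hr2
  have hrec : ∀ {E' : ℝ} {f : ℤ → ℝ},
      (∀ n ∈ Finset.Icc c d, jacobiOp a V f n = E' * f n) → ∀ i < q,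
      a (k + (i + 2 : ℕ)) * f (k + (i + 2 : ℕ)) + a (k + (i + 1 : ℕ)) * f (k + (i : ℕ)) +
        V (k + (i + 1 : ℕ)) * f (k + (i + 1 : ℕ)) = E' * f (k + (i + 1 : ℕ)) := by
    intro E' f hf i hi
    have := hf (k + (i + 1 : ℕ)) (by rw [Finset.mem_Icc]; push_cast; omega)
    rw [jacobiOp, show k + ((i + 1 : ℕ) : ℤ) + 1 = k + (i + 2 : ℕ) by push_cast; ring,
      show k + ((i + 1 : ℕ) : ℤ) - 1 = k + (i : ℕ) by push_cast; ring] at this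
    exact this
  obtain ⟨hblock, hend⟩ := block_nearly_equal (a := fun i => a (k + (i : ℕ)))
    (W := fun i => V (k + (i : ℕ))) (x := fun i => u (k + (i : ℕ)))
    (y := fun i => w (k + (i : ℕ))) (θ := θ) hq hM (fun i => ha _) (fun i => hV _) hE₁ hE₂ hB
    (hrec hu) (hrec hw) hθ hθ0
    (by rw [abs_le]; constructor <;> linarith [h₁.1, h₁.2, h₂.1, h₂.2])
    (by simpa using hclose) (by simpa using hw1) (by simpa using hu1)
  have hsplit : ∑ n ∈ Finset.Icc c d, u n * w n = ∑ n ∈ Finset.Icc c k, u n * w n +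
      ∑ i ∈ Finset.range q, u (k + (i + 1 : ℕ)) * w (k + (i + 1 : ℕ)) +
      ∑ n ∈ Finset.Icc (k + q + 1) d, u n * w n := by
    have e1 : Finset.Icc c d = (Finset.Icc c k ∪ Finset.Icc (k + 1) (k + q)) ∪
        Finset.Icc (k + q + 1) d := by
      ext n; simp only [Finset.mem_union, Finset.mem_Icc]; omega
    rw [e1, Finset.sum_union, Finset.sum_union]
    · congr 2
      symm
      refine Finset.sum_bij (fun i _ => k + ((i + 1 : ℕ) : ℤ)) ?_ ?_ ?_ ?_
      · intro i hi
        rw [Finset.mem_range] at hi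
        rw [Finset.mem_Icc]; push_cast; omega
      · intro i _ j _ h
        push_cast at h; omega
      · intro n hn
        rw [Finset.mem_Icc] at hn
        refine ⟨(n - k - 1).toNat, ?_, ?_⟩
        · rw [Finset.mem_range]; omega
        · push_cast; omega
      · intro i _; rfl
    · rw [Finset.disjoint_left]; intro n; simp only [Finset.mem_Icc]; omega
    · rw [Finset.disjoint_left]; intro n; simp only [Finset.mem_union, Finset.mem_Icc]; omega
  have hleft' : 0 ≤ ∑ n ∈ Finset.Icc c k, u n * w n := by
    rw [← hw1] at hleft
    exact (mul_nonneg_iff_of_pos_left (mul_self_pos.2 hu1)).1 hleft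
  -- The left part is nonnegative and the block positive, so orthogonality forces this sign. The
  -- sign rule for the box starting at `k + q + 1` then gives a nonpositive product at `k + q`. At
  -- `k + q + 1` a positive product would make both terms of `hstep` nonnegative.
  have hneg : ∑ n ∈ Finset.Icc (k + q + 1) d, u n * w n < 0 := by linarith
  apply hend
  rw [show k + (q : ℤ) + 1 - 1 = k + (q : ℤ) by ring] at hright1
  rw [show k + (q : ℤ) + 2 - 1 = k + q + 1 by ring] at hright2
  have hstep : ∑ n ∈ Finset.Icc (k + q + 1) d, u n * w n =
      u (k + q + 1) * w (k + q + 1) + ∑ n ∈ Finset.Icc (k + q + 2) d, u n * w n := by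
    rcases lt_or_ge d (k + q + 1) with h | h
    · rw [Finset.Icc_eq_empty (by omega), Finset.sum_empty] at hneg
      exact absurd hneg (lt_irrefl _)
    · have e1 : Finset.Icc (k + q + 1) d = insert (k + q + 1) (Finset.Icc (k + q + 2) d) := by
        ext n; simp only [Finset.mem_insert, Finset.mem_Icc]; omega
      rw [e1, Finset.sum_insert (by simp)]
  have hgoal1 : u (k + q) * w (k + q) ≤ 0 := by
    by_contra! h
    nlinarith
  have hgoal2 : u (k + q + 1) * w (k + q + 1) ≤ 0 := by
    by_contra! h
    have : 0 ≤ ∑ n ∈ Finset.Icc (k + q + 2) d, u n * w n :=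
      (mul_nonneg_iff_of_pos_left h).1 hright2
    linarith
  refine ⟨hgoal1, ?_⟩
  push_cast
  rw [← add_assoc]
  exact hgoal2

/-- Inverse tunneling: if `H([c, d])` has two eigenvalues close to `E`, then there are two disjoint
subintervals, at distance at least `q`, whose restrictions both have an eigenvalue close to `E`. -/
theorem inverse_tunneling {q : ℕ} {M Em B θ ε D : ℝ} (hq : 2 ≤ q) (hM : 0 < M)
    (ha : ∀ n, 1 / M ≤ |a n| ∧ |a n| ≤ M) (hV : ∀ n, |V n| ≤ M)
    (hE₁ : |E₁| ≤ Em) (hE₂ : |E₂| ≤ Em) (hB : B = M * (2 * M + Em) + M + 1)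
    (hθ : θ * (q * (2 * B ^ 2) ^ q * B ^ 2) < 1) (hε : 0 ≤ ε) (hD : 0 < D) (hεD : 8 * ε ≤ D)
    (hDθ : 16 * (ε / D) ≤ θ) (hεθ : 2 * ε ≤ θ)
    (h₁ : E₁ ∈ Set.Icc (E - ε) (E + ε)) (h₂ : E₂ ∈ Set.Icc (E - ε) (E + ε))
    (hu : IsBoxEigenfunction a V (Finset.Icc c d) E₁ u)
    (hv : IsBoxEigenfunction a V (Finset.Icc c d) E₂ v)
    (huv : ∑ n ∈ Finset.Icc c d, u n * v n = 0) (hcd : c + q ≤ d + 1) :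
    ∃ k₁ k₂ : ℤ, c ≤ k₁ ∧ k₁ + q ≤ k₂ ∧ k₂ ≤ k₁ + q + 2 ∧ k₂ ≤ d ∧
      HasEigenvalueIn a V (Finset.Icc c k₁) (Set.Icc (E - D) (E + D)) ∧
      HasEigenvalueIn a V (Finset.Icc k₂ d) (Set.Icc (E - D) (E + D)) := by
  set K := Set.Icc (E - D) (E + D) with hK
  by_contra hno
  have hsep : ∀ k₁ k₂ : ℤ, k₁ + q ≤ k₂ → k₂ ≤ k₁ + q + 2 →
      HasEigenvalueIn a V (Finset.Icc c k₁) K → HasEigenvalueIn a V (Finset.Icc k₂ d) K →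
      False := by
    intro k₁ k₂ h1 h2 hl hr
    refine hno ⟨k₁, k₂, ?_, h1, h2, ?_, hl, hr⟩
    · by_contra h
      exact not_hasEigenvalueIn_of_lt (by omega) K hl
    · by_contra h
      exact not_hasEigenvalueIn_of_lt (by omega) K hr
  have halt := fun (k : ℤ) (h1 : c ≤ k + 1) (h2 : k + q ≤ d) =>
    tunneling_alternative hq hM ha hV hE₁ hE₂ hB hθ hε hD hεD hDθ hεθ h₁ h₂ hu hv huv h1 h2
  have key : ∀ i : ℕ, c - 1 + i + q ≤ d →
      HasEigenvalueIn a V (Finset.Icc (c - 1 + i + q + 1) d) K ∨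
        HasEigenvalueIn a V (Finset.Icc (c - 1 + i + q + 2) d) K := by
    intro i
    induction i with
    | zero =>
      intro hi
      refine (halt (c - 1 + (0 : ℕ)) (by simp) hi).resolve_left ?_
      rintro (h | h)
      · exact not_hasEigenvalueIn_of_lt (by simp) K h
      · exact not_hasEigenvalueIn_of_lt (by simp) K h
    | succ i ih =>
      intro hi
      push_cast at hi
      have hQ := ih (by omega)
      refine (halt (c - 1 + (i + 1 : ℕ)) (by push_cast; omega) (by push_cast; omega)).resolve_left
        ?_
      rintro (h | h) <;> rcases hQ with h' | h'
      · exact hsep _ _ (by push_cast; omega) (by push_cast; omega) h h'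
      · exact hsep _ _ (by push_cast; omega) (by push_cast; omega) h h'
      · exact hsep _ _ (by push_cast; omega) (by push_cast; omega) h h'
      · exact hsep _ _ (by push_cast; omega) (by push_cast; omega) h h'
  -- At the last position the right boxes are empty.
  have hlast := key (d - q - (c - 1)).toNat (by omega)
  rcases hlast with h | h
  · exact not_hasEigenvalueIn_of_lt (by omega) K h
  · exact not_hasEigenvalueIn_of_lt (by omega) K h

end InverseTunneling

/-! ### Cutting off vectors of a spectral subspace -/

section Truncation

variable {a V : ℤ → ℝ} {M E ε : ℝ}

/-- Cutting an approximate eigenfunction of `H([1, L])` off to `[p, q]`. -/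
theorem sum_sq_truncate_le {L : ℕ} {p q : ℤ} {w : ℤ → ℝ} {κ : ℝ} (ha : ∀ n, |a n| ≤ M)
    (hp : 1 ≤ p) (hq : q ≤ L) (hL : 1 ≤ L) (hε : 0 ≤ ε) (hε1 : ε ≤ 1)
    (happ : ∑ n ∈ Finset.Icc 1 (L : ℤ), (jacobiOp a V w n - E * w n) ^ 2 ≤
      ε ^ 2 * ∑ n ∈ Finset.Icc 1 (L : ℤ), w n ^ 2)
    (hκ : ∀ n ∉ Finset.Icc p q, w n ^ 2 ≤ κ)
    (hκ2 : (1 + 4 * M ^ 2) * L * κ ≤ ε ^ 2 * ∑ n ∈ Finset.Icc p q, w n ^ 2) :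
    ∑ n ∈ Finset.Icc p q,
        (jacobiOp a V (fun m => if m ∈ Finset.Icc p q then w m else 0) n - E * w n) ^ 2 ≤
      (2 * ε) ^ 2 * ∑ n ∈ Finset.Icc p q, w n ^ 2 := by
  have hsub : Finset.Icc p q ⊆ Finset.Icc 1 (L : ℤ) := Finset.Icc_subset_Icc hp hq
  have hκ0 : 0 ≤ κ := (sq_nonneg _).trans (hκ (p - 1) (by simp))
  have hb : ∀ n m : ℤ, m ∉ Finset.Icc p q → (a n * w m) ^ 2 ≤ M ^ 2 * κ := by
    intro n m hm
    rw [mul_pow]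
    have h1 : a n ^ 2 ≤ M ^ 2 := by
      rw [← sq_abs]; gcongr; exact ha n
    exact mul_le_mul h1 (hκ m hm) (sq_nonneg _) (sq_nonneg _)
  have hterm : ∀ n ∈ Finset.Icc p q,
      (jacobiOp a V (fun m => if m ∈ Finset.Icc p q then w m else 0) n - E * w n) ^ 2 ≤
      2 * (jacobiOp a V w n - E * w n) ^ 2 + ((if n = q then 4 * (M ^ 2 * κ) else 0) +
        if n = p then 4 * (M ^ 2 * κ) else 0) := by
    intro n hn
    rw [jacobiOp_truncate w hn]
    have h1 := hb (q + 1) (q + 1) (by simp)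
    have h2 := hb p (p - 1) (by simp)
    have key : ∀ f x y : ℝ, (f - x - y) ^ 2 ≤ 2 * f ^ 2 + (4 * x ^ 2 + 4 * y ^ 2) := by
      intro f x y
      nlinarith [sq_nonneg (f + (x + y)), sq_nonneg (x - y)]
    have h3 := key (jacobiOp a V w n - E * w n) (if n = q then a (q + 1) * w (q + 1) else 0)
      (if n = p then a p * w (p - 1) else 0)
    have h4 : (if n = q then a (q + 1) * w (q + 1) else 0) ^ 2 ≤
        (if n = q then M ^ 2 * κ else 0) := by
      split_ifs
      · exact h1
      · simp
    have h5 : (if n = p then a p * w (p - 1) else 0) ^ 2 ≤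
        (if n = p then M ^ 2 * κ else 0) := by
      split_ifs
      · exact h2
      · simp
    calc _ = (jacobiOp a V w n - E * w n - (if n = q then a (q + 1) * w (q + 1) else 0) -
          (if n = p then a p * w (p - 1) else 0)) ^ 2 := by ring
      _ ≤ _ := h3
      _ ≤ 2 * (jacobiOp a V w n - E * w n) ^ 2 + (4 * (if n = q then M ^ 2 * κ else 0) +
          4 * (if n = p then M ^ 2 * κ else 0)) := by gcongr
      _ = _ := by simp only [mul_ite, mul_zero]
  have hite : ∀ b : ℤ, ∑ n ∈ Finset.Icc p q, (if n = b then 4 * (M ^ 2 * κ) else 0) ≤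
      4 * (M ^ 2 * κ) := by
    intro b
    rw [Finset.sum_ite_eq']
    split_ifs
    · exact le_rfl
    · positivity
  have hmass : ∑ n ∈ Finset.Icc 1 (L : ℤ), w n ^ 2 ≤ ∑ n ∈ Finset.Icc p q, w n ^ 2 + L * κ := by
    rw [← Finset.sum_sdiff hsub, add_comm]
    gcongr
    calc ∑ n ∈ Finset.Icc 1 (L : ℤ) \ Finset.Icc p q, w n ^ 2
        ≤ ∑ n ∈ Finset.Icc 1 (L : ℤ) \ Finset.Icc p q, κ :=
          Finset.sum_le_sum fun n hn => hκ n (Finset.mem_sdiff.1 hn).2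
      _ ≤ ∑ n ∈ Finset.Icc 1 (L : ℤ), κ :=
          Finset.sum_le_sum_of_subset_of_nonneg Finset.sdiff_subset fun _ _ _ => hκ0
      _ = L * κ := by simp
  have hsum := Finset.sum_le_sum hterm
  rw [Finset.sum_add_distrib, Finset.sum_add_distrib, ← Finset.mul_sum] at hsum
  have hf : ∑ n ∈ Finset.Icc p q, (jacobiOp a V w n - E * w n) ^ 2 ≤
      ε ^ 2 * (∑ n ∈ Finset.Icc p q, w n ^ 2 + L * κ) :=
    (Finset.sum_le_sum_of_subset_of_nonneg hsub fun _ _ _ => sq_nonneg _).trans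
      (happ.trans (by gcongr))
  have hL1 : (1 : ℝ) ≤ L := by exact_mod_cast hL
  have hε2 : ε ^ 2 ≤ 1 := pow_le_one₀ hε hε1
  -- Besides twice the residual on the inner mass there remain `2 * ε ^ 2 * L * κ` for the lost mass
  -- and `8 * M ^ 2 * κ` for the two cut bonds. Together they are at most twice the left side of
  -- `hκ2`, which brings the total to `(2 * ε) ^ 2`.
  have h6 : ε ^ 2 * (L * κ) ≤ 1 * (L * κ) := by gcongr
  have h7 : 1 * (M ^ 2 * κ) ≤ L * (M ^ 2 * κ) := by gcongr
  have := hite p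
  have := hite q
  nlinarith

/-- The spectral sum for a vector with spectral support in `[E - ε, E + ε]`. -/
theorem sum_sq_mulVec_sub_le {n : Type*} [Fintype n] [DecidableEq n] {A : Matrix n n ℝ}
    (hA : A.IsHermitian) {w : n → ℝ} (hε : 0 ≤ ε)
    (h : ∀ j, specCoef hA w j ≠ 0 → hA.eigenvalues j ∈ Set.Icc (E - ε) (E + ε)) :
    ∑ i, ((A.mulVec w) i - E * w i) ^ 2 ≤ ε ^ 2 * ∑ i, w i ^ 2 := by
  have e1 := sum_mul_eq_sum_specCoef hA w w
  have e2 := sum_mul_eq_sum_specCoef hA (fun i => (A.mulVec w) i - E * w i)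
    (fun i => (A.mulVec w) i - E * w i)
  simp only [specCoef_mulVec_sub] at e2
  simp only [sq (w _), sq ((A.mulVec w) _ - _), e1, e2]
  rw [Finset.mul_sum]
  refine Finset.sum_le_sum fun j _ => ?_
  by_cases hj : specCoef hA w j = 0
  · simp [hj]
  · obtain ⟨h1, h2⟩ := h j hj
    have h3 : (hA.eigenvalues j - E) ^ 2 ≤ ε ^ 2 := by
      rw [sq_le_sq, abs_of_nonneg hε, abs_le]; constructor <;> linarith
    have h4 := sq_nonneg (specCoef hA w j)
    nlinarith

theorem specCoef_specVec {n : Type*} [Fintype n] [DecidableEq n] {A : Matrix n n ℝ}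
    (hA : A.IsHermitian) (j k : n) : specCoef hA (specVec hA k) j = if j = k then 1 else 0 :=
  specVec_orth hA j k

/-- A truncated vector of the spectral subspace is an approximate eigenvector of the small box. -/
theorem truncate_spectral {L : ℕ} {p q : ℤ} {κ : ℝ} (ha : ∀ n, |a n| ≤ M)
    (hp : 1 ≤ p) (hq : q ≤ L) (hL : 1 ≤ L) (hε : 0 ≤ ε) (hε1 : ε ≤ 1) (w : boxL L → ℝ)
    (hw : ∀ j, specCoef (boxOp_isHermitian a V (boxL L)) w j ≠ 0 →
      (boxOp_isHermitian a V (boxL L)).eigenvalues j ∈ Set.Icc (E - ε) (E + ε))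
    (hκ0 : 0 ≤ κ) (hκ : ∀ i : boxL L, (i : ℤ) ∉ Finset.Icc p q → w i ^ 2 ≤ κ)
    (hκ2 : (1 + 4 * M ^ 2) * L * κ ≤ ε ^ 2 * ∑ n ∈ Finset.Icc p q, zeroExtend w n ^ 2) :
    ∑ i : Finset.Icc p q, ((boxOp a V (Finset.Icc p q)).mulVec
        (fun j : Finset.Icc p q => zeroExtend w j) i - E * zeroExtend w i) ^ 2 ≤
      (2 * ε) ^ 2 * ∑ i : Finset.Icc p q, zeroExtend w i ^ 2 := by
  have h1 := sum_sq_mulVec_sub_le (boxOp_isHermitian a V (boxL L)) hε hw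
  simp only [boxOp_mulVec_zeroExtend] at h1
  have h2 : ∑ i : boxL L, (jacobiOp a V (zeroExtend w) i - E * zeroExtend w i) ^ 2 ≤
      ε ^ 2 * ∑ i : boxL L, zeroExtend w i ^ 2 := by
    simpa only [zeroExtend_coe] using h1
  rw [Finset.sum_coe_sort (boxL L) (fun n => (jacobiOp a V (zeroExtend w) n -
    E * zeroExtend w n) ^ 2), Finset.sum_coe_sort (boxL L) (fun n => zeroExtend w n ^ 2)] at h2
  have h3 := sum_sq_truncate_le ha hp hq hL hε hε1 h2 (κ := κ) (fun n hn => by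
    by_cases hm : n ∈ boxL L
    · have := hκ ⟨n, hm⟩ hn
      rwa [← zeroExtend_coe w] at this
    · rw [zeroExtend_of_notMem w hm]; simpa using hκ0) hκ2
  simp only [boxOp_mulVec]
  rw [Finset.sum_coe_sort (Finset.Icc p q) (fun i => (jacobiOp a V (fun m =>
    if m ∈ Finset.Icc p q then zeroExtend w m else 0) i - E * zeroExtend w i) ^ 2),
    Finset.sum_coe_sort (Finset.Icc p q) (fun n => zeroExtend w n ^ 2)]
  exact h3

end Truncation

/-! ### The spectral projection kernel and eigenvalues of small boxes -/

section Localization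

variable {a V : ℤ → ℝ} {M E ε : ℝ}

/-- The spectral projection kernel `⟨δ_x, 1_{[E-ε, E+ε]}(H(Λ_L)) δ_y⟩`. -/
noncomputable def projKernel (a V : ℤ → ℝ) (L : ℕ) (E ε : ℝ) : Matrix (boxL L) (boxL L) ℝ :=
  boxCalc a V (boxL L) ((Set.Icc (E - ε) (E + ε)).indicator fun _ => 1)

theorem projKernel_apply (L : ℕ) (x y : boxL L) :
    projKernel a V L E ε x y = ∑ j, (Set.Icc (E - ε) (E + ε)).indicator (fun _ => (1 : ℝ))
      ((boxOp_isHermitian a V (boxL L)).eigenvalues j) *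
      specVec (boxOp_isHermitian a V (boxL L)) j x *
      specVec (boxOp_isHermitian a V (boxL L)) j y :=
  cfc_apply_eq_sum _ _ _ _

theorem specCoef_projKernel (L : ℕ) (x j : boxL L) :
    specCoef (boxOp_isHermitian a V (boxL L)) (projKernel a V L E ε x) j =
      (Set.Icc (E - ε) (E + ε)).indicator (fun _ => (1 : ℝ))
      ((boxOp_isHermitian a V (boxL L)).eigenvalues j) *
      specVec (boxOp_isHermitian a V (boxL L)) j x := by
  have : projKernel a V L E ε x = fun y => projKernel a V L E ε x y := rfl
  rw [this]
  simp only [specCoef, projKernel_apply, Finset.mul_sum]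
  rw [Finset.sum_comm]
  have h : ∀ k : boxL L, ∑ y, specVec (boxOp_isHermitian a V (boxL L)) j y *
      ((Set.Icc (E - ε) (E + ε)).indicator (fun _ => (1 : ℝ))
      ((boxOp_isHermitian a V (boxL L)).eigenvalues k) *
      specVec (boxOp_isHermitian a V (boxL L)) k x *
      specVec (boxOp_isHermitian a V (boxL L)) k y) =
      (Set.Icc (E - ε) (E + ε)).indicator (fun _ => (1 : ℝ))
      ((boxOp_isHermitian a V (boxL L)).eigenvalues k) *
      specVec (boxOp_isHermitian a V (boxL L)) k x * if j = k then 1 else 0 := by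
    intro k
    rw [← specVec_orth (boxOp_isHermitian a V (boxL L)) j k, Finset.mul_sum]
    exact Finset.sum_congr rfl fun y _ => by ring
  simp only [h]
  simp

theorem projKernel_diag_le_one (L : ℕ) (x : boxL L) : projKernel a V L E ε x x ≤ 1 := by
  have h := specVec_complete (boxOp_isHermitian a V (boxL L)) x x
  rw [if_pos rfl] at h
  rw [projKernel_apply]
  refine le_trans (Finset.sum_le_sum fun j _ => ?_) h.le
  rw [mul_assoc]
  have h1 := mul_self_nonneg (specVec (boxOp_isHermitian a V (boxL L)) j x)
  have h2 : (Set.Icc (E - ε) (E + ε)).indicator (fun _ => (1 : ℝ))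
      ((boxOp_isHermitian a V (boxL L)).eigenvalues j) ≤ 1 :=
    Set.indicator_le' (fun _ _ => le_rfl) (fun _ _ => zero_le_one) _
  nlinarith

/-- The diagonal of the projection is the sum of the squares of all eigenfunctions in the window.
Its smallness therefore controls every combination of two of them at once. -/
theorem specVec_sq_add_sq_le_projKernel (L : ℕ) {j k : boxL L} (hjk : j ≠ k)
    (hj : (boxOp_isHermitian a V (boxL L)).eigenvalues j ∈ Set.Icc (E - ε) (E + ε))
    (hk : (boxOp_isHermitian a V (boxL L)).eigenvalues k ∈ Set.Icc (E - ε) (E + ε))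
    (x : boxL L) : specVec (boxOp_isHermitian a V (boxL L)) j x ^ 2 +
      specVec (boxOp_isHermitian a V (boxL L)) k x ^ 2 ≤ projKernel a V L E ε x x := by
  rw [projKernel_apply]
  calc _ = ∑ i ∈ {j, k}, (Set.Icc (E - ε) (E + ε)).indicator (fun _ => (1 : ℝ))
          ((boxOp_isHermitian a V (boxL L)).eigenvalues i) *
          specVec (boxOp_isHermitian a V (boxL L)) i x *
          specVec (boxOp_isHermitian a V (boxL L)) i x := by
        rw [Finset.sum_pair hjk, Set.indicator_of_mem hj, Set.indicator_of_mem hk]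
        ring
    _ ≤ _ := by
        refine Finset.sum_le_sum_of_subset_of_nonneg (Finset.subset_univ _) fun i _ _ => ?_
        rw [mul_assoc]
        exact mul_nonneg (Set.indicator_nonneg (fun _ _ => zero_le_one) _) (mul_self_nonneg _)

/-- If the projection kernel is concentrated around `x` and not too small at `(x, x)`, then the
box around `x` has an eigenvalue. -/
theorem hasEigenvalueIn_of_projKernel {L : ℕ} {p q : ℤ} {κ τ : ℝ} (ha : ∀ n, |a n| ≤ M)
    (hp : 1 ≤ p) (hq : q ≤ L) (hL : 1 ≤ L) (hε : 0 ≤ ε) (hε1 : ε ≤ 1) (x : boxL L)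
    (hx : (x : ℤ) ∈ Finset.Icc p q) (hτ : 0 < τ) (hxτ : τ ≤ projKernel a V L E ε x x)
    (hκ0 : 0 ≤ κ)
    (hκ : ∀ i : boxL L, (i : ℤ) ∉ Finset.Icc p q → projKernel a V L E ε x i ^ 2 ≤ κ)
    (hκ2 : (1 + 4 * M ^ 2) * L * κ ≤ ε ^ 2 * τ ^ 2) :
    HasEigenvalueIn a V (Finset.Icc p q) (Set.Icc (E - 2 * ε) (E + 2 * ε)) := by
  have hx0 : zeroExtend (projKernel a V L E ε x) x = projKernel a V L E ε x x :=
    zeroExtend_coe _ _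
  have hlow : τ ^ 2 ≤ ∑ n ∈ Finset.Icc p q, zeroExtend (projKernel a V L E ε x) n ^ 2 := by
    refine le_trans ?_ (Finset.single_le_sum
      (f := fun n => zeroExtend (projKernel a V L E ε x) n ^ 2) (fun n _ => sq_nonneg _) hx)
    simp only [hx0]
    gcongr
  have h := truncate_spectral ha hp hq hL hε hε1 (projKernel a V L E ε x) (κ := κ) (V := V)
    (E := E) (fun j hj => by
      rw [specCoef_projKernel] at hj
      by_contra hn
      rw [Set.indicator_of_notMem hn, zero_mul] at hj
      exact hj rfl) hκ0 hκ (hκ2.trans (by gcongr))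
  rw [hasEigenvalueIn_iff]
  by_contra hno
  push Not at hno
  refine absurd h (not_le.2 (lt_sum_sq_mulVec_sub (boxOp_isHermitian a V (Finset.Icc p q))
    (by linarith) ⟨⟨x, hx⟩, ?_⟩ fun j _ => hno j))
  change zeroExtend (projKernel a V L E ε x) x ≠ 0
  rw [hx0]
  linarith

/-- `H(Λ)` has two orthogonal eigenfunctions at energies in `K`. -/
def HasTwoEigenvaluesIn (a V : ℤ → ℝ) (Λ : Finset ℤ) (K : Set ℝ) : Prop :=
  ∃ E₁ ∈ K, ∃ E₂ ∈ K, ∃ u v, IsBoxEigenfunction a V Λ E₁ u ∧ IsBoxEigenfunction a V Λ E₂ v ∧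
    ∑ n ∈ Λ, u n * v n = 0

theorem hasTwoEigenvaluesIn_of_ne {Λ : Finset ℤ} {K : Set ℝ} {j k : Λ} (hjk : j ≠ k)
    (hj : (boxOp_isHermitian a V Λ).eigenvalues j ∈ K)
    (hk : (boxOp_isHermitian a V Λ).eigenvalues k ∈ K) : HasTwoEigenvaluesIn a V Λ K := by
  refine ⟨_, hj, _, hk, _, _, isBoxEigenfunction_specVec Λ j, isBoxEigenfunction_specVec Λ k, ?_⟩
  rw [← Finset.sum_coe_sort Λ]
  simp only [zeroExtend_coe]
  rw [specVec_orth, if_neg hjk]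

/-- If the projection kernel is small on the diagonal outside `[p, q]` and the projection has rank
at least two, then the box `[p, q]` has two eigenvalues. -/
theorem hasTwoEigenvaluesIn_of_projKernel {L : ℕ} {p q : ℤ} {τ : ℝ} (ha : ∀ n, |a n| ≤ M)
    (hp : 1 ≤ p) (hq : q ≤ L) (hL : 1 ≤ L) (hε : 0 ≤ ε) (hε1 : ε ≤ 1) (hτ : 0 ≤ τ)
    (hτ2 : 2 * ((1 + 4 * M ^ 2) * L * τ) ≤ ε ^ 2)
    (hout : ∀ i : boxL L, (i : ℤ) ∉ Finset.Icc p q → projKernel a V L E ε i i ≤ τ)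
    {j k : boxL L} (hjk : j ≠ k)
    (hj : (boxOp_isHermitian a V (boxL L)).eigenvalues j ∈ Set.Icc (E - ε) (E + ε))
    (hk : (boxOp_isHermitian a V (boxL L)).eigenvalues k ∈ Set.Icc (E - ε) (E + ε)) :
    HasTwoEigenvaluesIn a V (Finset.Icc p q) (Set.Icc (E - 2 * ε) (E + 2 * ε)) := by
  set hA := boxOp_isHermitian a V (boxL L)
  set hB := boxOp_isHermitian a V (Finset.Icc p q)
  have hL1 : (1 : ℝ) ≤ L := by exact_mod_cast hL
  have hε2 : ε ^ 2 ≤ 1 := pow_le_one₀ hε hε1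
  -- This guarantees that at least half of the mass survives the cutoff (`hinner`), so that
  -- truncated combinations are nonzero.
  have hLτ : L * τ ≤ 1 / 2 := by nlinarith [mul_nonneg (mul_nonneg (sq_nonneg M) (by linarith : (0 : ℝ) ≤ L)) hτ]
  -- every combination of the two eigenfunctions is an approximate eigenvector of the small box
  have main : ∀ α β : ℝ, 0 < α ^ 2 + β ^ 2 → ∃ i, hB.eigenvalues i ∈
      Set.Icc (E - 2 * ε) (E + 2 * ε) ∧ specCoef hB (fun n : Finset.Icc p q =>
        α * zeroExtend (specVec hA j) n + β * zeroExtend (specVec hA k) n) i ≠ 0 := by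
    intro α β hαβ
    set w : boxL L → ℝ := fun i => α * specVec hA j i + β * specVec hA k i with hw
    have hwext : ∀ n, zeroExtend w n =
        α * zeroExtend (specVec hA j) n + β * zeroExtend (specVec hA k) n := by
      intro n
      by_cases h : n ∈ boxL L
      · simp [zeroExtend, h, hw]
      · simp [zeroExtend, h]
    have hcoef : ∀ i, specCoef hA w i = α * (if i = j then 1 else 0) +
        β * if i = k then 1 else 0 := by
      intro i
      rw [← specCoef_specVec hA i j, ← specCoef_specVec hA i k]
      simp only [specCoef, hw, Finset.mul_sum, ← Finset.sum_add_distrib]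
      exact Finset.sum_congr rfl fun m _ => by ring
    have hmass : ∑ n ∈ boxL L, zeroExtend w n ^ 2 = α ^ 2 + β ^ 2 := by
      rw [← Finset.sum_coe_sort (boxL L)]
      simp only [zeroExtend_coe]
      have h1 : ∑ i, w i ^ 2 = α ^ 2 * (∑ i, specVec hA j i * specVec hA j i) +
          2 * α * β * (∑ i, specVec hA j i * specVec hA k i) +
          β ^ 2 * (∑ i, specVec hA k i * specVec hA k i) := by
        simp only [hw, Finset.mul_sum, ← Finset.sum_add_distrib]
        exact Finset.sum_congr rfl fun m _ => by ring
      rw [h1, specVec_orth, specVec_orth, specVec_orth, if_pos rfl, if_pos rfl, if_neg hjk]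
      ring
    have hsmall : ∀ i : boxL L, (i : ℤ) ∉ Finset.Icc p q → w i ^ 2 ≤ τ * (α ^ 2 + β ^ 2) := by
      intro i hi
      have h1 := specVec_sq_add_sq_le_projKernel L hjk hj hk i
      have h2 := hout i hi
      have h3 : w i ^ 2 ≤ (specVec hA j i ^ 2 + specVec hA k i ^ 2) * (α ^ 2 + β ^ 2) := by
        simp only [hw]
        nlinarith [sq_nonneg (α * specVec hA k i - β * specVec hA j i)]
      exact h3.trans (by gcongr; exact h1.trans h2)
    have hinner : (α ^ 2 + β ^ 2) / 2 ≤ ∑ n ∈ Finset.Icc p q, zeroExtend w n ^ 2 := by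
      have hsub : Finset.Icc p q ⊆ boxL L := Finset.Icc_subset_Icc hp hq
      have h1 : ∑ n ∈ boxL L \ Finset.Icc p q, zeroExtend w n ^ 2 ≤
          L * (τ * (α ^ 2 + β ^ 2)) := by
        calc ∑ n ∈ boxL L \ Finset.Icc p q, zeroExtend w n ^ 2
            ≤ ∑ n ∈ boxL L \ Finset.Icc p q, τ * (α ^ 2 + β ^ 2) := by
              refine Finset.sum_le_sum fun n hn => ?_
              rw [Finset.mem_sdiff] at hn
              have := hsmall ⟨n, hn.1⟩ hn.2
              rwa [← zeroExtend_coe w] at this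
          _ ≤ ∑ n ∈ boxL L, τ * (α ^ 2 + β ^ 2) :=
              Finset.sum_le_sum_of_subset_of_nonneg Finset.sdiff_subset
                fun _ _ _ => by positivity
          _ = L * (τ * (α ^ 2 + β ^ 2)) := by simp [boxL]
      rw [← Finset.sum_sdiff hsub] at hmass
      nlinarith
    have happ := truncate_spectral ha hp hq hL hε hε1 w (κ := τ * (α ^ 2 + β ^ 2)) (V := V)
      (E := E) (fun i hi => by
        change specCoef hA w i ≠ 0 at hi
        rw [hcoef] at hi
        by_cases h1 : i = j
        · rw [h1]; exact hj
        · by_cases h2 : i = k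
          · rw [h2]; exact hk
          · simp [h1, h2] at hi) (by positivity) hsmall (by nlinarith)
    by_contra! hno
    refine absurd happ (not_le.2 (lt_sum_sq_mulVec_sub hB (by linarith) ?_ fun i hi => ?_))
    · by_contra! h0
      have : ∑ n ∈ Finset.Icc p q, zeroExtend w n ^ 2 = 0 :=
        Finset.sum_eq_zero fun n hn => by
          have := h0 ⟨n, hn⟩
          simp only at this
          rw [this]; ring
      linarith
    · intro hmem
      have h1 := hno i hmem
      simp only [hwext] at hi
      exact hi h1
  obtain ⟨i₀, hi₀, -⟩ := main 1 0 (by norm_num)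
  set cj := specCoef hB (fun n : Finset.Icc p q => zeroExtend (specVec hA j) n) i₀ with hcj
  set ck := specCoef hB (fun n : Finset.Icc p q => zeroExtend (specVec hA k) n) i₀ with hck
  have hlin : ∀ α β : ℝ, specCoef hB (fun n : Finset.Icc p q =>
        α * zeroExtend (specVec hA j) n + β * zeroExtend (specVec hA k) n) i₀ =
        α * cj + β * ck := by
    intro α β
    simp only [hcj, hck, specCoef, Finset.mul_sum, ← Finset.sum_add_distrib]
    exact Finset.sum_congr rfl fun m _ => by ring
  -- In a two-dimensional space some nontrivial combination has no component along the eigenvector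
  -- `i₀`; the eigenvalue that it detects must have another index.
  obtain ⟨α, β, hαβ, h0⟩ : ∃ α β : ℝ, 0 < α ^ 2 + β ^ 2 ∧ α * cj + β * ck = 0 := by
    by_cases h : cj = 0
    · exact ⟨1, 0, by norm_num, by simp [h]⟩
    · exact ⟨ck, -cj, add_pos_of_nonneg_of_pos (sq_nonneg _) (by rw [neg_sq]; positivity),
        by ring⟩
  obtain ⟨i₁, hi₁, hne⟩ := main α β hαβ
  refine hasTwoEigenvaluesIn_of_ne (j := i₀) (k := i₁) ?_ hi₀ hi₁
  rintro rfl
  exact hne ((hlin α β).trans h0)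

end Localization

/-! ### Counting eigenvalues by small boxes on the good event -/

section Counting

variable {a V : ℤ → ℝ} {M E ε : ℝ}

/-- The part of the box of radius `r` around `x` that lies in `Λ_L`. -/
noncomputable def siteBox (L r : ℕ) (x : ℤ) : Finset ℤ :=
  Finset.Icc (max 1 (x - r)) (min L (x + r))

/-- The number of pairs of sites at distance at least `R` whose boxes of radius `r` both have an
eigenvalue in `K`. -/
noncomputable def farPairCount (a V : ℤ → ℝ) (L r R : ℕ) (K : Set ℝ) : ℕ := by
  classical
  exact ((boxL L ×ˢ boxL L).filter fun p => (R : ℤ) ≤ |p.1 - p.2| ∧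
    HasEigenvalueIn a V (siteBox L r p.1) K ∧ HasEigenvalueIn a V (siteBox L r p.2) K).card

/-- The number of intervals of `2 R + 1` sites in `Λ_L` with two eigenvalues in `K`. -/
noncomputable def doubleCount (a V : ℤ → ℝ) (L R : ℕ) (K : Set ℝ) : ℕ := by
  classical
  exact ((Finset.Icc 1 ((L : ℤ) - 2 * R)).filter fun m =>
    HasTwoEigenvaluesIn a V (Finset.Icc m (m + 2 * R)) K).card

/-- On the event where the projection kernel decays off the diagonal, the number of eigenvalues,
if at least two, is controlled by pairs of eigenvalues of small boxes. -/
theorem card_eigenvalues_le {L r R : ℕ} {κ τ : ℝ} (ha : ∀ n, |a n| ≤ M)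
    (hRL : 2 * R + 1 ≤ L) (hε : 0 ≤ ε) (hε1 : ε ≤ 1) (hτ : 0 < τ)
    (hτ2 : 2 * ((1 + 4 * M ^ 2) * L * τ) ≤ ε ^ 2) (hκ0 : 0 ≤ κ)
    (hκ2 : (1 + 4 * M ^ 2) * L * κ ≤ ε ^ 2 * τ ^ 2)
    (hgood : ∀ x y : boxL L, (r : ℤ) ≤ |(x : ℤ) - y| → projKernel a V L E ε x y ^ 2 ≤ κ)
    {N : ℕ} (hN : specTrace a V (boxL L) (Set.Icc (E - ε) (E + ε)) = N) (hN2 : 2 ≤ N) :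
    N ≤ farPairCount a V L r R (Set.Icc (E - 2 * ε) (E + 2 * ε)) +
      (2 * R + 1) * doubleCount a V L R (Set.Icc (E - 2 * ε) (E + 2 * ε)) := by
  classical
  have hL1 : (1 : ℝ) ≤ L := by exact_mod_cast (by omega : 1 ≤ L)
  have hε2 : ε ^ 2 ≤ 1 := pow_le_one₀ hε hε1
  -- The sites outside `X` contribute less than 1 to the trace, hence nothing to an integer count.
  have hLτ : L * τ < 1 := by
    nlinarith [mul_nonneg (mul_nonneg (sq_nonneg M) (by linarith : (0 : ℝ) ≤ L)) hτ.le]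
  set X : Finset (boxL L) := Finset.univ.filter fun x => τ ≤ projKernel a V L E ε x x with hX
  have hmemX : ∀ x, x ∈ X ↔ τ ≤ projKernel a V L E ε x x := by simp [hX]
  have hcard : N ≤ X.card := by
    have h1 : (N : ℝ) = ∑ x, projKernel a V L E ε x x := by rw [← hN]; rfl
    have h2 : ∑ x, projKernel a V L E ε x x ≤ ∑ x : boxL L, ((if x ∈ X then 1 else 0) + τ) := by
      refine Finset.sum_le_sum fun x _ => ?_
      split_ifs with h
      · have := projKernel_diag_le_one (a := a) (V := V) (E := E) (ε := ε) L x
        linarith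
      · rw [hmemX, not_le] at h
        linarith
    rw [Finset.sum_add_distrib] at h2
    have h3 : ∑ x : boxL L, (if x ∈ X then (1 : ℝ) else 0) = X.card := by
      rw [Finset.sum_ite_mem, Finset.univ_inter]
      simp
    have h4 : ∑ _x : boxL L, τ = L * τ := by
      rw [Finset.sum_const, Finset.card_univ, Fintype.card_coe]
      simp [boxL]
    rw [h3, h4, ← h1] at h2
    have h5 : (N : ℝ) < (X.card + 1 : ℕ) := by push_cast; linarith
    exact Nat.lt_succ_iff.1 (by exact_mod_cast h5)
  have hXne : X.Nonempty := Finset.card_pos.1 (by omega)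
  obtain ⟨x₀, hx₀, hmin⟩ := X.exists_min_image (fun x => (x : ℤ)) hXne
  obtain ⟨x₁, hx₁, hmax⟩ := X.exists_max_image (fun x => (x : ℤ)) hXne
  have hrange : ∀ x : boxL L, 1 ≤ (x : ℤ) ∧ (x : ℤ) ≤ L := fun x => Finset.mem_Icc.1 x.2
  rcases le_or_gt ((x₁ : ℤ) - x₀) (2 * R) with hdiam | hdiam
  -- The window starts at the leftmost site of `X`, moved left if necessary to stay within `Λ_L`.
  · set m : ℤ := min x₀ (L - 2 * R) with hm
    have hXin : ∀ x ∈ X, (x : ℤ) ∈ Finset.Icc m (m + 2 * R) := by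
      intro x hx
      have h1 := hmin x hx
      have h2 := hmax x hx
      have h3 := hrange x
      rw [Finset.mem_Icc]
      omega
    have hNR : N ≤ 2 * R + 1 := by
      refine hcard.trans ?_
      have h1 : X.card ≤ (Finset.Icc m (m + 2 * R)).card :=
        Finset.card_le_card_of_injOn (fun x => (x : ℤ)) (fun x hx => hXin x hx)
          (fun x _ y _ h => Subtype.ext h)
      rw [Int.card_Icc] at h1
      omega
    have hT : HasTwoEigenvaluesIn a V (Finset.Icc m (m + 2 * R))
        (Set.Icc (E - 2 * ε) (E + 2 * ε)) := by
      rw [specTrace_eq_card, Nat.cast_inj] at hN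
      obtain ⟨j, hj, k, hk, hjk⟩ := Finset.one_lt_card.1
        (lt_of_lt_of_le one_lt_two (hN2.trans hN.ge))
      rw [Finset.mem_filter] at hj hk
      have h1 := hrange x₀
      refine hasTwoEigenvaluesIn_of_projKernel ha (by omega) (by omega) (by omega) hε hε1 hτ.le
        hτ2 (fun i hi => ?_) hjk hj.2 hk.2
      by_contra h
      exact hi (hXin i ((hmemX i).2 (by linarith)))
    have hpos : 1 ≤ doubleCount a V L R (Set.Icc (E - 2 * ε) (E + 2 * ε)) := by
      rw [doubleCount]
      refine Finset.card_pos.2 ⟨m, Finset.mem_filter.2 ⟨?_, hT⟩⟩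
      have h1 := hrange x₀
      rw [Finset.mem_Icc]
      omega
    nlinarith
  · have hS : ∀ x ∈ X, HasEigenvalueIn a V (siteBox L r x) (Set.Icc (E - 2 * ε) (E + 2 * ε)) := by
      intro x hx
      have h1 := hrange x
      refine hasEigenvalueIn_of_projKernel ha (le_max_left _ _) (min_le_left _ _) (by omega) hε hε1
        x ?_ hτ ((hmemX x).1 hx) hκ0 (fun i hi => hgood x i ?_) hκ2
      · rw [Finset.mem_Icc]; omega
      · have h2 := hrange i
        rw [Finset.mem_Icc] at hi
        rcases abs_cases ((x : ℤ) - i) with ⟨h, _⟩ | ⟨h, _⟩ <;> omega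
    refine le_trans ?_ (Nat.le_add_right _ _)
    refine hcard.trans ?_
    rw [farPairCount]
    refine Finset.card_le_card_of_injOn
      -- The extremes are more than `2 * R` apart, so a site close to one is far from the other.
      -- Injectivity comes from the second coordinate.
      (fun x => if (R : ℤ) ≤ |(x₀ : ℤ) - x| then ((x₀ : ℤ), (x : ℤ)) else (x₁, (x : ℤ)))
      (fun x hx => ?_) (fun x _ y _ h => ?_)
    · rw [Finset.mem_coe] at hx
      rw [Finset.mem_coe, Finset.mem_filter]
      dsimp only
      split_ifs with h
      · exact ⟨Finset.mem_product.2 ⟨x₀.2, x.2⟩, h, hS _ hx₀, hS _ hx⟩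
      · refine ⟨Finset.mem_product.2 ⟨x₁.2, x.2⟩, ?_, hS _ hx₁, hS _ hx⟩
        have h1 := hmin x hx
        have h2 := hmax x hx
        rcases abs_cases ((x₀ : ℤ) - x) with ⟨h, _⟩ | ⟨h, _⟩ <;>
        rcases abs_cases ((x₁ : ℤ) - x) with ⟨h', _⟩ | ⟨h', _⟩ <;> simp only <;> omega
    · have h2 := congrArg Prod.snd h
      apply Subtype.ext
      simp only at h2
      split_ifs at h2 <;> exact h2

end Counting

/-! ### Measurability of the kernel and of eigenvalue events -/

section Measurability

theorem pow_apply_eq_sum {n : Type*} [Fintype n] [DecidableEq n] {A : Matrix n n ℝ}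
    (hA : A.IsHermitian) (k : ℕ) (x y : n) :
    (A ^ k) x y = ∑ j, hA.eigenvalues j ^ k * specVec hA j x * specVec hA j y := by
  induction k generalizing x y with
  | zero => simp only [pow_zero, one_mul, specVec_complete, Matrix.one_apply]
  | succ k ih =>
    rw [pow_succ', Matrix.mul_apply]
    simp only [ih, Finset.mul_sum]
    rw [Finset.sum_comm]
    refine Finset.sum_congr rfl fun j _ => ?_
    have h := mulVec_specVec hA j x
    rw [pow_succ, mul_assoc (_ ^ k), ← h, Matrix.mulVec, dotProduct, Finset.mul_sum,
      Finset.sum_mul]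
    exact Finset.sum_congr rfl fun z _ => by ring

theorem exists_polynomial_tendsto_indicator_Icc (E ε : ℝ) :
    ∃ p : ℕ → Polynomial ℝ, ∀ t : ℝ, Filter.Tendsto (fun n => (p n).eval t) Filter.atTop
      (nhds ((Set.Icc (E - ε) (E + ε)).indicator (fun _ => 1) t)) := by
  -- Continuous trapezoids that equal the indicator at each fixed point from some `n` on.
  -- Approximating them on the growing intervals `[-n, n]` gives pointwise convergence on the whole
  -- line.
  set f : ℕ → ℝ → ℝ := fun n t => max 0 (1 - n * max 0 (|t - E| - ε)) with hf
  have hex : ∀ n : ℕ, ∃ p : Polynomial ℝ, ∀ t ∈ Set.Icc (-(n : ℝ)) n,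
      |p.eval t - f n t| < 1 / ((n : ℝ) + 1) := fun n =>
    exists_polynomial_near_of_continuousOn _ _ (f n) (by simp only [hf]; fun_prop) _ (by positivity)
  choose p hp using hex
  refine ⟨p, fun t => ?_⟩
  have hlim : ∀ᶠ n : ℕ in Filter.atTop,
      f n t = (Set.Icc (E - ε) (E + ε)).indicator (fun _ => 1) t := by
    by_cases ht : t ∈ Set.Icc (E - ε) (E + ε)
    · filter_upwards with n
      rw [Set.indicator_of_mem ht]
      have : |t - E| - ε ≤ 0 := by
        rw [sub_nonpos, abs_le]; constructor <;> linarith [ht.1, ht.2]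
      simp [hf, max_eq_left this]
    · have hpos : 0 < |t - E| - ε := by
        by_contra! h
        apply ht
        have := abs_le.1 (sub_nonpos.1 h)
        constructor <;> linarith [this.1, this.2]
      filter_upwards [Filter.eventually_ge_atTop ⌈1 / (|t - E| - ε)⌉₊] with n hn
      rw [Set.indicator_of_notMem ht]
      have h1 : 1 / (|t - E| - ε) ≤ n := (Nat.le_ceil _).trans (by exact_mod_cast hn)
      rw [div_le_iff₀ hpos] at h1
      simp only [hf, max_eq_right hpos.le]
      exact max_eq_left (by linarith)
  have hzero : Filter.Tendsto (fun n => (p n).eval t - f n t) Filter.atTop (nhds 0) := by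
    refine squeeze_zero_norm' ?_ (tendsto_one_div_add_atTop_nhds_zero_nat (𝕜 := ℝ))
    filter_upwards [Filter.eventually_ge_atTop ⌈|t|⌉₊] with n hn
    have h1 : |t| ≤ n := (Nat.le_ceil _).trans (by exact_mod_cast hn)
    exact (hp n t (abs_le.1 h1)).le
  have h2 : Filter.Tendsto (fun n => f n t) Filter.atTop
      (nhds ((Set.Icc (E - ε) (E + ε)).indicator (fun _ => 1) t)) :=
    tendsto_const_nhds.congr' (hlim.mono fun n h => h.symm)
  simpa using hzero.add h2

variable {Ω : Type*} [MeasurableSpace Ω] {a V : Ω → ℤ → ℝ}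

theorem measurable_boxOp (ha : Measurable a) (hV : Measurable V) (Λ : Finset ℤ) (i j : Λ) :
    Measurable fun ω => boxOp (a ω) (V ω) Λ i j := by
  have h1 : ∀ n, Measurable fun ω => a ω n := fun n => (measurable_pi_apply n).comp ha
  have h2 : ∀ n, Measurable fun ω => V ω n := fun n => (measurable_pi_apply n).comp hV
  simp only [boxOp, Matrix.of_apply, jacobiOp]
  exact (((h1 _).mul_const _).add ((h1 _).mul_const _)).add ((h2 _).mul_const _)

/-- Entries of a polynomial in the matrix are polynomials in its entries, and the kernel is a
pointwise limit of such. This avoids choosing eigenvectors measurably. -/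
theorem measurable_projKernel (ha : Measurable a) (hV : Measurable V) (L : ℕ) (E ε : ℝ)
    (x y : boxL L) : Measurable fun ω => projKernel (a ω) (V ω) L E ε x y := by
  obtain ⟨p, hp⟩ := exists_polynomial_tendsto_indicator_Icc E ε
  have hpow : ∀ (k : ℕ) (x y : boxL L),
      Measurable fun ω => (boxOp (a ω) (V ω) (boxL L) ^ k) x y := by
    intro k
    induction k with
    | zero => intro x y; simp only [pow_zero]; exact measurable_const
    | succ k ih =>
      intro x y
      simp only [pow_succ, Matrix.mul_apply]
      exact Finset.measurable_sum _ fun z _ => (ih x z).mul (measurable_boxOp ha hV _ z y)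
  have hpoly : ∀ q : Polynomial ℝ, Measurable fun ω => ∑ j,
      q.eval ((boxOp_isHermitian (a ω) (V ω) (boxL L)).eigenvalues j) *
        specVec (boxOp_isHermitian (a ω) (V ω) (boxL L)) j x *
        specVec (boxOp_isHermitian (a ω) (V ω) (boxL L)) j y := by
    intro q
    have : ∀ ω, ∑ j, q.eval ((boxOp_isHermitian (a ω) (V ω) (boxL L)).eigenvalues j) *
        specVec (boxOp_isHermitian (a ω) (V ω) (boxL L)) j x *
        specVec (boxOp_isHermitian (a ω) (V ω) (boxL L)) j y =
        ∑ k ∈ Finset.range (q.natDegree + 1), q.coeff k *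
          (boxOp (a ω) (V ω) (boxL L) ^ k) x y := by
      intro ω
      simp only [pow_apply_eq_sum (boxOp_isHermitian (a ω) (V ω) (boxL L)), Finset.mul_sum]
      rw [Finset.sum_comm]
      refine Finset.sum_congr rfl fun j _ => ?_
      rw [Polynomial.eval_eq_sum_range, Finset.sum_mul, Finset.sum_mul]
      exact Finset.sum_congr rfl fun k _ => by ring
    simp only [this]
    exact Finset.measurable_sum _ fun k _ => (hpow k x y).const_mul _
  refine measurable_of_tendsto_metrizable (fun n => hpoly (p n)) ?_
  rw [tendsto_pi_nhds]
  intro ω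
  rw [projKernel_apply]
  exact tendsto_finsetSum _ fun j _ => ((hp _).mul_const _).mul_const _

/-- The set of matrices on `Λ` with an eigenvalue in `K`. -/
def eigenvalueSet (Λ : Finset ℤ) (K : Set ℝ) : Set (Λ → Λ → ℝ) :=
  {A | ∃ t ∈ K, (Matrix.of A - t • (1 : Matrix Λ Λ ℝ)).det = 0}

/-- The pairs (t, A) with singular A - t form a closed set, and projecting along the compact `K`
keeps it closed. -/
theorem measurableSet_eigenvalueSet (Λ : Finset ℤ) {K : Set ℝ} (hK : IsCompact K) :
    MeasurableSet (eigenvalueSet Λ K) := by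
  have : CompactSpace K := isCompact_iff_compactSpace.1 hK
  have hcont : Continuous fun p : K × (Λ → Λ → ℝ) =>
      (Matrix.of p.2 - (p.1 : ℝ) • (1 : Matrix Λ Λ ℝ)).det := by
    refine Continuous.matrix_det ?_
    refine Continuous.sub ?_ ?_
    · exact continuous_snd
    · exact (continuous_subtype_val.comp continuous_fst).smul continuous_const
  have hcl : IsClosed {p : K × (Λ → Λ → ℝ) |
      (Matrix.of p.2 - (p.1 : ℝ) • (1 : Matrix Λ Λ ℝ)).det = 0} :=
    isClosed_eq hcont continuous_const
  have himg := isClosedMap_snd_of_compactSpace _ hcl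
  convert himg.measurableSet using 1
  ext A
  simp [eigenvalueSet]

theorem boxOp_mem_eigenvalueSet_iff (a V : ℤ → ℝ) (Λ : Finset ℤ) (K : Set ℝ) :
    (fun i j => boxOp a V Λ i j) ∈ eigenvalueSet Λ K ↔ HasEigenvalueIn a V Λ K := by
  have hof : Matrix.of (fun i j => boxOp a V Λ i j) = boxOp a V Λ := rfl
  simp only [eigenvalueSet, Set.mem_ofPred_eq, hof, ← Matrix.exists_mulVec_eq_zero_iff]
  constructor
  · rintro ⟨t, ht, w, hw0, hw⟩
    obtain ⟨i, hi⟩ := Function.ne_iff.1 hw0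
    rw [hasEigenvalueIn_iff]
    obtain ⟨j, hj⟩ := exists_eigenvalue_eq (boxOp_isHermitian a V Λ) (w := w) (E := t) ⟨i, hi⟩
      (fun i => by
        have := congrFun hw i
        simp only [Matrix.sub_mulVec, Matrix.smul_mulVec, Matrix.one_mulVec, Pi.sub_apply,
          Pi.smul_apply, smul_eq_mul, Pi.zero_apply] at this
        linarith)
    exact ⟨j, hj ▸ ht⟩
  · rintro ⟨t, ht, u, ⟨m, hm⟩, hu0, hu⟩
    refine ⟨t, ht, fun j : Λ => u j, ?_, ?_⟩
    · refine Function.ne_iff.2 ⟨⟨m, by by_contra h; exact hm (hu0 m h)⟩, hm⟩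
    · funext i
      simp only [Matrix.sub_mulVec, Matrix.smul_mulVec, Matrix.one_mulVec, Pi.sub_apply,
          Pi.smul_apply, smul_eq_mul, Pi.zero_apply]
      rw [boxOp_mulVec_of_support hu0, hu i i.2, sub_self]

end Measurability

/-! ### Markov, Wegner, independence and summation of tails -/

section Probability

variable {Ω : Type*} [MeasurableSpace Ω] {μ : Measure Ω} {a V : Ω → ℤ → ℝ}

/-- A tail estimate for the projection kernel. -/
theorem measure_projKernel_ge_le (ha : Measurable a) (hV : Measurable V) {I : Set ℝ} {ξ : ℝ}
    (hξ : 0 < ξ) {K : ℝ≥0}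
    (hK : ∀ (L : ℕ) (x : boxL L) (f : ℝ → ℝ),
      Measurable f → tsupport f ⊆ I → (∀ t, |f t| ≤ 1) →
      ∫⁻ ω, ∑ y : boxL L, ENNReal.ofReal
        (Real.exp (|((y : ℤ) : ℝ) - ((x : ℤ) : ℝ)| ^ ξ) *
          |boxCalc (a ω) (V ω) (boxL L) f x y|) ∂μ ≤ K)
    {E ε : ℝ} (hI : Set.Icc (E - ε) (E + ε) ⊆ I) {L r : ℕ} {κ : ℝ} (hκ : 0 < κ) (x y : boxL L)
    (hxy : (r : ℤ) ≤ |(x : ℤ) - y|) :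
    μ {ω | κ ≤ |projKernel (a ω) (V ω) L E ε x y|} ≤
      ENNReal.ofReal (K * Real.exp (-(r : ℝ) ^ ξ) / κ) := by
  have h1 := hK L x ((Set.Icc (E - ε) (E + ε)).indicator fun _ => 1)
    (measurable_const.indicator measurableSet_Icc)
    ((closure_minimal Set.support_indicator_subset isClosed_Icc).trans hI)
    (fun t => by
      by_cases ht : t ∈ Set.Icc (E - ε) (E + ε)
      · simp [Set.indicator_of_mem ht]
      · simp [Set.indicator_of_notMem ht])
  have h2 : ∫⁻ ω, ENNReal.ofReal (Real.exp ((r : ℝ) ^ ξ) *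
      |projKernel (a ω) (V ω) L E ε x y|) ∂μ ≤ K := by
    refine le_trans (lintegral_mono fun ω => ?_) h1
    -- Of the localization sum only the term at `y` is kept; its weight is at least `exp (r ^ ξ)`.
    refine le_trans ?_ (Finset.single_le_sum (fun _ _ => zero_le) (Finset.mem_univ y))
    refine ENNReal.ofReal_le_ofReal ?_
    refine mul_le_mul_of_nonneg_right (Real.exp_le_exp.2 ?_) (abs_nonneg _)
    refine Real.rpow_le_rpow (Nat.cast_nonneg _) ?_ hξ.le
    rw [abs_sub_comm]
    exact_mod_cast hxy
  have hmeas : Measurable fun ω => ENNReal.ofReal (Real.exp ((r : ℝ) ^ ξ) *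
      |projKernel (a ω) (V ω) L E ε x y|) :=
    ((measurable_projKernel ha hV L E ε x y).abs.const_mul _).ennreal_ofReal
  have hpos : 0 < Real.exp ((r : ℝ) ^ ξ) * κ := by positivity
  have h3 := meas_ge_le_lintegral_div (μ := μ) hmeas.aemeasurable
    (ε := ENNReal.ofReal (Real.exp ((r : ℝ) ^ ξ) * κ)) (by simpa using hpos) ENNReal.ofReal_ne_top
  refine (measure_mono fun ω hω => ?_).trans (h3.trans ?_)
  · rw [Set.mem_ofPred_eq] at hω ⊢
    exact ENNReal.ofReal_le_ofReal (by gcongr)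
  · refine (ENNReal.div_le_div_right h2 _).trans ?_
    rw [← ENNReal.ofReal_coe_nnreal, ← ENNReal.ofReal_div_of_pos hpos, Real.exp_neg]
    refine ENNReal.ofReal_le_ofReal (le_of_eq ?_)
    field_simp

theorem measure_hasEigenvalueIn_le {I : Set ℝ} {s ρ C : ℝ}
    (hW : ∀ c d : ℝ, c ≤ d → Set.Icc c d ⊆ I → ∀ m n : ℕ, m ≤ n →
      μ {ω | 1 ≤ specTrace (a ω) (V ω) (Finset.Icc (m : ℤ) (n : ℤ)) (Set.Icc c d)} ≤
        ENNReal.ofReal (C * (d - c) ^ s * ((Finset.Icc (m : ℤ) (n : ℤ)).card : ℝ) ^ ρ))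
    (hC : 0 ≤ C) (hρ : 0 ≤ ρ) {E D : ℝ} (hD : 0 ≤ D) (hI : Set.Icc (E - D) (E + D) ⊆ I)
    {p q : ℤ} {l : ℕ} (hp : 0 ≤ p) (hl : q - p + 1 ≤ l) :
    μ {ω | HasEigenvalueIn (a ω) (V ω) (Finset.Icc p q) (Set.Icc (E - D) (E + D))} ≤
      ENNReal.ofReal (C * (2 * D) ^ s * (l : ℝ) ^ ρ) := by
  rcases lt_or_ge q p with hqp | hpq
  · have : {ω | HasEigenvalueIn (a ω) (V ω) (Finset.Icc p q) (Set.Icc (E - D) (E + D))} = ∅ := by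
      ext ω
      simpa using not_hasEigenvalueIn_of_lt hqp _
    rw [this, measure_empty]
    exact zero_le
  · have h := hW (E - D) (E + D) (by linarith) hI p.toNat q.toNat (by omega)
    rw [Int.toNat_of_nonneg hp, Int.toNat_of_nonneg (hp.trans hpq)] at h
    simp only [one_le_specTrace_iff] at h
    refine h.trans (ENNReal.ofReal_le_ofReal ?_)
    rw [show E + D - (E - D) = 2 * D by ring, Int.card_Icc]
    have h1 : 0 ≤ (2 * D) ^ s := Real.rpow_nonneg (by linarith) _
    gcongr
    omega

/-- Having an eigenvalue in the compact set `K` is a measurable condition on the matrix alone, so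
independence of the two random matrices passes to the events. -/
theorem measure_two_hasEigenvalueIn_eq {S : ℕ}
    (hS : ∀ (n : ℕ) (c d : Fin n → ℤ), (∀ k, c k ≤ d k) →
      (∀ k k' : Fin n, k ≠ k' → ∀ x ∈ Finset.Icc (c k) (d k), ∀ y ∈ Finset.Icc (c k') (d k'),
        (S : ℤ) ≤ |x - y|) →
      iIndepFun (β := fun k : Fin n =>
          Finset.Icc (c k) (d k) → Finset.Icc (c k) (d k) → ℝ)
        (fun k ω i j => boxOp (a ω) (V ω) (Finset.Icc (c k) (d k)) i j) μ)
    {p₁ q₁ p₂ q₂ : ℤ} (h₁ : p₁ ≤ q₁) (h₂ : p₂ ≤ q₂)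
    (hdist : ∀ x ∈ Finset.Icc p₁ q₁, ∀ y ∈ Finset.Icc p₂ q₂, (S : ℤ) ≤ |x - y|)
    {K : Set ℝ} (hK : IsCompact K) :
    μ {ω | HasEigenvalueIn (a ω) (V ω) (Finset.Icc p₁ q₁) K ∧
        HasEigenvalueIn (a ω) (V ω) (Finset.Icc p₂ q₂) K} =
      μ {ω | HasEigenvalueIn (a ω) (V ω) (Finset.Icc p₁ q₁) K} *
      μ {ω | HasEigenvalueIn (a ω) (V ω) (Finset.Icc p₂ q₂) K} := by
  have h := hS 2 ![p₁, p₂] ![q₁, q₂] (by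
      intro k; fin_cases k
      · exact h₁
      · exact h₂) (by
      intro k k' hkk'
      fin_cases k <;> fin_cases k'
      · exact absurd rfl hkk'
      · exact hdist
      · intro x hx y hy
        rw [abs_sub_comm]
        exact hdist y hy x hx
      · exact absurd rfl hkk')
  have h2 := (h.indepFun (i := 0) (j := 1) (by decide)).measure_inter_preimage_eq_mul
    (eigenvalueSet (Finset.Icc p₁ q₁) K) (eigenvalueSet (Finset.Icc p₂ q₂) K)
    (measurableSet_eigenvalueSet _ hK) (measurableSet_eigenvalueSet _ hK)
  have e1 : ∀ p q : ℤ, (fun ω (i j : Finset.Icc p q) => boxOp (a ω) (V ω) (Finset.Icc p q) i j) ⁻¹'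
      eigenvalueSet (Finset.Icc p q) K =
      {ω | HasEigenvalueIn (a ω) (V ω) (Finset.Icc p q) K} := by
    intro p q
    ext ω
    exact boxOp_mem_eigenvalueSet_iff (a ω) (V ω) _ K
  have e2 := e1 p₁ q₁
  have e3 := e1 p₂ q₂
  rw [Set.ofPred_and, ← e2, ← e3]
  exact h2

/-- Summing the distribution function of an integer random variable bounded by a weighted number
of events. -/
theorem tsum_measure_le_of_le_sum {ι : Type*} (s : Finset ι) (B : ι → Set Ω) (c : ι → ℕ)
    (N : Ω → ℕ)
    (h : ∀ᵐ ω ∂μ, 2 ≤ N ω → N ω ≤ ∑ i ∈ s, c i * (B i).indicator (fun _ => 1) ω) :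
    ∑' k : ℕ, μ {ω | k + 2 ≤ N ω} ≤ ∑ i ∈ s, (c i : ℝ≥0∞) * μ (B i) := by
  -- Measurable hulls replace the events, whose measurability is not assumed. The rest is the
  -- layer-cake formula for the integer variable `F`.
  set F : Ω → ℕ := fun ω => ∑ i ∈ s, c i * (toMeasurable μ (B i)).indicator (fun _ => 1) ω with hF
  have hFmeas : Measurable F :=
    Finset.measurable_sum _ fun i _ =>
      (measurable_const.indicator (measurableSet_toMeasurable _ _)).const_mul _
  have hset : ∀ k : ℕ, MeasurableSet {ω | k < F ω} := fun k =>
    hFmeas (measurableSet_Ioi (a := k))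
  have h1 : ∀ k : ℕ, μ {ω | k + 2 ≤ N ω} ≤ μ {ω | k < F ω} := by
    intro k
    refine measure_mono_ae ?_
    filter_upwards [h] with ω hω hk
    have hk' : k + 2 ≤ N ω := hk
    have h2 := hω (by omega)
    have h3 : ∑ i ∈ s, c i * (B i).indicator (fun _ => 1) ω ≤ F ω := by
      refine Finset.sum_le_sum fun i _ => Nat.mul_le_mul_left _ ?_
      exact Set.indicator_le_indicator_of_subset (subset_toMeasurable _ _) (fun _ => zero_le) ω
    change k < F ω
    omega
  calc ∑' k : ℕ, μ {ω | k + 2 ≤ N ω} ≤ ∑' k : ℕ, μ {ω | k < F ω} := ENNReal.tsum_le_tsum h1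
    _ = ∑' k : ℕ, ∫⁻ ω, {ω | k < F ω}.indicator (fun _ => 1) ω ∂μ := by
        refine tsum_congr fun k => ?_
        rw [lintegral_indicator_const (hset k), one_mul]
    _ = ∫⁻ ω, ∑' k : ℕ, {ω | k < F ω}.indicator (fun _ => 1) ω ∂μ :=
        (lintegral_tsum fun k => (measurable_const.indicator (hset k)).aemeasurable).symm
    _ = ∫⁻ ω, (F ω : ℝ≥0∞) ∂μ := by
        refine lintegral_congr fun ω => ?_
        rw [tsum_eq_sum (s := Finset.range (F ω))]
        · rw [Finset.sum_congr rfl (g := fun _ => (1 : ℝ≥0∞))]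
          · simp
          · intro k hk
            have hm : ω ∈ {ω | k < F ω} := Finset.mem_range.1 hk
            exact Set.indicator_of_mem hm _
        · intro k hk
          have hm : ω ∉ {ω | k < F ω} := fun h => hk (Finset.mem_range.2 h)
          exact Set.indicator_of_notMem hm _
    _ = ∑ i ∈ s, (c i : ℝ≥0∞) * μ (B i) := by
        have : ∀ ω, (F ω : ℝ≥0∞) = ∑ i ∈ s, (c i : ℝ≥0∞) *
            (toMeasurable μ (B i)).indicator (fun _ => 1) ω := by
          intro ω
          simp only [hF]
          push_cast
          refine Finset.sum_congr rfl fun i _ => ?_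
          by_cases hi : ω ∈ toMeasurable μ (B i) <;> simp [hi]
        simp only [this]
        rw [lintegral_finsetSum]
        · refine Finset.sum_congr rfl fun i _ => ?_
          rw [lintegral_const_mul, lintegral_indicator_const (measurableSet_toMeasurable _ _),
            one_mul, measure_toMeasurable]
          exact measurable_const.indicator (measurableSet_toMeasurable _ _)
        · exact fun i _ => (measurable_const.indicator (measurableSet_toMeasurable _ _)).const_mul _

end Probability

/-! ### Probability of double eigenvalues and the three-term bound -/

section CoreEstimate

variable {Ω : Type*} [MeasurableSpace Ω] {μ : Measure Ω} {a V : Ω → ℤ → ℝ}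

/-- The probability that a box has two eigenvalues close to `E`. -/
theorem measure_hasTwoEigenvaluesIn_le {S : ℕ}
    (hS : ∀ (n : ℕ) (c d : Fin n → ℤ), (∀ k, c k ≤ d k) →
      (∀ k k' : Fin n, k ≠ k' → ∀ x ∈ Finset.Icc (c k) (d k), ∀ y ∈ Finset.Icc (c k') (d k'),
        (S : ℤ) ≤ |x - y|) →
      iIndepFun (β := fun k : Fin n =>
          Finset.Icc (c k) (d k) → Finset.Icc (c k) (d k) → ℝ)
        (fun k ω i j => boxOp (a ω) (V ω) (Finset.Icc (c k) (d k)) i j) μ)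
    {I : Set ℝ} {s ρ C : ℝ}
    (hW : ∀ c d : ℝ, c ≤ d → Set.Icc c d ⊆ I → ∀ m n : ℕ, m ≤ n →
      μ {ω | 1 ≤ specTrace (a ω) (V ω) (Finset.Icc (m : ℤ) (n : ℤ)) (Set.Icc c d)} ≤
        ENNReal.ofReal (C * (d - c) ^ s * ((Finset.Icc (m : ℤ) (n : ℤ)).card : ℝ) ^ ρ))
    (hC : 0 ≤ C) (hρ : 0 ≤ ρ) {M Em B θ ε D E : ℝ} (hM : 0 < M)
    (hbdd : ∀ᵐ ω ∂μ, ∀ n : ℤ, 1 / M ≤ |a ω n| ∧ |a ω n| ≤ M ∧ |V ω n| ≤ M)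
    (hEm : |E| + ε ≤ Em) (hB : B = M * (2 * M + Em) + M + 1)
    (hθ : θ * ((S + 2 : ℕ) * (2 * B ^ 2) ^ (S + 2) * B ^ 2) < 1) (hε : 0 ≤ ε) (hD : 0 < D)
    (hεD : 8 * ε ≤ D) (hDθ : 16 * (ε / D) ≤ θ) (hεθ : 2 * ε ≤ θ)
    (hI : Set.Icc (E - D) (E + D) ⊆ I) {R : ℕ} (hSR : S + 2 ≤ 2 * R + 1) {m : ℤ} (hm : 0 ≤ m) :
    μ {ω | HasTwoEigenvaluesIn (a ω) (V ω) (Finset.Icc m (m + 2 * R))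
        (Set.Icc (E - ε) (E + ε))} ≤
      ENNReal.ofReal (3 * (2 * R + 1) * (C * (2 * D) ^ s * (2 * R + 1 : ℝ) ^ ρ) ^ 2) := by
  set K := Set.Icc (E - D) (E + D) with hK
  set w := C * (2 * D) ^ s * (2 * R + 1 : ℝ) ^ ρ with hw
  have hw0 : 0 ≤ w := by positivity
  set Z : ℤ × ℕ → Set Ω := fun p =>
    {ω | HasEigenvalueIn (a ω) (V ω) (Finset.Icc m p.1) K ∧
      HasEigenvalueIn (a ω) (V ω) (Finset.Icc (p.1 + (S + 2 : ℕ) + p.2) (m + 2 * R)) K} with hZ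
  -- Block length `S + 2` gives both the separation required for independence and the two sites
  -- needed by the block lemma. The second index is the excess `k₂ - k₁ - (S + 2)`, which is 0, 1 or
  -- 2.
  set T : Finset (ℤ × ℕ) := Finset.Icc m (m + 2 * R) ×ˢ Finset.range 3 with hT
  have hone : ∀ p ∈ T, μ (Z p) ≤ ENNReal.ofReal (w ^ 2) := by
    rintro ⟨k, j⟩ hp
    rw [hT, Finset.mem_product, Finset.mem_Icc, Finset.mem_range] at hp
    obtain ⟨⟨hp1, hp2⟩, -⟩ := hp
    simp only at hp1 hp2
    rcases lt_or_ge (m + 2 * R : ℤ) (k + (S + 2 : ℕ) + j) with h | h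
    · have : Z (k, j) = ∅ := by
        ext ω
        simp only [hZ, Set.mem_empty_iff_false, iff_false]
        exact fun hω => not_hasEigenvalueIn_of_lt h _ hω.2
      rw [this, measure_empty]
      exact zero_le
    · have hind := measure_two_hasEigenvalueIn_eq (μ := μ) (a := a) (V := V) hS (p₁ := m)
        (q₁ := k) (p₂ := k + (S + 2 : ℕ) + j) (q₂ := m + 2 * R) hp1 h (K := K) (by
          intro x hx y hy
          rw [Finset.mem_Icc] at hx hy
          push_cast at hy
          rw [abs_sub_comm]
          refine le_trans ?_ (le_abs_self _)
          omega) isCompact_Icc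
      change μ {ω | _ ∧ _} ≤ _
      rw [hind, sq, ENNReal.ofReal_mul hw0]
      have hl := measure_hasEigenvalueIn_le (a := a) (V := V) (μ := μ) hW hC hρ hD.le hI
        (p := m) (q := k) (l := 2 * R + 1) hm (by push_cast; omega)
      have hr := measure_hasEigenvalueIn_le (a := a) (V := V) (μ := μ) hW hC hρ hD.le hI
        (p := k + (S + 2 : ℕ) + j) (q := m + 2 * R) (l := 2 * R + 1) (by push_cast; omega)
        (by push_cast; omega)
      push_cast at hl hr
      exact mul_le_mul' hl hr
  have hsub : μ {ω | HasTwoEigenvaluesIn (a ω) (V ω) (Finset.Icc m (m + 2 * R))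
      (Set.Icc (E - ε) (E + ε))} ≤ μ (⋃ p ∈ T, Z p) := by
    refine measure_mono_ae ?_
    filter_upwards [hbdd] with ω hω hmem
    have hmem' : HasTwoEigenvaluesIn (a ω) (V ω) (Finset.Icc m (m + 2 * R))
      (Set.Icc (E - ε) (E + ε)) := hmem
    obtain ⟨E₁, h₁, E₂, h₂, u, v, hu, hv, huv⟩ := hmem'
    have habs : ∀ t ∈ Set.Icc (E - ε) (E + ε), |t| ≤ Em := by
      intro t ht
      have h1 := le_abs_self E
      have h2 := neg_abs_le E
      rw [abs_le]
      constructor <;> linarith [ht.1, ht.2]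
    obtain ⟨k₁, k₂, a1, a2, a3, a4, a5, a6⟩ := inverse_tunneling (q := S + 2) (by omega) hM
      (fun n => ⟨(hω n).1, (hω n).2.1⟩) (fun n => (hω n).2.2) (habs _ h₁) (habs _ h₂) hB hθ hε hD
      hεD hDθ hεθ h₁ h₂ hu hv huv (by push_cast; omega)
    change ω ∈ ⋃ p ∈ T, Z p
    simp only [Set.mem_iUnion]
    refine ⟨(k₁, (k₂ - k₁ - (S + 2 : ℕ)).toNat), ?_, a5, ?_⟩
    · rw [hT, Finset.mem_product, Finset.mem_Icc, Finset.mem_range]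
      push_cast at *
      omega
    · rw [show k₁ + ((S + 2 : ℕ) : ℤ) + ((k₂ - k₁ - (S + 2 : ℕ)).toNat : ℤ) = k₂ by omega]
      exact a6
  refine hsub.trans ((measure_biUnion_finset_le _ _).trans ?_)
  refine (Finset.sum_le_card_nsmul _ _ _ hone).trans ?_
  have hcard : T.card = 3 * (2 * R + 1) := by
    rw [hT, Finset.card_product, Int.card_Icc, Finset.card_range]
    omega
  rw [hcard, nsmul_eq_mul, ← ENNReal.ofReal_natCast, ← ENNReal.ofReal_mul (Nat.cast_nonneg _)]
  push_cast
  exact le_rfl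

/-- The basic estimate: pairs of far sites, boxes with two eigenvalues, and the event where
localization fails. -/
theorem minamiSum_le_counts {S : ℕ}
    (hS : ∀ (n : ℕ) (c d : Fin n → ℤ), (∀ k, c k ≤ d k) →
      (∀ k k' : Fin n, k ≠ k' → ∀ x ∈ Finset.Icc (c k) (d k), ∀ y ∈ Finset.Icc (c k') (d k'),
        (S : ℤ) ≤ |x - y|) →
      iIndepFun (β := fun k : Fin n =>
          Finset.Icc (c k) (d k) → Finset.Icc (c k) (d k) → ℝ)
        (fun k ω i j => boxOp (a ω) (V ω) (Finset.Icc (c k) (d k)) i j) μ)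
    {I : Set ℝ} {s ρ C : ℝ}
    (hW : ∀ c d : ℝ, c ≤ d → Set.Icc c d ⊆ I → ∀ m n : ℕ, m ≤ n →
      μ {ω | 1 ≤ specTrace (a ω) (V ω) (Finset.Icc (m : ℤ) (n : ℤ)) (Set.Icc c d)} ≤
        ENNReal.ofReal (C * (d - c) ^ s * ((Finset.Icc (m : ℤ) (n : ℤ)).card : ℝ) ^ ρ))
    (hC : 0 ≤ C) (hρ : 0 ≤ ρ) {M ε E κ τ w t : ℝ}
    (hbdd : ∀ᵐ ω ∂μ, ∀ n : ℤ, |a ω n| ≤ M)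
    {L r R : ℕ} (hr : 1 ≤ r) (hR : R = 2 * r + S) (hRL : 2 * R + 1 ≤ L)
    (hε : 0 ≤ ε) (hε1 : ε ≤ 1) (hτ : 0 < τ)
    (hτ2 : 2 * ((1 + 4 * M ^ 2) * L * τ) ≤ ε ^ 2)
    (hκ2 : (1 + 4 * M ^ 2) * L * κ ^ 2 ≤ ε ^ 2 * τ ^ 2)
    (hI : Set.Icc (E - 2 * ε) (E + 2 * ε) ⊆ I) (hw : 0 ≤ w) (ht : 0 ≤ t)
    (hdouble : ∀ m : ℤ, 0 ≤ m → μ {ω | HasTwoEigenvaluesIn (a ω) (V ω)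
      (Finset.Icc m (m + 2 * R)) (Set.Icc (E - 2 * ε) (E + 2 * ε))} ≤ ENNReal.ofReal w)
    (htail : ∀ x y : boxL L, (r : ℤ) ≤ |(x : ℤ) - y| →
      μ {ω | κ ≤ |projKernel (a ω) (V ω) L E ε x y|} ≤ ENNReal.ofReal t) :
    minamiSum μ a V L E ε ≤ ENNReal.ofReal
      (L ^ 2 * (C * (4 * ε) ^ s * (3 * r : ℝ) ^ ρ) ^ 2 + L * ((2 * R + 1) * w) +
        L * (L ^ 2 * t)) := by
  classical
  set K := Set.Icc (E - 2 * ε) (E + 2 * ε) with hK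
  set v := C * (4 * ε) ^ s * (3 * r : ℝ) ^ ρ with hv
  have hv0 : 0 ≤ v := by positivity
  set pairs : Finset (ℤ × ℤ) := (boxL L ×ˢ boxL L).filter fun p => (R : ℤ) ≤ |p.1 - p.2|
    with hpairs
  set starts : Finset ℤ := Finset.Icc 1 ((L : ℤ) - 2 * R) with hstarts
  set Bp : ℤ × ℤ → Set Ω := fun p => {ω | HasEigenvalueIn (a ω) (V ω) (siteBox L r p.1) K ∧
    HasEigenvalueIn (a ω) (V ω) (siteBox L r p.2) K} with hBp
  set Bt : ℤ → Set Ω := fun m => {ω | HasTwoEigenvaluesIn (a ω) (V ω)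
    (Finset.Icc m (m + 2 * R)) K} with hBt
  set bad : Set Ω := ⋃ p ∈ (Finset.univ : Finset (boxL L × boxL L)).filter
    (fun p => (r : ℤ) ≤ |(p.1 : ℤ) - p.2|),
      {ω | κ ≤ |projKernel (a ω) (V ω) L E ε p.1 p.2|} with hbad
  set N : Ω → ℕ := fun ω => (Finset.univ.filter fun j : boxL L =>
    (boxOp_isHermitian (a ω) (V ω) (boxL L)).eigenvalues j ∈ Set.Icc (E - ε) (E + ε)).card with hN
  have hNtrace : ∀ ω, specTrace (a ω) (V ω) (boxL L) (Set.Icc (E - ε) (E + ε)) = N ω :=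
    fun ω => specTrace_eq_card _ _
  have hsum : minamiSum μ a V L E ε = ∑' k : ℕ, μ {ω | k + 2 ≤ N ω} := by
    simp only [minamiSum, hNtrace, Nat.cast_le]
  rw [hsum]
  -- Three kinds of events with weights: far pairs count 1, a window with two eigenvalues counts for
  -- all its `2 * R + 1` sites, and the bad event counts `L`, the maximal number of eigenvalues.
  have hcount := tsum_measure_le_of_le_sum (μ := μ)
    (pairs.disjSum (starts.disjSum ({()} : Finset Unit)))
    (Sum.elim Bp (Sum.elim Bt fun _ => bad))
    (Sum.elim (fun _ => 1) (Sum.elim (fun _ => 2 * R + 1) fun _ => L)) N ?_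
  · refine hcount.trans ?_
    simp only [Finset.sum_disjSum, Sum.elim_inl, Sum.elim_inr, Finset.sum_singleton]
    have h1 : ∑ p ∈ pairs, ((1 : ℕ) : ℝ≥0∞) * μ (Bp p) ≤ ENNReal.ofReal (L ^ 2 * v ^ 2) := by
      have hone : ∀ p ∈ pairs, ((1 : ℕ) : ℝ≥0∞) * μ (Bp p) ≤ ENNReal.ofReal (v ^ 2) := by
        rintro ⟨x, y⟩ hp
        rw [hpairs, Finset.mem_filter, Finset.mem_product, boxL, Finset.mem_Icc,
          Finset.mem_Icc] at hp
        simp only at hp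
        obtain ⟨⟨⟨x1, x2⟩, y1, y2⟩, hxy⟩ := hp
        have hind := measure_two_hasEigenvalueIn_eq (μ := μ) (a := a) (V := V) hS
          (p₁ := max 1 (x - r)) (q₁ := min L (x + r)) (p₂ := max 1 (y - r)) (q₂ := min L (y + r))
          (by omega) (by omega) (K := K) (by
            intro m hm n hn
            rw [Finset.mem_Icc] at hm hn
            -- Sites at distance at least `2 * r + S` have boxes of radius `r` at distance at least
            -- `S`.
            rw [hR] at hxy
            push_cast at hxy
            rcases abs_cases (x - y) with ⟨h, _⟩ | ⟨h, _⟩ <;>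
            rcases abs_cases (m - n) with ⟨h', _⟩ | ⟨h', _⟩ <;> omega) isCompact_Icc
        have hbox : ∀ z : ℤ, 1 ≤ z → z ≤ L →
            μ {ω | HasEigenvalueIn (a ω) (V ω) (siteBox L r z) K} ≤ ENNReal.ofReal v := by
          intro z hz1 hz2
          have := measure_hasEigenvalueIn_le (a := a) (V := V) (μ := μ) hW hC hρ
            (by linarith : 0 ≤ 2 * ε) hI (p := max 1 (z - r)) (q := min L (z + r)) (l := 3 * r)
            (by omega) (by push_cast; omega)
          refine this.trans (le_of_eq ?_)
          rw [hv]
          push_cast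
          rw [show 2 * (2 * ε) = 4 * ε by ring]
        rw [Nat.cast_one, one_mul]
        change μ {ω | _ ∧ _} ≤ _
        refine hind.le.trans ?_
        rw [sq, ENNReal.ofReal_mul hv0]
        exact mul_le_mul' (hbox x x1 x2) (hbox y y1 y2)
      refine (Finset.sum_le_card_nsmul _ _ _ hone).trans ?_
      have hcard : pairs.card ≤ L ^ 2 := by
        refine (Finset.card_filter_le _ _).trans (le_of_eq ?_)
        rw [Finset.card_product, boxL, Int.card_Icc, sq]
        simp
      rw [nsmul_eq_mul, ← ENNReal.ofReal_natCast, ← ENNReal.ofReal_mul (Nat.cast_nonneg _)]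
      refine ENNReal.ofReal_le_ofReal ?_
      gcongr
      exact_mod_cast hcard
    have h2 : ∑ m ∈ starts, ((2 * R + 1 : ℕ) : ℝ≥0∞) * μ (Bt m) ≤
        ENNReal.ofReal (L * ((2 * R + 1) * w)) := by
      have hone : ∀ m ∈ starts, ((2 * R + 1 : ℕ) : ℝ≥0∞) * μ (Bt m) ≤
          ENNReal.ofReal ((2 * R + 1) * w) := by
        intro m hm
        rw [hstarts, Finset.mem_Icc] at hm
        rw [ENNReal.ofReal_mul (by positivity),
          show (2 * R + 1 : ℝ) = ((2 * R + 1 : ℕ) : ℝ) by push_cast; ring, ENNReal.ofReal_natCast]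
        gcongr
        exact hdouble m (by omega)
      refine (Finset.sum_le_card_nsmul _ _ _ hone).trans ?_
      have hcard : starts.card ≤ L := by
        rw [hstarts, Int.card_Icc]; omega
      rw [nsmul_eq_mul, ← ENNReal.ofReal_natCast, ← ENNReal.ofReal_mul (Nat.cast_nonneg _)]
      refine ENNReal.ofReal_le_ofReal ?_
      gcongr
    have h3 : (L : ℝ≥0∞) * μ bad ≤ ENNReal.ofReal (L * (L ^ 2 * t)) := by
      rw [ENNReal.ofReal_mul (Nat.cast_nonneg _), ENNReal.ofReal_natCast]
      gcongr
      refine (measure_biUnion_finset_le _ _).trans ?_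
      refine (Finset.sum_le_card_nsmul _ _ (ENNReal.ofReal t) fun p hp =>
        htail _ _ (Finset.mem_filter.1 hp).2).trans ?_
      rw [nsmul_eq_mul, ← ENNReal.ofReal_natCast, ← ENNReal.ofReal_mul (Nat.cast_nonneg _)]
      refine ENNReal.ofReal_le_ofReal ?_
      gcongr
      have hcard : ((Finset.univ : Finset (boxL L × boxL L)).filter
          (fun p => (r : ℤ) ≤ |(p.1 : ℤ) - p.2|)).card ≤ L ^ 2 := by
        refine (Finset.card_filter_le _ _).trans (le_of_eq ?_)
        rw [Finset.card_univ, Fintype.card_prod, Fintype.card_coe, boxL, Int.card_Icc, sq]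
        simp
      exact_mod_cast hcard
    rw [ENNReal.ofReal_add (by positivity) (by positivity),
      ENNReal.ofReal_add (by positivity) (by positivity), add_assoc]
    exact add_le_add h1 (add_le_add h2 h3)
  · filter_upwards [hbdd] with ω hω hN2
    simp only [Finset.sum_disjSum, Sum.elim_inl, Sum.elim_inr, Finset.sum_singleton]
    by_cases hgood : ω ∈ bad
    · have hNL : N ω ≤ L := by
        refine (Finset.card_filter_le _ _).trans (le_of_eq ?_)
        rw [Finset.card_univ, Fintype.card_coe, boxL, Int.card_Icc]
        simp
      rw [Set.indicator_of_mem hgood]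
      omega
    · have hmain := card_eigenvalues_le (a := a ω) (V := V ω) (E := E) (r := r) (κ := κ ^ 2) hω
        hRL hε hε1 hτ hτ2 (sq_nonneg κ) hκ2 (fun x y hxy => by
          rw [← sq_abs]
          have : ¬ κ ≤ |projKernel (a ω) (V ω) L E ε x y| := by
            intro h
            apply hgood
            simp only [hbad, Set.mem_iUnion]
            exact ⟨(x, y), Finset.mem_filter.2 ⟨Finset.mem_univ _, hxy⟩, h⟩
          push Not at this
          gcongr) (hNtrace ω) hN2
      have e1 : farPairCount (a ω) (V ω) L r R K =
          ∑ p ∈ pairs, 1 * (Bp p).indicator (fun _ => 1) ω := by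
        rw [farPairCount, ← Finset.filter_filter, Finset.card_filter]
        refine Finset.sum_congr ?_ fun p _ => ?_
        · rw [hpairs]
        · rw [one_mul, Set.indicator_apply]
          rfl
      have e2 : (2 * R + 1) * doubleCount (a ω) (V ω) L R K =
          ∑ m ∈ starts, (2 * R + 1) * (Bt m).indicator (fun _ => 1) ω := by
        rw [doubleCount, Finset.card_filter, Finset.mul_sum]
        refine Finset.sum_congr rfl fun p _ => ?_
        rw [Set.indicator_apply]
        rfl
      change N ω ≤ farPairCount (a ω) (V ω) L r R K +
        (2 * R + 1) * doubleCount (a ω) (V ω) L R K at hmain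
      rw [e1, e2] at hmain
      omega

end CoreEstimate

/-! ### The decorrelation estimate with explicit constants -/

section MinamiSum

variable {Ω : Type*} [MeasurableSpace Ω] {μ : Measure Ω} {a V : Ω → ℤ → ℝ}

theorem minamiSum_mono (L : ℕ) (E : ℝ) {ε ε' : ℝ} (h : ε ≤ ε') :
    minamiSum μ a V L E ε ≤ minamiSum μ a V L E ε' := by
  classical
  refine ENNReal.tsum_le_tsum fun k => measure_mono fun ω hω => ?_
  rw [Set.mem_ofPred_eq, specTrace_eq_card] at hω ⊢
  refine hω.trans (Nat.cast_le.2 (Finset.card_le_card fun j hj => ?_))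
  rw [Finset.mem_filter] at hj ⊢
  exact ⟨hj.1, Set.Icc_subset_Icc (by linarith) (by linarith) hj.2⟩

theorem minamiSum_le [IsProbabilityMeasure μ] (L : ℕ) (E ε : ℝ) :
    minamiSum μ a V L E ε ≤ ENNReal.ofReal L := by
  classical
  rw [minamiSum, tsum_eq_sum (s := Finset.range L)]
  · refine (Finset.sum_le_card_nsmul _ _ 1 fun k _ => prob_le_one).trans ?_
    rw [Finset.card_range, ENNReal.ofReal_natCast]
    simp
  · intro k hk
    rw [Finset.mem_range] at hk
    have : {ω | ((k + 2 : ℕ) : ℝ) ≤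
        specTrace (a ω) (V ω) (boxL L) (Set.Icc (E - ε) (E + ε))} = ∅ := by
      refine Set.eq_empty_of_forall_notMem fun ω hω => ?_
      rw [Set.mem_ofPred_eq, specTrace_eq_card, Nat.cast_le] at hω
      have h2 := hω.trans (Finset.card_filter_le _ _)
      rw [Finset.card_univ, Fintype.card_coe, boxL, Int.card_Icc] at h2
      omega
    rw [this, measure_empty]

theorem weighted_sum_le {p q r X Y Z : ℝ} (hp : 0 ≤ p) (hq : 0 ≤ q) (hr : 0 ≤ r) (hX : 0 ≤ X)
    (hY : 0 ≤ Y) (hZ : 0 ≤ Z) : p * X + q * Y + r * Z ≤ (p + q + r + 1) * (X + Y + Z) := by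
  nlinarith [mul_nonneg hp hY, mul_nonneg hp hZ, mul_nonneg hq hX, mul_nonneg hq hZ,
    mul_nonneg hr hX, mul_nonneg hr hY]

set_option maxHeartbeats 1000000 in
/-- The basic decorrelation estimate with explicit dependence on the length scale `r`. -/
theorem exists_minamiSum_le (ha : Measurable a) (hV : Measurable V)
    (hbdd : ∃ M : ℝ, 0 < M ∧ ∀ᵐ ω ∂μ, ∀ n : ℤ, 1 / M ≤ |a ω n| ∧ |a ω n| ≤ M ∧ |V ω n| ≤ M)
    {I : Set ℝ} (hI : IsOpen I) {s ρ : ℝ} (hρ : 0 ≤ ρ)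
    (hIAD : IndepAtDistance μ a V) (hW : WegnerEstimate μ a V I s ρ) (hLoc : LocalizedOn μ a V I)
    {J : Set ℝ} (hJ : IsCompact J) (hJI : J ⊆ I) {ξ : ℝ} (hξ : 0 < ξ) (hξ1 : ξ < 1) :
    ∃ A : ℝ, 0 < A ∧ ∃ ε₁ : ℝ, 0 < ε₁ ∧ ∃ S : ℕ, ∀ E ∈ J, ∀ L r : ℕ, 1 ≤ r → S * r ≤ L →
      ∀ ε : ℝ, 0 < ε → ε ≤ ε₁ → minamiSum μ a V L E ε ≤ ENNReal.ofReal
        (A * ((ε ^ s * L * (r : ℝ) ^ ρ) ^ 2 + L * (ε ^ s * (r * (r : ℝ) ^ ρ)) ^ 2 +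
          (L : ℝ) ^ 5 / ε ^ 3 * Real.exp (-(r : ℝ) ^ ξ))) := by
  obtain ⟨M, hM, hbdd⟩ := hbdd
  obtain ⟨S, hS⟩ := hIAD
  obtain ⟨C, hC, hW⟩ := hW
  obtain ⟨K, hK⟩ := hLoc ξ hξ hξ1
  obtain ⟨δ, hδ, hδI⟩ := hJ.exists_cthickening_subset_open hI hJI
  obtain ⟨E₀, hE₀⟩ := hJ.isBounded.exists_norm_le
  have hsubI : ∀ E ∈ J, ∀ D ≤ δ, Set.Icc (E - D) (E + D) ⊆ I := by
    intro E hE D hD t ht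
    refine hδI (Metric.mem_cthickening_of_dist_le t E δ J hE ?_)
    rw [Real.dist_eq, abs_le]
    constructor <;> linarith [ht.1, ht.2]
  set Em := E₀ + 2 with hEm
  set B := M * (2 * M + Em) + M + 1 with hB
  set P : ℝ := (S + 2 : ℕ) * (2 * B ^ 2) ^ (S + 2) * B ^ 2 with hP
  have hP0 : 0 ≤ P := by positivity
  -- `P` is the stability constant of the block lemma, so θ is the admissible relative discrepancy.
  set θ : ℝ := 1 / (P + 1) with hθ
  have hθ0 : 0 < θ := by positivity
  have hθ1 : θ ≤ 1 := by
    rw [hθ, div_le_one (by positivity)]; linarith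
  have hθP : θ * P < 1 := by
    rw [hθ, one_div, inv_mul_lt_iff₀ (by positivity)]; linarith
  set G := 1 + 4 * M ^ 2 with hG
  have hG1 : 1 ≤ G := by rw [hG]; nlinarith [sq_nonneg M]
  clear_value P θ G B
  set S₁ := 2 * S + 5 with hS₁
  set A₁ := C * 4 ^ s * 3 ^ ρ with hA₁
  set A₂ := C * (64 / θ) ^ s * (S₁ : ℝ) ^ ρ with hA₂
  refine ⟨A₁ ^ 2 + 3 * S₁ ^ 2 * A₂ ^ 2 + 2 * G ^ 2 * K + 1, by positivity,
    min (θ / 4) (δ * θ / 32), by positivity, S₁, fun E hE L r hr hrL ε hε hεε => ?_⟩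
  clear_value S₁ A₁ A₂
  have hε4 : ε ≤ θ / 4 := hεε.trans (min_le_left _ _)
  have hεδ : ε ≤ δ * θ / 32 := hεε.trans (min_le_right _ _)
  have hr1 : (1 : ℝ) ≤ r := by exact_mod_cast hr
  set R := 2 * r + S with hR
  have hRS : 2 * R + 1 ≤ S₁ * r := by
    rw [hR, hS₁]; nlinarith
  have hRL : 2 * R + 1 ≤ L := hRS.trans hrL
  have hL1 : (1 : ℝ) ≤ L := by exact_mod_cast (by omega : 1 ≤ L)
  -- Inverse tunneling is used with energy radius `2 * ε`, and this `D` gives equality in `16 * (2 *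
  -- ε / D) ≤ θ`. The threshold `δ * θ / 32` for ε keeps the enlarged window inside `I`.
  obtain ⟨D, hD⟩ : ∃ D, D = 32 * ε / θ := ⟨_, rfl⟩
  have hD0 : 0 < D := by rw [hD]; positivity
  have hDδ : D ≤ δ := by
    rw [hD, div_le_iff₀ hθ0]; linarith
  have hDε : 32 * ε ≤ D := by
    rw [hD, le_div_iff₀ hθ0]; nlinarith
  -- The largest diagonal threshold allowed by the truncation estimate. The choice of κ then
  -- satisfies its own condition with a factor `G * L` to spare, and `L ^ 3 / κ` produces the power
  -- `L ^ 5 / ε ^ 3`.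
  set τ := ε ^ 2 / (2 * (G * L)) with hτ
  have hτ0 : 0 < τ := by positivity
  set κ := ε ^ 3 / (2 * (G * L) ^ 2) with hκ
  have hκ0 : 0 < κ := by positivity
  set w := 3 * (2 * R + 1) * (C * (2 * D) ^ s * (2 * R + 1 : ℝ) ^ ρ) ^ 2 with hw
  set t := K * Real.exp (-(r : ℝ) ^ ξ) / κ with ht
  have hEabs : |E| ≤ E₀ := hE₀ E hE
  have htail : ∀ x y : boxL L, (r : ℤ) ≤ |(x : ℤ) - y| →
      μ {ω | κ ≤ |projKernel (a ω) (V ω) L E ε x y|} ≤ ENNReal.ofReal t := fun x y hxy =>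
    measure_projKernel_ge_le ha hV hξ hK (hsubI E hE _ (by linarith)) hκ0 x y hxy
  have hdouble : ∀ m : ℤ, 0 ≤ m → μ {ω | HasTwoEigenvaluesIn (a ω) (V ω)
      (Finset.Icc m (m + 2 * R)) (Set.Icc (E - 2 * ε) (E + 2 * ε))} ≤ ENNReal.ofReal w :=
    fun m hm => measure_hasTwoEigenvaluesIn_le (B := B) (Em := Em) (θ := θ) (D := D) hS hW hC.le
      hρ hM hbdd (by linarith) hB (hP ▸ hθP) (by linarith) hD0 (by linarith)
      (by rw [hD]; apply le_of_eq; field_simp; norm_num) (by linarith) (hsubI E hE D hDδ)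
      (by omega) hm
  have hτ2 : 2 * ((1 + 4 * M ^ 2) * L * τ) ≤ ε ^ 2 := by
    rw [hτ, ← hG]; apply le_of_eq; field_simp
  have hκ2 : (1 + 4 * M ^ 2) * L * κ ^ 2 ≤ ε ^ 2 * τ ^ 2 := by
    have : (1 + 4 * M ^ 2) * L * κ ^ 2 = ε ^ 2 * τ ^ 2 / (G * L) := by
      rw [hκ, hτ, ← hG]; field_simp
    rw [this]
    exact div_le_self (by positivity) (one_le_mul_of_one_le_of_one_le hG1 hL1)
  have hbdd' : ∀ᵐ ω ∂μ, ∀ n : ℤ, |a ω n| ≤ M := hbdd.mono fun ω h n => (h n).2.1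
  have hw0 : 0 ≤ w := by positivity
  have ht0 : 0 ≤ t := by positivity
  clear_value R τ κ w t
  have hmain := minamiSum_le_counts (μ := μ) (a := a) (V := V) (M := M) (ε := ε) (E := E)
    (κ := κ) (τ := τ) (w := w) (t := t) (L := L) (r := r) (R := R) hS hW hC.le hρ hbdd' hr hR hRL hε.le (by linarith) hτ0 hτ2 hκ2
    (hsubI E hE _ (by linarith)) hw0 ht0 hdouble htail
  refine hmain.trans (ENNReal.ofReal_le_ofReal ?_)
  have e1 : (L : ℝ) ^ 2 * (C * (4 * ε) ^ s * (3 * r : ℝ) ^ ρ) ^ 2 =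
      A₁ ^ 2 * (ε ^ s * L * (r : ℝ) ^ ρ) ^ 2 := by
    rw [Real.mul_rpow (by norm_num) hε.le, Real.mul_rpow (by norm_num) (by linarith), hA₁]
    ring
  have e2 : (L : ℝ) * ((2 * R + 1) * w) ≤
      3 * S₁ ^ 2 * A₂ ^ 2 * (L * (ε ^ s * (r * (r : ℝ) ^ ρ)) ^ 2) := by
    have hRS' : (2 * R + 1 : ℝ) ≤ S₁ * r := by exact_mod_cast hRS
    have h1 : (2 * D) ^ s = (64 / θ) ^ s * ε ^ s := by
      rw [← Real.mul_rpow (by positivity) hε.le, hD]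
      congr 1
      ring
    have h2 : (2 * R + 1 : ℝ) ^ ρ ≤ (S₁ : ℝ) ^ ρ * (r : ℝ) ^ ρ := by
      rw [← Real.mul_rpow (by positivity) (by positivity)]
      exact Real.rpow_le_rpow (by positivity) hRS' hρ
    rw [hw, h1]
    calc (L : ℝ) * ((2 * R + 1) * (3 * (2 * R + 1) *
          (C * ((64 / θ) ^ s * ε ^ s) * (2 * R + 1 : ℝ) ^ ρ) ^ 2))
        ≤ L * ((S₁ * r) * (3 * (S₁ * r) *
          (C * ((64 / θ) ^ s * ε ^ s) * ((S₁ : ℝ) ^ ρ * (r : ℝ) ^ ρ)) ^ 2)) := by gcongr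
      _ = _ := by rw [hA₂]; ring
  have e3 : (L : ℝ) * (L ^ 2 * t) = 2 * G ^ 2 * K *
      ((L : ℝ) ^ 5 / ε ^ 3 * Real.exp (-(r : ℝ) ^ ξ)) := by
    rw [ht, hκ]; field_simp
  rw [e1, e3]
  refine (add_le_add_left (add_le_add_right e2 _) _).trans ?_
  set X := (ε ^ s * L * (r : ℝ) ^ ρ) ^ 2
  set Y := L * (ε ^ s * (r * (r : ℝ) ^ ρ)) ^ 2
  set Z := (L : ℝ) ^ 5 / ε ^ 3 * Real.exp (-(r : ℝ) ^ ξ)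
  have hX : 0 ≤ X := by positivity
  have hY : 0 ≤ Y := by positivity
  have hZ : 0 ≤ Z := by positivity
  exact weighted_sum_le (by positivity) (by positivity) (by positivity) hX hY hZ

end MinamiSum

/-! ### Choice of the length scale -/

section Scales

theorem eventually_mul_rpow_le_rpow {x y : ℝ} (hxy : x < y) (c : ℝ) :
    ∀ᶠ z : ℝ in Filter.atTop, c * z ^ x ≤ z ^ y := by
  filter_upwards [(tendsto_rpow_atTop (sub_pos.2 hxy)).eventually_ge_atTop c,
    Filter.eventually_gt_atTop 0] with z hz hz0
  calc c * z ^ x ≤ z ^ (y - x) * z ^ x := by gcongr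
    _ = z ^ y := by rw [← Real.rpow_add hz0]; ring_nf

/-- The estimate at one scale, from the basic one. -/
theorem bound_at_scale {A ε₁ s ρ β ξ : ℝ} (hA : 0 < A) (hε₁ : 0 < ε₁) (hs : 0 < s) (hρ : 0 ≤ ρ)
    (hβ : ρ ≤ β) (hξ : 0 < ξ) {S L : ℕ} {l err ε₀ : ℝ} {F : ℝ → ℝ≥0∞}
    (hcore : ∀ r : ℕ, 1 ≤ r → S * r ≤ L → ∀ ε : ℝ, 0 < ε → ε ≤ ε₁ → F ε ≤ ENNReal.ofReal
        (A * ((ε ^ s * L * (r : ℝ) ^ ρ) ^ 2 + L * (ε ^ s * (r * (r : ℝ) ^ ρ)) ^ 2 +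
          (L : ℝ) ^ 5 / ε ^ 3 * Real.exp (-(r : ℝ) ^ ξ))))
    (hmono : ∀ ε ε', ε ≤ ε' → F ε ≤ F ε') (htriv : ∀ ε, F ε ≤ ENNReal.ofReal L)
    (hl : 1 ≤ l) (hL : 1 ≤ L) (hSl : 2 * S * l ≤ L) (hε₀ : 0 < ε₀) (hε₀₁ : ε₀ ≤ ε₁)
    (hrho : L * (l * l ^ ρ) ^ 2 ≤ (L * l ^ β) ^ 2) (herr : 0 ≤ err)
    (h₁ : (L : ℝ) ^ 5 / ε₀ ^ 3 * Real.exp (-l ^ ξ) ≤ err)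
    (h₂ : (ε₀ ^ s * L * l ^ β) ^ 2 ≤ err) {ε : ℝ} (hε : 0 < ε) :
    F ε ≤ ENNReal.ofReal ((A * (2 * (2 * 2 ^ ρ) ^ 2 + 1 + 2 * (2 * 2 ^ ρ) ^ 2) +
      1 / (ε₁ ^ s) ^ 2) * ((ε ^ s * L * l ^ β) ^ 2 + err)) := by
  have hL1 : (1 : ℝ) ≤ L := by exact_mod_cast hL
  have hl0 : 0 < l := by linarith
  have hlβ : 1 ≤ l ^ β := Real.one_le_rpow hl (hρ.trans hβ)
  set X := (ε ^ s * L * l ^ β) ^ 2 with hX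
  have hX0 : 0 ≤ X := by positivity
  set Q : ℝ := (2 * 2 ^ ρ) ^ 2 with hQ
  have hQ0 : 0 ≤ Q := by positivity
  have hi0 : 0 ≤ 1 / (ε₁ ^ s) ^ 2 := by positivity
  -- Below `ε₁` the basic estimate is applied at `max ε ε₀`, which keeps the negative power of ε
  -- bounded. Above it, the trivial bound `L` is already dominated by a constant times `X`.
  rcases le_or_gt ε ε₁ with hle | hgt
  · set e := max ε ε₀ with he
    have he0 : 0 < e := lt_max_of_lt_left hε
    set r := ⌈l⌉₊ with hr
    have hlr : l ≤ r := Nat.le_ceil l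
    have hr2 : (r : ℝ) ≤ 2 * l := by
      have := Nat.ceil_lt_add_one hl0.le
      linarith
    have hr1 : 1 ≤ r := by
      have : (1 : ℝ) ≤ r := hl.trans hlr
      exact_mod_cast this
    have hSr : S * r ≤ L := by
      have : (S * r : ℝ) ≤ L := by
        calc (S * r : ℝ) ≤ S * (2 * l) := by gcongr
          _ ≤ L := by linarith
      exact_mod_cast this
    have hcr := hcore r hr1 hSr e he0 (max_le hle hε₀₁)
    refine (hmono ε e (le_max_left _ _)).trans (hcr.trans (ENNReal.ofReal_le_ofReal ?_))
    have hes : (e ^ s * L * l ^ β) ^ 2 ≤ X + err := by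
      rcases max_choice ε ε₀ with h | h
      · rw [he, h]; linarith
      · rw [he, h]; linarith
    have hrρ : (r : ℝ) ^ ρ ≤ 2 ^ ρ * l ^ ρ := by
      rw [← Real.mul_rpow (by norm_num) hl0.le]
      exact Real.rpow_le_rpow (Nat.cast_nonneg _) hr2 hρ
    have t1 : (e ^ s * L * (r : ℝ) ^ ρ) ^ 2 ≤ Q * (X + err) := by
      calc (e ^ s * L * (r : ℝ) ^ ρ) ^ 2 ≤ (e ^ s * L * (2 ^ ρ * l ^ β)) ^ 2 := by
            gcongr
            exact hrρ.trans (by gcongr)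
        _ = (2 ^ ρ) ^ 2 * (e ^ s * L * l ^ β) ^ 2 := by ring
        _ ≤ (2 * 2 ^ ρ) ^ 2 * (X + err) := by
            gcongr
            linarith [Real.rpow_pos_of_pos (by norm_num : (0 : ℝ) < 2) ρ]
    have t2 : L * (e ^ s * (r * (r : ℝ) ^ ρ)) ^ 2 ≤ Q * (X + err) := by
      calc L * (e ^ s * (r * (r : ℝ) ^ ρ)) ^ 2
          ≤ L * (e ^ s * ((2 * l) * (2 ^ ρ * l ^ ρ))) ^ 2 := by gcongr
        _ = Q * ((e ^ s) ^ 2 * (L * (l * l ^ ρ) ^ 2)) := by rw [hQ]; ring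
        _ ≤ Q * ((e ^ s) ^ 2 * (L * l ^ β) ^ 2) := by gcongr
        _ = Q * (e ^ s * L * l ^ β) ^ 2 := by ring
        _ ≤ Q * (X + err) := by gcongr
    have t3 : (L : ℝ) ^ 5 / e ^ 3 * Real.exp (-(r : ℝ) ^ ξ) ≤ X + err := by
      calc (L : ℝ) ^ 5 / e ^ 3 * Real.exp (-(r : ℝ) ^ ξ)
          ≤ (L : ℝ) ^ 5 / ε₀ ^ 3 * Real.exp (-l ^ ξ) := by
            gcongr
            exact le_max_right _ _
        _ ≤ X + err := by linarith
    have hXe : 0 ≤ X + err := by linarith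
    calc _ ≤ A * (Q * (X + err) + Q * (X + err) + (X + err)) := by gcongr
      _ ≤ _ := by nlinarith [mul_nonneg hi0 hXe, mul_nonneg (mul_nonneg hA.le hQ0) hXe]
  · refine (htriv ε).trans (ENNReal.ofReal_le_ofReal ?_)
    have h3 : (L : ℝ) ≤ 1 / (ε₁ ^ s) ^ 2 * X := by
      have h4 : ε₁ ^ s ≤ ε ^ s := Real.rpow_le_rpow hε₁.le hgt.le hs.le
      have h5 : (ε₁ ^ s * L * 1) ^ 2 ≤ X := by rw [hX]; gcongr
      have h6 : 0 < ε₁ ^ s := Real.rpow_pos_of_pos hε₁ s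
      calc (L : ℝ) ≤ L ^ 2 := by nlinarith
        _ = 1 / (ε₁ ^ s) ^ 2 * (ε₁ ^ s * L * 1) ^ 2 := by field_simp
        _ ≤ _ := by gcongr
    have h7 : 0 ≤ A * (2 * Q + 1 + 2 * Q) * (X + err) := by positivity
    nlinarith [mul_nonneg hi0 herr]

end Scales

section Scales

/-- Combining the basic estimate with a length scale `l(L)` that dominates `log L` and the
logarithm of the error term. -/
theorem exists_bound_of_scale {Ω : Type*} [MeasurableSpace Ω] {μ : Measure Ω}
    [IsProbabilityMeasure μ] {a V : Ω → ℤ → ℝ} {J : Set ℝ} {s ρ β ξ₀ c : ℝ}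
    (hcore : ∀ ξ : ℝ, 0 < ξ → ξ < 1 → ∃ A : ℝ, 0 < A ∧ ∃ ε₁ : ℝ, 0 < ε₁ ∧ ∃ S : ℕ,
      ∀ E ∈ J, ∀ L r : ℕ, 1 ≤ r → S * r ≤ L →
      ∀ ε : ℝ, 0 < ε → ε ≤ ε₁ → minamiSum μ a V L E ε ≤ ENNReal.ofReal
        (A * ((ε ^ s * L * (r : ℝ) ^ ρ) ^ 2 + L * (ε ^ s * (r * (r : ℝ) ^ ρ)) ^ 2 +
          (L : ℝ) ^ 5 / ε ^ 3 * Real.exp (-(r : ℝ) ^ ξ))))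
    (hs : 0 < s) (hρ : 0 ≤ ρ) (hβ : ρ ≤ β) (hξ₀ : 0 < ξ₀) (hξ₁ : ξ₀ < 1)
    {l err : ℕ → ℝ} (hl : Filter.Tendsto l Filter.atTop Filter.atTop)
    (hlog : ∀ᶠ L : ℕ in Filter.atTop, Real.log L ≤ l L ^ ξ₀)
    (herr : ∀ᶠ L : ℕ in Filter.atTop, Real.exp (-(c * l L ^ ξ₀)) ≤ err L)
    (hlin : ∀ k : ℝ, ∀ᶠ L : ℕ in Filter.atTop, k * l L ≤ L)
    (hquad : ∀ᶠ L : ℕ in Filter.atTop, L * (l L * l L ^ ρ) ^ 2 ≤ (L * l L ^ β) ^ 2) :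
    ∃ C : ℝ, 0 < C ∧ ∃ L₀ : ℕ, 0 < L₀ ∧ ∀ E ∈ J, ∀ L : ℕ, L₀ ≤ L → 0 ≤ err L ∧
      ∀ ε : ℝ, 0 < ε → minamiSum μ a V L E ε ≤
        ENNReal.ofReal (C * ((ε ^ s * L * l L ^ β) ^ 2 + err L)) := by
  -- Three exponents `ξ₀ < ξ' < ξ`: powers of `L` and of `l` cost at most `exp (const * l ^ ξ₀)`,
  -- the floor for ε is `exp (-l ^ ξ')`, and localization gains `exp (-l ^ ξ)`. The gain beats every
  -- inverse power of the floor, while the floor beats the polynomial factors.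
  obtain ⟨ξ', h1, h2⟩ := exists_between hξ₁
  obtain ⟨ξ, h3, h4⟩ := exists_between h2
  obtain ⟨A, hA, ε₁, hε₁, S, hcore⟩ := hcore ξ (by linarith) h4
  have hscale : ∀ᶠ y : ℝ in Filter.atTop, 1 ≤ y ∧ (2 * (5 + c)) * y ^ ξ₀ ≤ y ^ ξ ∧
      (2 * 3) * y ^ ξ' ≤ y ^ ξ ∧ (2 + 2 * (β / ξ₀) + c) * y ^ ξ₀ ≤ (2 * s) * y ^ ξ' ∧
      Real.exp (-y ^ ξ') ≤ ε₁ := by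
    have e4 := eventually_mul_rpow_le_rpow h1 ((2 + 2 * (β / ξ₀) + c) / (2 * s))
    have e5 : Filter.Tendsto (fun y : ℝ => Real.exp (-y ^ ξ')) Filter.atTop (nhds 0) :=
      Real.tendsto_exp_neg_atTop_nhds_zero.comp (tendsto_rpow_atTop (by linarith))
    filter_upwards [Filter.eventually_ge_atTop 1,
      eventually_mul_rpow_le_rpow (h1.trans h3) (2 * (5 + c)),
      eventually_mul_rpow_le_rpow h3 (2 * 3), e4, e5.eventually_le_const hε₁]
      with y y1 y2 y3 y4 y5
    refine ⟨y1, y2, y3, ?_, y5⟩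
    have : (2 + 2 * (β / ξ₀) + c) * y ^ ξ₀ =
      (2 * s) * ((2 + 2 * (β / ξ₀) + c) / (2 * s) * y ^ ξ₀) := by field_simp
    rw [this]
    gcongr
  have hall := (hl.eventually hscale).and (hlog.and (herr.and ((hlin (2 * S)).and
    (hquad.and (Filter.eventually_ge_atTop 1)))))
  obtain ⟨L₀, hL₀⟩ := Filter.eventually_atTop.1 hall
  have hi0 : 0 < 1 / (ε₁ ^ s) ^ 2 := by positivity
  refine ⟨_, add_pos (by positivity : 0 < A * (2 * (2 * 2 ^ ρ) ^ 2 + 1 + 2 * (2 * 2 ^ ρ) ^ 2)) hi0,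
    max L₀ 1, by positivity, fun E hE L hL => ?_⟩
  obtain ⟨⟨y1, y2, y3, y4, y5⟩, z1, z2, z3, z4, z5⟩ := hL₀ L ((le_max_left _ _).trans hL)
  have herr0 : 0 ≤ err L := (Real.exp_pos _).le.trans z2
  refine ⟨herr0, fun ε hε => ?_⟩
  have hL1 : (1 : ℝ) ≤ L := by exact_mod_cast z5
  have hLpos : (0 : ℝ) < L := by linarith
  have hl0 : 0 < l L := by linarith
  have hLexp : (L : ℝ) ≤ Real.exp (l L ^ ξ₀) := by
    rw [← Real.exp_log hLpos]; exact Real.exp_le_exp.2 z1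
  refine bound_at_scale (ξ := ξ) (ε₀ := Real.exp (-l L ^ ξ')) (F := fun ε => minamiSum μ a V L E ε)
    hA hε₁ hs hρ hβ (by linarith) (hcore E hE L) (fun _ _ h => minamiSum_mono L E h)
    (fun _ => minamiSum_le L E _) y1 z5 z3 (Real.exp_pos _) y5 z4 herr0 ?_ ?_ hε
  · calc (L : ℝ) ^ 5 / Real.exp (-l L ^ ξ') ^ 3 * Real.exp (-l L ^ ξ)
        ≤ Real.exp (l L ^ ξ₀) ^ 5 / Real.exp (-l L ^ ξ') ^ 3 * Real.exp (-l L ^ ξ) := by gcongr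
      _ = Real.exp (5 * l L ^ ξ₀ + 3 * l L ^ ξ' - l L ^ ξ) := by
          rw [← Real.exp_nat_mul, ← Real.exp_nat_mul, ← Real.exp_sub, ← Real.exp_add]
          congr 1; push_cast; ring
      _ ≤ Real.exp (-(c * l L ^ ξ₀)) := Real.exp_le_exp.2 (by linarith)
      _ ≤ err L := z2
  · have hlβ : l L ^ β ≤ Real.exp (β / ξ₀ * l L ^ ξ₀) := by
      rw [Real.rpow_def_of_pos hl0]
      refine Real.exp_le_exp.2 ?_
      have := Real.log_le_rpow_div hl0.le hξ₀
      calc Real.log (l L) * β ≤ l L ^ ξ₀ / ξ₀ * β := by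
            gcongr; exact hρ.trans hβ
        _ = β / ξ₀ * l L ^ ξ₀ := by ring
    calc (Real.exp (-l L ^ ξ') ^ s * L * l L ^ β) ^ 2
        ≤ (Real.exp (-l L ^ ξ') ^ s * Real.exp (l L ^ ξ₀) * Real.exp (β / ξ₀ * l L ^ ξ₀)) ^ 2 := by
          gcongr
      _ = Real.exp (-(2 * s * l L ^ ξ') + (2 + 2 * (β / ξ₀)) * l L ^ ξ₀) := by
          rw [← Real.exp_mul, ← Real.exp_add, ← Real.exp_add, ← Real.exp_nat_mul]
          congr 1; push_cast; ring
      _ ≤ Real.exp (-(c * l L ^ ξ₀)) := Real.exp_le_exp.2 (by linarith)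
      _ ≤ err L := z2

/-- The terms `e` and `exp z` only enlarge the right side, since `e ≥ 0` and `exp z ≥ 1`; this
passes from the sharper bound to the stated one. -/
theorem mul_sq_add_le {C X e err z : ℝ} (hC : 0 ≤ C) (hX : 0 ≤ X) (he : 0 ≤ e) (hz : 0 ≤ z) :
    C * (X ^ 2 + err) ≤ C * ((X + e) ^ 2 * Real.exp z + err) := by
  gcongr
  calc X ^ 2 = X ^ 2 * 1 := by ring
    _ ≤ (X + e) ^ 2 * Real.exp z := by
      gcongr
      · linarith
      · exact Real.one_le_exp hz

theorem mul_log_rpow_le (k η : ℝ) : ∀ᶠ L : ℕ in Filter.atTop, k * Real.log L ^ η ≤ L := by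
  have h := (isLittleO_log_rpow_rpow_atTop η (by norm_num : (0 : ℝ) < 1)).bound
    (by positivity : 0 < 1 / (|k| + 1))
  filter_upwards [tendsto_natCast_atTop_atTop.eventually h,
    tendsto_natCast_atTop_atTop.eventually (Filter.eventually_ge_atTop (1 : ℝ))] with L hL hL1
  rw [Real.rpow_one, Real.norm_eq_abs, Real.norm_eq_abs, abs_of_nonneg (by linarith : (0 : ℝ) ≤ L),
    div_mul_eq_mul_div, one_mul, le_div_iff₀ (by positivity)] at hL
  have h1 := le_abs_self (Real.log L ^ η)
  have h2 := le_abs_self k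
  have h3 := abs_nonneg (Real.log L ^ η)
  calc k * Real.log L ^ η ≤ |k * Real.log L ^ η| := le_abs_self _
    _ = |Real.log L ^ η| * |k| := by rw [abs_mul, mul_comm]
    _ ≤ L := by nlinarith [abs_nonneg k]

end Scales

/-! ### The two length scales of the theorem -/

theorem mainTheorem4 {Ω : Type*} [MeasurableSpace Ω] (μ : Measure Ω) [IsProbabilityMeasure μ]
    (a V : Ω → ℤ → ℝ) (ha : Measurable a) (hV : Measurable V)
    (hbdd : ∃ M : ℝ, 0 < M ∧ ∀ᵐ ω ∂μ, ∀ n : ℤ, 1 / M ≤ |a ω n| ∧ |a ω n| ≤ M ∧ |V ω n| ≤ M)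
    (I : Set ℝ) (hI : IsOpen I) (hIb : Bornology.IsBounded I)
    (s ρ : ℝ) (hs : 0 < s) (hs1 : s ≤ 1) (hρ : 1 ≤ ρ)
    (hIAD : IndepAtDistance μ a V) (hW : WegnerEstimate μ a V I s ρ)
    (hLoc : LocalizedOn μ a V I)
    (J : Set ℝ) (hJ : IsCompact J) (hJI : J ⊆ I) :
    (∀ p η β ρ' : ℝ, 0 < p → 1 < η → max (1 + 4 * s) ρ < β → ρ < ρ' →
      ∃ C : ℝ, 0 < C ∧ ∃ L₀ : ℕ, 0 < L₀ ∧
        ∀ E ∈ J, ∀ L : ℕ, L₀ ≤ L → ∀ ε : ℝ, 0 < ε → ε < 1 →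
        ∀ l : ℝ, l = Real.log L ^ η →
          minamiSum μ a V L E ε ≤ ENNReal.ofReal
            (C * ((ε ^ s * L * l ^ β + Real.exp (-l / 8)) ^ 2 *
                Real.exp (C * ε ^ s * L * l ^ ρ') + (L : ℝ) ^ (-p)))) ∧
    (∀ α ν β ρ' : ℝ, 0 < α → α < 1 → 0 < ν → ν < α → 1 + 4 * s + ρ < β → ρ < ρ' →
      ∃ C : ℝ, 0 < C ∧ ∃ L₀ : ℕ, 0 < L₀ ∧
        ∀ E ∈ J, ∀ L : ℕ, L₀ ≤ L → ∀ ε : ℝ, 0 < ε → ε < 1 →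
        ∀ l : ℝ, l = (L : ℝ) ^ α →
          minamiSum μ a V L E ε ≤ ENNReal.ofReal
            (C * ((ε ^ s * L * l ^ β + Real.exp (-l / 8)) ^ 2 *
                Real.exp (C * ε ^ s * L * l ^ ρ') + Real.exp (-(L : ℝ) ^ ν)))) := by
  have hρ0 : 0 ≤ ρ := by linarith
  have hcore := fun (ξ : ℝ) (h0 : 0 < ξ) (h1 : ξ < 1) =>
    exists_minamiSum_le ha hV hbdd hI hρ0 hIAD hW hLoc hJ hJI h0 h1
  have hnat : Filter.Tendsto (fun L : ℕ => (L : ℝ)) Filter.atTop Filter.atTop :=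
    tendsto_natCast_atTop_atTop
  constructor
  · intro p η β ρ' hp hη hβ _
    have hρβ : ρ ≤ β := ((le_max_right _ _).trans_lt hβ).le
    -- With `ξ₀ > 1 / η` the power `l ^ ξ₀` dominates `log L`, so `exp (-p * l ^ ξ₀)` is at most `L
    -- ^ (-p)`.
    obtain ⟨ξ₀, h1, h2⟩ := exists_between (inv_lt_one_of_one_lt₀ hη)
    have hη0 : 0 < η := by linarith
    have hξ₀ : 0 < ξ₀ := (inv_pos.2 hη0).trans h1
    have hηξ : 1 ≤ η * ξ₀ := by
      rw [inv_lt_iff_one_lt_mul₀ hη0] at h1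
      linarith
    have hloginf : Filter.Tendsto (fun L : ℕ => Real.log L) Filter.atTop Filter.atTop :=
      Real.tendsto_log_atTop.comp hnat
    have hlog : ∀ᶠ L : ℕ in Filter.atTop, Real.log L ≤ (Real.log L ^ η) ^ ξ₀ := by
      filter_upwards [hloginf.eventually_ge_atTop 1] with L hL
      rw [← Real.rpow_mul (by linarith)]
      calc Real.log L = Real.log L ^ (1 : ℝ) := (Real.rpow_one _).symm
        _ ≤ Real.log L ^ (η * ξ₀) := Real.rpow_le_rpow_of_exponent_le hL hηξ
    obtain ⟨C, hC, L₀, hL₀, hmain⟩ := exists_bound_of_scale (β := β) (c := p)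
      (l := fun L : ℕ => Real.log L ^ η) (err := fun L : ℕ => (L : ℝ) ^ (-p)) hcore hs hρ0 hρβ
      hξ₀ h2 ((tendsto_rpow_atTop hη0).comp hloginf) hlog (by
        filter_upwards [hlog, Filter.eventually_ge_atTop 1] with L hL hL1
        have hL0 : (0 : ℝ) < L := by exact_mod_cast hL1
        rw [Real.rpow_def_of_pos hL0]
        refine Real.exp_le_exp.2 ?_
        nlinarith) (fun k => mul_log_rpow_le k η) (by
        -- A polylogarithmic scale has `l ^ 2 ≤ L`, so the spare factor `L` absorbs the extra power
        -- of `l` and `β ≥ ρ` suffices.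
        filter_upwards [mul_log_rpow_le 1 (2 * η), hloginf.eventually_ge_atTop 1] with L hL hL1
        have hl1 : 1 ≤ Real.log L ^ η := Real.one_le_rpow hL1 hη0.le
        have hsq : (Real.log L ^ η) ^ 2 ≤ L := by
          rw [one_mul, mul_comm, Real.rpow_mul (by linarith), Real.rpow_two] at hL
          exact hL
        calc (L : ℝ) * (Real.log L ^ η * (Real.log L ^ η) ^ ρ) ^ 2
            = L * ((Real.log L ^ η) ^ 2 * ((Real.log L ^ η) ^ ρ) ^ 2) := by ring
          _ ≤ L * (L * ((Real.log L ^ η) ^ β) ^ 2) := by gcongr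
          _ = _ := by ring)
    refine ⟨C, hC, max L₀ 1, by positivity, fun E hE L hL ε hε _ l hl => ?_⟩
    have hL1 : 1 ≤ L := (le_max_right _ _).trans hL
    have hl0 : 0 ≤ l := hl ▸ Real.rpow_nonneg (Real.log_nonneg (by exact_mod_cast hL1)) _
    refine ((hmain E hE L ((le_max_left _ _).trans hL)).2 ε hε).trans
      (ENNReal.ofReal_le_ofReal ?_)
    simp only [← hl]
    exact mul_sq_add_le hC.le (by positivity) (Real.exp_pos _).le (by positivity)
  · intro α ν β ρ' hα hα1 hν hνα hβ _
    have hρβ : ρ ≤ β := by linarith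
    have hlinf : Filter.Tendsto (fun L : ℕ => (L : ℝ) ^ α) Filter.atTop Filter.atTop :=
      (tendsto_rpow_atTop hα).comp hnat
    have hpow : ∀ L : ℕ, ((L : ℝ) ^ α) ^ (ν / α) = (L : ℝ) ^ ν := fun L => by
      rw [← Real.rpow_mul (Nat.cast_nonneg _)]
      congr 1
      field_simp
    -- This exponent makes `l ^ ξ₀` equal to `L ^ ν`, hence the error exactly `exp (-L ^ ν)`.
    obtain ⟨C, hC, L₀, hL₀, hmain⟩ := exists_bound_of_scale (β := β) (c := 1) (ξ₀ := ν / α)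
      (l := fun L : ℕ => (L : ℝ) ^ α) (err := fun L : ℕ => Real.exp (-(L : ℝ) ^ ν)) hcore hs hρ0
      hρβ (by positivity) ((div_lt_one hα).2 hνα) hlinf (by
        filter_upwards [hnat.eventually ((isLittleO_log_rpow_atTop hν).bound one_pos)] with L hL
        rw [hpow]
        rw [one_mul, Real.norm_eq_abs, Real.norm_eq_abs,
          abs_of_nonneg (Real.rpow_nonneg (Nat.cast_nonneg _) _)] at hL
        exact (le_abs_self _).trans hL) (by
        filter_upwards with L
        rw [hpow, one_mul]) (fun k => by
        filter_upwards [hnat.eventually (eventually_mul_rpow_le_rpow hα1 k)] with L hL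
        rwa [Real.rpow_one] at hL) (by
        filter_upwards [hlinf.eventually_ge_atTop 1, Filter.eventually_ge_atTop 1] with L hl1 hL
        have hL1 : (1 : ℝ) ≤ L := by exact_mod_cast hL
        -- Here `l ^ 2` may exceed `L`, and the extra power of `l` is paid for by `β ≥ 1 + ρ`.
        have h1 : (L : ℝ) ^ α * ((L : ℝ) ^ α) ^ ρ ≤ ((L : ℝ) ^ α) ^ β := by
          calc (L : ℝ) ^ α * ((L : ℝ) ^ α) ^ ρ = ((L : ℝ) ^ α) ^ (1 + ρ) := by
                rw [Real.rpow_add (by linarith), Real.rpow_one]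
            _ ≤ ((L : ℝ) ^ α) ^ β := Real.rpow_le_rpow_of_exponent_le hl1 (by linarith)
        calc (L : ℝ) * ((L : ℝ) ^ α * ((L : ℝ) ^ α) ^ ρ) ^ 2
            ≤ (L : ℝ) ^ 2 * (((L : ℝ) ^ α) ^ β) ^ 2 := by gcongr; nlinarith
          _ = _ := by ring)
    refine ⟨C, hC, L₀, hL₀, fun E hE L hL ε hε _ l hl => ?_⟩
    have hl0 : 0 ≤ l := hl ▸ Real.rpow_nonneg (Nat.cast_nonneg _) _
    refine ((hmain E hE L hL).2 ε hε).trans (ENNReal.ofReal_le_ofReal ?_)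
    simp only [← hl]
    exact mul_sq_add_le hC.le (by positivity) (Real.exp_pos _).le (by positivity)
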